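/- **Setting.** Let $\Omega\subseteq\mathbb R^n$ be open with $0\in\Omega$ and $f\in C^4(\Omega;\mathbb R^n)$. Suppose that $Df(u)$ has $n$ real distinct eigenvalues $\lambda_1(u)<\dots<\lambda_n(u)$ for $u\in\Omega$ and that each field is genuinely nonlinear ($D\lambda_j(u)v\ne0$ for every $u\in\Omega$ and every $j$-th eigenvector $v\neq 0$ of $Df(u)$) or linearly degenerate ($D\lambda_j(u)v=0$ for all such $u,v$). Let $k_1,\dots,k_n>0$, and near $0$ let $r_j$ be continuous fields of right eigenvectors with $D\lambda_j\cdot r_j=k_j$ if the $j$-th field is genuinely nonlinear and $|r_j|=1$ if it is linearly degenerate; let $l_1,\dots,l_n$ be the dual left eigenvectors, $l_i\cdot r_j=\delta_{ij}$. **Riemann solver.** Let $R_j(\sigma)(u)$ be the integral curve of $r_j$ starting at $u$, and $S_j(\sigma)(u)$ the $C^1$ curve of states $w$ with $f(w)-f(u)=c\,(w-u)$ for some $c\in\mathbb R$ that starts at $u$ with velocity $r_j(u)$, parametrized by $\frac{\partial}{\partial\sigma}\lambda_j(S_j(\sigma)(u))=k_j$ (genuinely nonlinear) or by arc length (linearly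 degenerate). Put $\psi_j(\sigma)=R_j(\sigma)$ for $\sigma\ge0$, $\psi_j(\sigma)=S_j(\sigma)$ for $\sigma<0$, and $\Psi(\sigma)(u)=\psi_n(\sigma_n)\circ\dots\circ\psi_1(\sigma_1)(u)$. For $\rho>0$ let $B_\rho$ be the open ball of radius $\rho$ about $0$, and let $E(u^-,u^+)=\sigma$ be the wave strengths with $u^+=\Psi(\sigma)(u^-)$, all curves being taken inside $B_\rho$. **Domain.** Functions are taken right continuous. For $v\in L^1(\mathbb R;\mathbb R^n)$ piecewise constant with finitely many jumps, such that $E(v(x-),v(x))$ exists for every $x$, let $\sigma_{x,i}=E_i(v(x-),v(x))$, and $$V(v)=\sum_x\sum_i|\sigma_{x,i}|,\qquad Q(v)=\sum|\sigma_{x,i}\sigma_{y,j}|,\qquad \Upsilon(v)=V(v)+C_0\,Q(v),$$ the sum in $Q$ being over the pairs of waves at jump points $x<y$ such that $i>j$, or $i=j$, the $i$-th field is genuinely nonlinear and $\min\{\sigma_{x,i},\sigma_{y,i}\}<0$. Let $\mathcal D^*_\delta$ be the set of these $v$ with $\Upsilon(v)<\delta$, and let $\mathcal D_\delta$ be its closure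 in $L^1$. **Functionals.** Let $u\in L^1$ have a (necessarily unique) right continuous representative of bounded variation, again called $u$, and let $\mu_c$ be the continuous (non-atomic) part of its distributional derivative. Its wave measures are the signed measures $$\mu_i(A)=\int_A l_i(u)\cdot d\mu_c+\sum_{x\in A}E_i(u(x-),u(x+)),\qquad i=1,\dots,n,$$ with positive and negative parts $\mu_i^\pm$ and $|\mu_i|=\mu_i^++\mu_i^-$. For a set $J\subseteq\{1,\dots,n\}$ that contains the indices of all genuinely nonlinear fields, let $$\rho_J=\sum_{j<i}|\mu_i|\otimes|\mu_j|+\sum_{i\in J}\left(\mu_i^-\otimes\mu_i^-+\mu_i^+\otimes\mu_i^-+\mu_i^-\otimes\mu_i^+\right),$$ $$\hat Q(u)=\rho_J\left(\{(x,y)\in\mathbb R^2: x<y\}\right),\qquad \hat\Upsilon(u)=\sum_{i=1}^n|\mu_i|(\mathbb R)+C_0\,\hat Q(u).$$ ($J=\{1,\dots,n\}$ counts the same-family terms of every field; $J=\{i:\ i\text{-th field genuinely nonlinear}\}$ counts the approaching waves as in $Q$.) **Proposition.** There are $R>0$ and $C>0$ such that for every $\rho\in(0,R]$: $B_\rho\subseteq\Omega$;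 for all $u^-,u^+$ in some neighbourhood of $0$ there is exactly one $\sigma$ with $u^+=\Psi(\sigma)(u^-)$, the curves being taken inside $B_\rho$; and for every $C_0\ge C$ there is $\delta_0>0$ such that for every $\delta\in(0,\delta_0)$ each $u\in\mathcal D_\delta$ has a right continuous representative of bounded variation, and, for every $J$ as above, $\hat Q$ and $\hat\Upsilon$ are lower semicontinuous on $\mathcal D_\delta$ with respect to the $L^1$ norm. -/

import Mathlib

open MeasureTheory Set Filter Topology
open scoped ENNReal

/-- The state space `ℝⁿ` with its Euclidean norm. -/
abbrev State (n : ℕ) : Type := EuclideanSpace ℝ (Fin n)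

/-- The data of a system of conservation laws `∂ₜ u + ∂ₓ f(u) = 0` in `n` unknowns: the open set `Ω`
of states, the flux `f`, the eigenvalues `lam j u` and right eigenvectors `r j u` of `Df(u)`, and the
numbers `k j` that fix the length of the genuinely nonlinear eigenvectors.  The conditions that tie
these together are in `ConservationLaw.Admissible`. -/
structure ConservationLaw (n : ℕ) where
  Ω : Set (State n)
  f : State n → State n
  lam : Fin n → State n → ℝ
  r : Fin n → State n → State n
  k : Fin n → ℝ

namespace ConservationLaw

variable {n : ℕ}

/-- The `j`-th field is genuinely nonlinear: `Dλⱼ(u) v ≠ 0` for each `j`-th eigenvector `v ≠ 0`. -/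
def GenuinelyNonlinear (S : ConservationLaw n) (j : Fin n) : Prop :=
  ∀ u ∈ S.Ω, ∀ v : State n, v ≠ 0 → fderiv ℝ S.f u v = S.lam j u • v → fderiv ℝ (S.lam j) u v ≠ 0

/-- The `j`-th field is linearly degenerate: `Dλⱼ(u) v = 0` for each `j`-th eigenvector `v`. -/
def LinearlyDegenerate (S : ConservationLaw n) (j : Fin n) : Prop :=
  ∀ u ∈ S.Ω, ∀ v : State n, fderiv ℝ S.f u v = S.lam j u • v → fderiv ℝ (S.lam j) u v = 0

/-- `f ∈ C⁴(Ω; ℝⁿ)`, the system is strictly hyperbolic, `lam 0 u < lam 1 u < ⋯` are the eigenvalues of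
`Df(u)`, each field is genuinely nonlinear or linearly degenerate, and near the origin `r j` is a
continuous field of `j`-th eigenvectors, with `Dλⱼ · rⱼ = kⱼ > 0` for a genuinely nonlinear field and
`|rⱼ| = 1` for a linearly degenerate one. -/
structure Admissible (S : ConservationLaw n) : Prop where
  isOpen : IsOpen S.Ω
  zero_mem : (0 : State n) ∈ S.Ω
  contDiffOn : ContDiffOn ℝ 4 S.f S.Ω
  strictMono : ∀ u ∈ S.Ω, StrictMono fun j => S.lam j u
  eigenvalue : ∀ u ∈ S.Ω, ∀ j, ∃ v : State n, v ≠ 0 ∧ fderiv ℝ S.f u v = S.lam j u • v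
  field : ∀ j, S.GenuinelyNonlinear j ∨ S.LinearlyDegenerate j
  k_pos : ∀ j, 0 < S.k j
  eigenvector : ∀ j, ∀ᶠ u in 𝓝 (0 : State n),
    ContinuousAt (S.r j) u ∧ fderiv ℝ S.f u (S.r j u) = S.lam j u • S.r j u ∧
      (S.GenuinelyNonlinear j → fderiv ℝ (S.lam j) u (S.r j u) = S.k j) ∧
      (S.LinearlyDegenerate j → ‖S.r j u‖ = 1)

/-- `l i u`: the left eigenvectors dual to the right ones, `lᵢ(u) · rⱼ(u) = δᵢⱼ`, that is, the rows of
the inverse of the matrix with columns `r₁(u), …, rₙ(u)`. -/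
noncomputable def l (S : ConservationLaw n) (i : Fin n) (u : State n) : State n :=
  WithLp.toLp 2 ((Matrix.of fun a j => S.r j u a)⁻¹ i)

/-- `w = Rⱼ(σ)(u)`: the state `w` is reached from `u` at parameter `σ` along the integral curve of
`rⱼ`, inside the region `B`. -/
def IsRarefaction (S : ConservationLaw n) (B : Set (State n)) (j : Fin n)
    (u : State n) (σ : ℝ) (w : State n) : Prop :=
  ∃ γ : ℝ → State n, γ 0 = u ∧ γ σ = w ∧
    ∀ s ∈ uIcc 0 σ, γ s ∈ B ∧ HasDerivWithinAt γ (S.r j (γ s)) (uIcc 0 σ) s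

/-- `w = Sⱼ(σ)(u)`: the state `w` is reached from `u` at parameter `σ` along the `j`-th
Rankine–Hugoniot curve of `u`, i.e. the `C¹` curve of solutions of the Rankine–Hugoniot equations
which starts at `u` with velocity `rⱼ(u)`, inside the region `B`.  Its parameter `s` satisfies
`(d/ds) λⱼ = kⱼ` if the field is genuinely nonlinear and is arc length if it is linearly degenerate. -/
def IsShock (S : ConservationLaw n) (B : Set (State n)) (j : Fin n)
    (u : State n) (σ : ℝ) (w : State n) : Prop :=
  ∃ γ γ' : ℝ → State n, γ 0 = u ∧ γ σ = w ∧ ContinuousOn γ' (uIcc 0 σ) ∧ γ' 0 = S.r j u ∧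
    ∀ s ∈ uIcc 0 σ, γ s ∈ B ∧ HasDerivWithinAt γ (γ' s) (uIcc 0 σ) s ∧
      (∃ c : ℝ, S.f (γ s) - S.f u = c • (γ s - u)) ∧
      (S.GenuinelyNonlinear j → S.lam j (γ s) = S.lam j u + S.k j * s) ∧
      (S.LinearlyDegenerate j → ‖γ' s‖ = 1)

/-- `w = ψⱼ(σ)(u)`: the Lax curve, a rarefaction for `σ ≥ 0` and a shock for `σ < 0`. -/
def IsLax (S : ConservationLaw n) (B : Set (State n)) (j : Fin n)
    (u : State n) (σ : ℝ) (w : State n) : Prop :=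
  (0 ≤ σ ∧ S.IsRarefaction B j u σ w) ∨ (σ < 0 ∧ S.IsShock B j u σ w)

/-- `w = Ψ(σ)(u) = ψₙ(σₙ) ∘ ⋯ ∘ ψ₁(σ₁)(u)`, with all the Lax curves inside the region `B`. -/
def IsWaveDecomposition (S : ConservationLaw n) (B : Set (State n))
    (u : State n) (σ : Fin n → ℝ) (w : State n) : Prop :=
  ∃ ω : Fin (n + 1) → State n, ω 0 = u ∧ ω (Fin.last n) = w ∧
    ∀ i : Fin n, S.IsLax B i (ω i.castSucc) (σ i) (ω i.succ)

open scoped Classical in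
/-- The map `E(u, w)`: the wave strengths `σ` with `w = Ψ(σ)(u)`, computed inside `B` (a small ball
around the origin); zero if there are none. -/
noncomputable def E (S : ConservationLaw n) (B : Set (State n)) (u w : State n) : Fin n → ℝ :=
  if h : ∃ σ, S.IsWaveDecomposition B u σ w then h.choose else 0

/-- The strength `σ_{x,i} = Eᵢ(u(x-), u(x))` of the `i`-th wave at `x` of a right continuous `u`. -/
noncomputable def strength (S : ConservationLaw n) (B : Set (State n)) (u : ℝ → State n)
    (x : ℝ) (i : Fin n) : ℝ :=
  S.E B (Function.leftLim u x) (u x) i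

end ConservationLaw

/-- The points where a right continuous function jumps. -/
def jumpSet {n : ℕ} (u : ℝ → State n) : Set ℝ := {x | Function.leftLim u x ≠ u x}

/-- Right continuous piecewise constant functions with finitely many jumps. -/
structure IsPiecewiseConstant {n : ℕ} (v : ℝ → State n) : Prop where
  right : ∀ x, ∀ᶠ y in 𝓝[>] x, v y = v x
  locally_const : ∃ F : Finset ℝ, ∀ x ∉ F, ∀ᶠ y in 𝓝 x, v y = v x

namespace ConservationLaw

variable {n : ℕ}

/-- The set `𝒜(v)` of pairs of approaching waves of a piecewise constant function. -/
def approaching (S : ConservationLaw n) (B : Set (State n)) (v : ℝ → State n) :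
    Set ((ℝ × Fin n) × (ℝ × Fin n)) :=
  {p | p.1.1 ∈ jumpSet v ∧ p.2.1 ∈ jumpSet v ∧ p.1.1 < p.2.1 ∧
    (p.2.2 < p.1.2 ∨
      (p.1.2 = p.2.2 ∧ S.GenuinelyNonlinear p.1.2 ∧
        min (S.strength B v p.1.1 p.1.2) (S.strength B v p.2.1 p.2.2) < 0))}

/-- The linear Glimm potential `V(v)` of a piecewise constant function. -/
noncomputable def V (S : ConservationLaw n) (B : Set (State n)) (v : ℝ → State n) : ℝ :=
  ∑ᶠ x ∈ jumpSet v, ∑ i, |S.strength B v x i|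

/-- The Glimm interaction potential `Q(v)` of a piecewise constant function. -/
noncomputable def Q (S : ConservationLaw n) (B : Set (State n)) (v : ℝ → State n) : ℝ :=
  ∑ᶠ p ∈ S.approaching B v, |S.strength B v p.1.1 p.1.2 * S.strength B v p.2.1 p.2.2|

/-- `Υ(v) = V(v) + C₀ Q(v)` for a piecewise constant function. -/
noncomputable def Upsilon (S : ConservationLaw n) (B : Set (State n)) (C₀ : ℝ)
    (v : ℝ → State n) : ℝ :=
  S.V B v + C₀ * S.Q B v

/-- `𝒟_δ^*`: the piecewise constant integrable functions with `Υ < δ` (such that the Riemann problem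
at each point has a solution inside `B`; in particular the values are in `B`). -/
def DStar (S : ConservationLaw n) (B : Set (State n)) (C₀ δ : ℝ) :
    Set (Lp (State n) 1 (volume : Measure ℝ)) :=
  {w | ∃ v : ℝ → State n, w =ᵐ[volume] v ∧ IsPiecewiseConstant v ∧
    (∀ x, ∃ σ, S.IsWaveDecomposition B (Function.leftLim v x) σ (v x)) ∧ S.Upsilon B C₀ v < δ}

/-- `𝒟_δ`: the closure of `𝒟_δ^*` in `L¹`. -/
def D (S : ConservationLaw n) (B : Set (State n)) (C₀ δ : ℝ) :
    Set (Lp (State n) 1 (volume : Measure ℝ)) :=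
  closure (S.DStar B C₀ δ)

end ConservationLaw

/-- `u` is a right continuous representative, of bounded variation on `ℝ`, of `w ∈ L¹`. -/
structure IsBVRepresentative {n : ℕ} (w : Lp (State n) 1 (volume : Measure ℝ))
    (u : ℝ → State n) : Prop where
  ae_eq : w =ᵐ[volume] u
  right_continuous : ∀ x, ContinuousWithinAt u (Ici x) x
  boundedVariation : BoundedVariationOn u univ

open scoped Classical in
/-- The (unique) right continuous representative of bounded variation (zero if there is none). -/
noncomputable def bvRepresentative {n : ℕ} (w : Lp (State n) 1 (volume : Measure ℝ)) :
    ℝ → State n :=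
  if h : ∃ u, IsBVRepresentative w u then h.choose else 0

namespace ConservationLaw

variable {n : ℕ}

open scoped Classical in
/-- The wave measure `μᵢ(A) = ∫_A lᵢ(u) · dμ_c + ∑_{x ∈ A} Eᵢ(u(x-), u(x+))` of a right continuous
function `u` of bounded variation, where `μ_c` is the continuous part of its distributional derivative
`h.vectorMeasure`: the restriction to the complement of the countable set of the jumps. -/
noncomputable def waveMeasure (S : ConservationLaw n) (B : Set (State n)) (u : ℝ → State n)
    (i : Fin n) : SignedMeasure ℝ :=
  if h : BoundedVariationOn u univ then
    (h.vectorMeasure.restrict (jumpSet u)ᶜ).withDensity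
        (fun x => innerSL ℝ (S.l i (u x))) (ContinuousLinearMap.id ℝ (State n →L[ℝ] ℝ)) +
      (Measure.count.restrict (jumpSet u)).withDensityᵥ fun x => S.strength B u x i
  else 0

/-- The positive part `μᵢ⁺` of the `i`-th wave measure of `u`. -/
noncomputable def wavePos (S : ConservationLaw n) (B : Set (State n)) (u : ℝ → State n)
    (i : Fin n) : Measure ℝ :=
  (S.waveMeasure B u i).toJordanDecomposition.posPart

/-- The negative part `μᵢ⁻` of the `i`-th wave measure of `u`. -/
noncomputable def waveNeg (S : ConservationLaw n) (B : Set (State n)) (u : ℝ → State n)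
    (i : Fin n) : Measure ℝ :=
  (S.waveMeasure B u i).toJordanDecomposition.negPart

/-- The total variation `|μᵢ| = μᵢ⁺ + μᵢ⁻` of the `i`-th wave measure of `u`. -/
noncomputable def waveAbs (S : ConservationLaw n) (B : Set (State n)) (u : ℝ → State n)
    (i : Fin n) : Measure ℝ :=
  S.wavePos B u i + S.waveNeg B u i

/-- The measure `ρ` of the interacting waves of `u`; the waves of one and the same family `i` are
counted for `i ∈ J`. -/
noncomputable def rho (S : ConservationLaw n) (B : Set (State n)) (J : Finset (Fin n))
    (u : ℝ → State n) : Measure (ℝ × ℝ) :=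
  ∑ i, ∑ j ∈ Finset.univ.filter (· < i), (S.waveAbs B u i).prod (S.waveAbs B u j) +
    ∑ i ∈ J, ((S.waveNeg B u i).prod (S.waveNeg B u i) +
      (S.wavePos B u i).prod (S.waveNeg B u i) + (S.waveNeg B u i).prod (S.wavePos B u i))

/-- The interaction potential `Q̂(w) = ρ({(x, y) | x < y})`, from the wave measures of `w`. -/
noncomputable def QHat (S : ConservationLaw n) (B : Set (State n)) (J : Finset (Fin n))
    (w : Lp (State n) 1 (volume : Measure ℝ)) : ℝ≥0∞ :=
  S.rho B J (bvRepresentative w) {p | p.1 < p.2}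

/-- The Glimm functional `Υ̂(w) = ∑ᵢ |μᵢ|(ℝ) + C₀ Q̂(w)`, from the wave measures of `w`. -/
noncomputable def UpsilonHat (S : ConservationLaw n) (B : Set (State n)) (J : Finset (Fin n))
    (C₀ : ℝ) (w : Lp (State n) 1 (volume : Measure ℝ)) : ℝ≥0∞ :=
  ∑ i, S.waveAbs B (bvRepresentative w) i univ + ENNReal.ofReal C₀ * S.QHat B J w

end ConservationLaw

/-! A supremum of continuous functionals is lower semicontinuous, so the aim is to write `QHat` and
`UpsilonHat` as suprema. Along a finite increasing list of points, consecutive values of `u` are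
joined by the wave fans `E (u a) (u b)`, and `fanQ`, `fanV` are the Glimm potentials of this list of
fans. The functionals of the wave measures are the suprema of `fanQ` and of `fanV + C₀ * fanQ` over
all such lists. This rests on two facts.

Monotonicity under refinement (`fan_sublist_le`): dropping an intermediate state merges two
neighbouring fans. By Glimm's interaction estimate the strengths of the merged fan are the sums of
the old ones up to `K` times the amount of interaction. Merging removes the mutual interaction from
the potential, and the errors meet only a small total strength. Hence `fanQ` drops by at least half
of the amount of interaction, and a large `C₀` pays for the growth of `fanV`. The error involves
only the approaching waves, with same-family terms for the genuinely nonlinear fields, so every `J`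
that contains these fields is allowed.

Approximation (`exists_partition_approx`): the strengths between `u a` and `u b` differ from the
wave measures of `(a, b]` by at most a constant times `|Du|((a, b)) |Du|((a, b])`
(`abs_E_sub_waveMeasure_le`). If the open gaps of a partition carry little variation, these errors
add up to something small. Together the two facts give `IsTame.fan_le` and
`IsTame.exists_partition`, that is, the supremum formula.

Semicontinuity follows in `lowerSemicontinuousOn_of_partition`: a subsequence of an `L¹`-convergent
sequence converges almost everywhere, and by right continuity the points of a partition may be
shifted slightly to the right into the set of convergence, where the continuity of `E` applies.
Elements of `𝒟_δ` have small values and variation because piecewise constant functions with `Υ < δ`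
do (`exists_isTame_of_mem_D`).

The rest proves the properties of the Riemann solver that are collected in `FanEstimates`. The
implicit function theorem, applied to the averaged Jacobian, gives smooth eigenvectors and Hugoniot
curves. Inside a small ball each Lax curve is a displacement `flowMap G` along velocities that are
merely Lipschitz (`exists_isLaxFamily`). Such displacements commute up to `O(|s| |t|)`. Two of one
family merge with the same error, and exactly if the field is linearly degenerate or both are
rarefactions. Reordering two consecutive fans therefore yields Glimm's estimate. Strict
differentiability at the origin suffices to invert the wave fans with a Lipschitz inverse, which is
`E` near the origin. -/

/-! ### Discrete wave patterns -/

/-- The sum of `f a * g b` over the pairs `a`, `b` of entries of a list with `a` before `b`. -/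
def pairSum {α : Type*} (f g : α → ℝ) : List α → ℝ
  | [] => 0
  | a :: W => f a * (W.map g).sum + pairSum f g W

theorem pairSum_append {α : Type*} (f g : α → ℝ) (A B : List α) :
    pairSum f g (A ++ B) = pairSum f g A + pairSum f g B + (A.map f).sum * (B.map g).sum := by
  induction A with
  | nil => simp [pairSum]
  | cons a A ih => simp only [List.cons_append, pairSum, ih, List.map_append, List.sum_append,
      List.map_cons, List.sum_cons]; ring

theorem list_sum_map_nonneg {α : Type*} {f : α → ℝ} (hf : ∀ a, 0 ≤ f a) (A : List α) :
    0 ≤ (A.map f).sum :=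
  List.sum_nonneg (by simpa using fun a _ => hf a)

theorem pairSum_nonneg {α : Type*} {f g : α → ℝ} (hf : ∀ a, 0 ≤ f a) (hg : ∀ a, 0 ≤ g a)
    (A : List α) : 0 ≤ pairSum f g A := by
  induction A with
  | nil => simp [pairSum]
  | cons a A ih =>
    have := mul_nonneg (hf a) (list_sum_map_nonneg hg A)
    simp only [pairSum]; positivity

/-- Merging two neighbouring entries in a sum over ordered pairs. -/
theorem pairSum_merge {α : Type*} {f g : α → ℝ} (hf : ∀ a, 0 ≤ f a) (hg : ∀ a, 0 ≤ g a)
    {a b c : α} {e : ℝ} (hfe : f c ≤ f a + f b + e) (hge : g c ≤ g a + g b + e) (A B : List α) :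
    pairSum f g (A ++ c :: B) + f a * g b ≤
      pairSum f g (A ++ a :: b :: B) + e * ((A.map f).sum + (B.map g).sum) := by
  have h1 := mul_le_mul_of_nonneg_right hfe (list_sum_map_nonneg hg B)
  have h2 := mul_le_mul_of_nonneg_left hge (list_sum_map_nonneg hf A)
  -- The pair formed by `a` and `b` themselves has no counterpart after the merge; it is the gain `f
  -- a * g b`. All other pairs survive, with an error `e` against the entries of `A` or of `B`.
  simp only [pairSum_append, pairSum, List.map_cons, List.sum_cons]
  nlinarith

/-- The positive (for `true`) or negative (for `false`) part of the wave of family `p.2`. -/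
def part {n : ℕ} (p : Bool × Fin n) (σ : Fin n → ℝ) : ℝ :=
  if p.1 then max (σ p.2) 0 else max (-σ p.2) 0

theorem part_nonneg {n : ℕ} (p : Bool × Fin n) (σ : Fin n → ℝ) : 0 ≤ part p σ := by
  unfold part; split_ifs <;> simp

theorem part_le_abs {n : ℕ} (p : Bool × Fin n) (σ : Fin n → ℝ) : part p σ ≤ |σ p.2| := by
  unfold part; split_ifs
  · exact max_le (le_abs_self _) (abs_nonneg _)
  · exact max_le (neg_le_abs _) (abs_nonneg _)

theorem part_true_add_part_false {n : ℕ} (i : Fin n) (σ : Fin n → ℝ) :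
    part (true, i) σ + part (false, i) σ = |σ i| := by
  simp only [part, if_true, Bool.false_eq_true, if_false]
  rcases le_total 0 (σ i) with h | h
  · rw [max_eq_left h, max_eq_right (by linarith), abs_of_nonneg h, add_zero]
  · rw [max_eq_right h, max_eq_left (by linarith), abs_of_nonpos h, zero_add]

theorem abs_part_sub_part_le {n : ℕ} (p : Bool × Fin n) (σ τ : Fin n → ℝ) :
    |part p σ - part p τ| ≤ |σ p.2 - τ p.2| := by
  unfold part; split_ifs
  · exact (abs_max_sub_max_le_abs _ _ _)
  · refine (abs_max_sub_max_le_abs _ _ _).trans (le_of_eq ?_)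
    rw [← abs_neg]; congr 1; ring

theorem part_le_add {n : ℕ} (p : Bool × Fin n) {σ τ ω : Fin n → ℝ} {e : ℝ}
    (h : |ω p.2 - σ p.2 - τ p.2| ≤ e) : part p ω ≤ part p σ + part p τ + e := by
  have h1 := abs_le.1 h
  have h0 : 0 ≤ e := (abs_nonneg _).trans h
  unfold part; split_ifs
  · refine max_le ?_ (by positivity)
    linarith [le_max_left (σ p.2) 0, le_max_left (τ p.2) 0]
  · refine max_le ?_ (by positivity)
    linarith [le_max_left (-σ p.2) 0, le_max_left (-τ p.2) 0]

theorem continuous_part {n : ℕ} (p : Bool × Fin n) : Continuous (part p) := by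
  unfold part; split_ifs <;> fun_prop

/-- The pairs of signed families that are approaching if the first one is on the left, the
interactions in a family being counted for the families in `J`. -/
def approachingParts {n : ℕ} (J : Finset (Fin n)) : Finset ((Bool × Fin n) × (Bool × Fin n)) :=
  Finset.univ.filter fun p =>
    p.2.2 < p.1.2 ∨ (p.1.2 = p.2.2 ∧ p.1.2 ∈ J ∧ ¬ (p.1.1 = true ∧ p.2.1 = true))

theorem approachingParts_mono {n : ℕ} {J J' : Finset (Fin n)} (h : J ⊆ J') :
    approachingParts J ⊆ approachingParts J' := by
  intro p hp
  simp only [approachingParts, Finset.mem_filter, Finset.mem_univ, true_and] at hp ⊢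
  rcases hp with hp | ⟨h1, h2, h3⟩
  · exact Or.inl hp
  · exact Or.inr ⟨h1, h h2, h3⟩

/-- The amount of interaction of the wave fan `σ` with the fan `τ` on its right. -/
def interaction {n : ℕ} (J : Finset (Fin n)) (σ τ : Fin n → ℝ) : ℝ :=
  ∑ p ∈ approachingParts J, part p.1 σ * part p.2 τ

theorem interaction_nonneg {n : ℕ} (J : Finset (Fin n)) (σ τ : Fin n → ℝ) :
    0 ≤ interaction J σ τ :=
  Finset.sum_nonneg fun _ _ => mul_nonneg (part_nonneg _ _) (part_nonneg _ _)

theorem interaction_mono {n : ℕ} {J J' : Finset (Fin n)} (h : J ⊆ J') (σ τ : Fin n → ℝ) :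
    interaction J σ τ ≤ interaction J' σ τ :=
  Finset.sum_le_sum_of_subset_of_nonneg (approachingParts_mono h)
    fun _ _ _ => mul_nonneg (part_nonneg _ _) (part_nonneg _ _)

/-- The total strength of a list of wave fans. -/
def fanV {n : ℕ} (W : List (Fin n → ℝ)) : ℝ := ∑ p : Bool × Fin n, (W.map (part p)).sum

/-- The interaction potential of a list of wave fans. -/
def fanQ {n : ℕ} (J : Finset (Fin n)) (W : List (Fin n → ℝ)) : ℝ :=
  ∑ p ∈ approachingParts J, pairSum (part p.1) (part p.2) W

theorem fanV_nonneg {n : ℕ} (W : List (Fin n → ℝ)) : 0 ≤ fanV W :=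
  Finset.sum_nonneg fun p _ => list_sum_map_nonneg (part_nonneg p) W

theorem fanV_append {n : ℕ} (A B : List (Fin n → ℝ)) : fanV (A ++ B) = fanV A + fanV B := by
  simp [fanV, Finset.sum_add_distrib]

theorem fanV_cons {n : ℕ} (σ : Fin n → ℝ) (B : List (Fin n → ℝ)) :
    fanV (σ :: B) = ∑ i, |σ i| + fanV B := by
  simp only [fanV, List.map_cons, List.sum_cons, Finset.sum_add_distrib]
  congr 1
  rw [Fintype.sum_prod_type_right]
  exact Finset.sum_congr rfl fun i _ => by
    rw [Fintype.sum_bool, part_true_add_part_false]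

theorem sum_map_part_le_fanV {n : ℕ} (p : Bool × Fin n) (W : List (Fin n → ℝ)) :
    (W.map (part p)).sum ≤ fanV W :=
  Finset.single_le_sum (f := fun p => (W.map (part p)).sum)
    (fun p _ => list_sum_map_nonneg (part_nonneg p) W) (Finset.mem_univ p)

/-! ### Merging two neighbouring wave fans. -/

section merge

variable {n : ℕ} {G J : Finset (Fin n)} {K v : ℝ} {σ τ ω : Fin n → ℝ} {A B : List (Fin n → ℝ)}

/-- The mutual interaction of `σ` and `τ` leaves the potential. Each of the at most `(2n)²` pairs of
signed families gains at most the error `K * interaction` times the total strength `v` of the other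
fans. Smallness of `v` makes all these gains together cost at most half of what is won. -/
theorem fanQ_append_cons_le (hGJ : G ⊆ J) (hK : 0 ≤ K)
    (hω : ∀ i, |ω i - σ i - τ i| ≤ K * interaction G σ τ)
    (hv : fanV A + fanV B ≤ v) (hKv : 2 * n * (2 * n) * K * v ≤ 1 / 2) :
    fanQ J (A ++ ω :: B) + interaction J σ τ / 2 ≤ fanQ J (A ++ σ :: τ :: B) := by
  set e := K * interaction J σ τ with he
  have h0 := interaction_nonneg J σ τ
  have he0 : 0 ≤ e := mul_nonneg hK h0
  have hωe : ∀ i, |ω i - σ i - τ i| ≤ e := fun i =>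
    (hω i).trans (mul_le_mul_of_nonneg_left (interaction_mono hGJ σ τ) hK)
  have key : ∀ p ∈ approachingParts J,
      pairSum (part p.1) (part p.2) (A ++ ω :: B) + part p.1 σ * part p.2 τ ≤
        pairSum (part p.1) (part p.2) (A ++ σ :: τ :: B) + e * v := fun p _ => by
    refine (pairSum_merge (part_nonneg _) (part_nonneg _) (part_le_add _ (hωe _))
      (part_le_add _ (hωe _)) A B).trans ?_
    gcongr
    exact (add_le_add (sum_map_part_le_fanV _ _) (sum_map_part_le_fanV _ _)).trans hv
  have hsum := Finset.sum_le_sum key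
  rw [Finset.sum_add_distrib, Finset.sum_add_distrib, Finset.sum_const, nsmul_eq_mul] at hsum
  have hcard : ((approachingParts J).card : ℝ) ≤ 2 * n * (2 * n) := by
    have := Finset.card_le_univ (approachingParts J)
    simp only [Fintype.card_prod, Fintype.card_bool, Fintype.card_fin] at this
    exact_mod_cast this
  have hv0 : 0 ≤ v := le_trans (add_nonneg (fanV_nonneg _) (fanV_nonneg _)) hv
  have h1 : ((approachingParts J).card : ℝ) * (e * v) ≤ interaction J σ τ / 2 := by
    calc ((approachingParts J).card : ℝ) * (e * v) ≤ 2 * n * (2 * n) * (e * v) := by gcongr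
      _ = 2 * n * (2 * n) * K * v * interaction J σ τ := by rw [he]; ring
      _ ≤ 1 / 2 * interaction J σ τ := by gcongr
      _ = _ := by ring
  unfold fanQ
  have : ∑ p ∈ approachingParts J, part p.1 σ * part p.2 τ = interaction J σ τ := rfl
  linarith

theorem fanV_append_cons_le
    (hω : ∀ i, |ω i - σ i - τ i| ≤ K * interaction G σ τ) :
    fanV (A ++ ω :: B) ≤ fanV (A ++ σ :: τ :: B) + n * (K * interaction G σ τ) := by
  simp only [fanV_append, fanV_cons]
  have : ∑ i, |ω i| ≤ ∑ i, (|σ i| + |τ i| + K * interaction G σ τ) := by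
    refine Finset.sum_le_sum fun i _ => ?_
    have h1 := abs_add_three (ω i - σ i - τ i) (σ i) (τ i)
    rw [show ω i - σ i - τ i + σ i + τ i = ω i by ring] at h1
    linarith [hω i]
  simp only [Finset.sum_add_distrib, Finset.sum_const, Finset.card_univ, Fintype.card_fin,
    nsmul_eq_mul] at this
  linarith

end merge

/-- The wave fans that connect the consecutive entries of a list. -/
def waves {α β : Type*} (E : α → α → β) : List α → List β
  | [] => []
  | [_] => []
  | a :: b :: l => E a b :: waves E (b :: l)

theorem waves_append_cons {α β : Type*} (E : α → α → β) (A : List α) (a : α) (B : List α) :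
    waves E (A ++ a :: B) = waves E (A ++ [a]) ++ waves E (a :: B) := by
  induction A with
  | nil => simp [waves]
  | cons x A ih =>
    cases A with
    | nil => simp [waves]
    | cons y A => simpa [waves] using ih

/-- A relation that is stable under the removal of one entry is stable under passing to sublists. -/
theorem List.Sublist.rel_of_erase {α : Type*} {P : List α → List α → Prop}
    (hrefl : ∀ l, P l l) (htrans : ∀ l₁ l₂ l₃, P l₁ l₂ → P l₂ l₃ → P l₁ l₃)
    (herase : ∀ A m B, P (A ++ B) (A ++ m :: B)) {s t : List α} (h : s.Sublist t) : P s t := by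
  -- The common prefix `A` makes the induction work: a head shared by both lists moves into the
  -- prefix.
  have key : ∀ {s t : List α}, s.Sublist t → ∀ A, P (A ++ s) (A ++ t) := by
    intro s t h
    induction h with
    | slnil => exact fun A => hrefl _
    | cons a _ ih => exact fun A => htrans _ _ _ (ih A) (herase A a _)
    | cons_cons a _ ih =>
      intro A
      simpa using ih (A ++ [a])
  exact key h []

/-! ### Monotonicity of the discrete functionals under refinement. -/

section refine

variable {α : Type*} {n : ℕ} {G J : Finset (Fin n)} {K v C₀ : ℝ} {E : α → α → Fin n → ℝ}

theorem fanQ_append_of_nonneg (A B : List (Fin n → ℝ)) : fanQ J B ≤ fanQ J (A ++ B) := by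
  refine Finset.sum_le_sum fun p _ => ?_
  rw [pairSum_append]
  have h1 := pairSum_nonneg (part_nonneg p.1) (part_nonneg p.2) A
  have h2 := mul_nonneg (list_sum_map_nonneg (part_nonneg p.1) A)
    (list_sum_map_nonneg (part_nonneg p.2) B)
  linarith

theorem fanQ_append_of_nonneg' (A B : List (Fin n → ℝ)) : fanQ J A ≤ fanQ J (A ++ B) := by
  refine Finset.sum_le_sum fun p _ => ?_
  rw [pairSum_append]
  have h1 := pairSum_nonneg (part_nonneg p.1) (part_nonneg p.2) B
  have h2 := mul_nonneg (list_sum_map_nonneg (part_nonneg p.1) A)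
    (list_sum_map_nonneg (part_nonneg p.2) B)
  linarith

/-- Removing an intermediate state decreases the interaction potential and the Glimm functional. -/
theorem fan_erase_le (hGJ : G ⊆ J) (hK : 0 ≤ K) (hKv : 2 * n * (2 * n) * K * v ≤ 1 / 2)
    (hC₀ : 2 * n * K ≤ C₀) (A : List α) (m : α) (B : List α)
    (hE : ∀ a ∈ A ++ m :: B, ∀ b ∈ A ++ m :: B, ∀ i,
      |E a b i - E a m i - E m b i| ≤ K * interaction G (E a m) (E m b))
    (hv : fanV (waves E (A ++ m :: B)) ≤ v) :
    fanQ J (waves E (A ++ B)) ≤ fanQ J (waves E (A ++ m :: B)) ∧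
      fanV (waves E (A ++ B)) + C₀ * fanQ J (waves E (A ++ B)) ≤
        fanV (waves E (A ++ m :: B)) + C₀ * fanQ J (waves E (A ++ m :: B)) := by
  have hC0 : 0 ≤ C₀ := le_trans (by positivity) hC₀
  rcases List.eq_nil_or_concat' A with rfl | ⟨A', a, rfl⟩
  -- Removing the first or the last state only drops a fan; a merge takes place for an interior
  -- state alone. `B.take 1` covers an empty and a nonempty `B` at once.
  · have : waves E ([] ++ m :: B) = waves E ([m] ++ B.take 1) ++ waves E B := by
      cases B <;> simp [waves]
    rw [this, List.nil_append]
    have h1 := fanQ_append_of_nonneg (J := J) (waves E ([m] ++ B.take 1)) (waves E B)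
    refine ⟨h1, ?_⟩
    rw [fanV_append]
    have := fanV_nonneg (waves E ([m] ++ B.take 1))
    have := mul_le_mul_of_nonneg_left h1 hC0
    linarith
  · rcases B with _ | ⟨b, B⟩
    · have : waves E (A' ++ [a] ++ [m]) = waves E (A' ++ [a]) ++ [E a m] := by
        rw [List.append_assoc, List.singleton_append, waves_append_cons]; simp [waves]
      rw [this, List.append_nil]
      have h1 := fanQ_append_of_nonneg' (J := J) (waves E (A' ++ [a])) [E a m]
      refine ⟨h1, ?_⟩
      rw [fanV_append]
      have := fanV_nonneg [E a m]
      have := mul_le_mul_of_nonneg_left h1 hC0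
      linarith
    · have e1 : waves E (A' ++ [a] ++ m :: b :: B) =
          waves E (A' ++ [a]) ++ E a m :: E m b :: waves E (b :: B) := by
        rw [List.append_assoc, List.singleton_append, waves_append_cons]; simp [waves]
      have e2 : waves E (A' ++ [a] ++ b :: B) =
          waves E (A' ++ [a]) ++ E a b :: waves E (b :: B) := by
        rw [List.append_assoc, List.singleton_append, waves_append_cons]; simp [waves]
      have hω := hE a (by simp) b (by simp)
      rw [e1] at hv ⊢
      rw [e2]
      have hv' : fanV (waves E (A' ++ [a])) + fanV (waves E (b :: B)) ≤ v := by
        refine le_trans ?_ hv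
        rw [fanV_append, fanV_cons, fanV_cons]
        have h1 : 0 ≤ ∑ i, |E a m i| := Finset.sum_nonneg fun _ _ => abs_nonneg _
        have h2 : 0 ≤ ∑ i, |E m b i| := Finset.sum_nonneg fun _ _ => abs_nonneg _
        linarith
      have hq := fanQ_append_cons_le hGJ hK hω hv' hKv
      have hV := fanV_append_cons_le (A := waves E (A' ++ [a])) (B := waves E (b :: B)) hω
      have h0 := interaction_nonneg J (E a m) (E m b)
      refine ⟨by linarith, ?_⟩
      have h1 := mul_le_mul_of_nonneg_left hq hC0
      -- The `n` strengths may grow by `K * interaction` each. Half of the interaction, weighted by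
      -- `C₀`, was won in the potential, which explains the requirement `2 * n * K ≤ C₀`.
      have h2 : n * (K * interaction G (E a m) (E m b)) ≤ C₀ * (interaction J (E a m) (E m b) / 2) :=
        calc n * (K * interaction G (E a m) (E m b)) ≤ n * (K * interaction J (E a m) (E m b)) := by
              gcongr; exact interaction_mono hGJ _ _
          _ = 2 * n * K * (interaction J (E a m) (E m b) / 2) := by ring
          _ ≤ _ := by gcongr
      linarith

/-- Both functionals are monotone under refinement of a list of states. -/
theorem fan_sublist_le (hGJ : G ⊆ J) (hK : 0 ≤ K) (hKv : 2 * n * (2 * n) * K * v ≤ 1 / 2)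
    (hC₀ : 2 * n * K ≤ C₀) {s t : List α} (hst : s.Sublist t) {S : Set α} (htS : ∀ a ∈ t, a ∈ S)
    (hE : ∀ a ∈ S, ∀ m ∈ S, ∀ b ∈ S, ∀ i,
      |E a b i - E a m i - E m b i| ≤ K * interaction G (E a m) (E m b))
    (hv : ∀ l : List α, l.Sublist t → fanV (waves E l) ≤ v) :
    fanQ J (waves E s) ≤ fanQ J (waves E t) ∧
      fanV (waves E s) + C₀ * fanQ J (waves E s) ≤ fanV (waves E t) + C₀ * fanQ J (waves E t) := by
  -- The relation remembers that all lists are sublists of `t`, so that the bound on the total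
  -- strength is available at every removal.
  refine (hst.rel_of_erase (P := fun s t' => t'.Sublist t → s.Sublist t ∧
    fanQ J (waves E s) ≤ fanQ J (waves E t') ∧ fanV (waves E s) + C₀ * fanQ J (waves E s) ≤
      fanV (waves E t') + C₀ * fanQ J (waves E t')) (fun l hl => ⟨hl, le_rfl, le_rfl⟩) ?_ ?_
      (List.Sublist.refl t)).2
  · intro l₁ l₂ l₃ h12 h23 h3
    obtain ⟨h2, a, b⟩ := h23 h3
    obtain ⟨h1, c, d⟩ := h12 h2
    exact ⟨h1, c.trans a, d.trans b⟩
  · intro A m B h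
    have hsub : (A ++ B).Sublist (A ++ m :: B) :=
      List.Sublist.append (List.Sublist.refl A) (List.sublist_cons_self m B)
    refine ⟨hsub.trans h, fan_erase_le hGJ hK hKv hC₀ A m B (fun a ha b hb => ?_) (hv _ h)⟩
    exact hE a (htS a (h.subset ha)) m (htS m (h.subset (by simp))) b (htS b (h.subset hb))

end refine

/-! ### Ordered pair sums and product measures -/

section pairs

variable {β : Type*} {e : ℝ → ℝ → β} {f g : β → ℝ} {μ ν θ : Measure ℝ} [IsFiniteMeasure μ]
  [IsFiniteMeasure ν] [IsFiniteMeasure θ] {ε M : ℝ}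

theorem List.IsChain.head_le_getLast {R : ℝ → ℝ → Prop} (hR : ∀ x y, R x y → x < y) {a : ℝ}
    {l : List ℝ} (h : List.IsChain R (a :: l)) : a ≤ (a :: l).getLast (by simp) := by
  induction l generalizing a with
  | nil => simp
  | cons b l ih =>
    rw [List.isChain_cons_cons] at h
    rw [List.getLast_cons (by simp)]
    exact (hR _ _ h.1).le.trans (ih h.2)

theorem measureReal_Ioc_split (κ : Measure ℝ) [IsFiniteMeasure κ] {a b c : ℝ} (hab : a ≤ b)
    (hbc : b ≤ c) : κ.real (Ioc a c) = κ.real (Ioc a b) + κ.real (Ioc b c) := by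
  rw [← Ioc_union_Ioc_eq_Ioc hab hbc, measureReal_union _ measurableSet_Ioc]
  exact Set.disjoint_left.2 fun x hx hx' => absurd hx'.1 (not_lt.2 hx.2)

/-- The error on each interval is dominated by a measure `θ`, so that the errors add up without loss
under concatenation. -/
theorem abs_sum_waves_sub_le {a : ℝ} {l : List ℝ}
    (h : List.IsChain (fun x y => x < y ∧ |f (e x y) - μ.real (Ioc x y)| ≤ θ.real (Ioc x y))
      (a :: l)) :
    |((waves e (a :: l)).map f).sum - μ.real (Ioc a ((a :: l).getLast (by simp)))| ≤
      θ.real (Ioc a ((a :: l).getLast (by simp))) := by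
  induction l generalizing a with
  | nil => simp [waves]
  | cons b l ih =>
    have hc := h
    rw [List.isChain_cons_cons] at h
    have hb := h.2.head_le_getLast (fun x y h => h.1)
    specialize ih h.2
    rw [List.getLast_cons (by simp), measureReal_Ioc_split μ h.1.1.le hb,
      measureReal_Ioc_split θ h.1.1.le hb]
    simp only [waves, List.map_cons, List.sum_cons]
    refine le_trans (le_of_eq ?_) ((abs_add_le _ _).trans (add_le_add h.1.2 ih))
    congr 1; ring

/-- The triangle `x < y` over `(a, c]` consists of the rectangle `(a, b] × (b, c]` and the triangles
over `(a, b]` and `(b, c]`. The rectangle corresponds to the products of the first entry with all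
later ones, and the last triangle is left to the induction. The first triangle has no discrete
counterpart and must be small. -/
theorem abs_pairSum_waves_sub_le (hg : ∀ b, 0 ≤ g b)
    (hν : ν.real univ ≤ M) (hθ : θ.real univ ≤ M) {a : ℝ} {l : List ℝ}
    (h : List.IsChain (fun x y => x < y ∧ |f (e x y) - μ.real (Ioc x y)| ≤ θ.real (Ioc x y) ∧
      |g (e x y) - ν.real (Ioc x y)| ≤ θ.real (Ioc x y) ∧ μ.real (Ioo x y) ≤ ε) (a :: l)) :
    |pairSum f g (waves e (a :: l)) - (μ.prod ν).real ({p | p.1 < p.2} ∩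
        Ioc a ((a :: l).getLast (by simp)) ×ˢ Ioc a ((a :: l).getLast (by simp)))| ≤
      2 * M * θ.real (Ioc a ((a :: l).getLast (by simp))) +
      μ.real (Ioc a ((a :: l).getLast (by simp))) * θ.real (Ioc a ((a :: l).getLast (by simp))) +
      ε * ν.real (Ioc a ((a :: l).getLast (by simp))) := by
  induction l generalizing a with
  | nil => simp [waves, pairSum]
  | cons b l ih =>
    have hab := (List.isChain_cons_cons.1 h).1
    have hch := (List.isChain_cons_cons.1 h).2
    have hb := hch.head_le_getLast (fun x y h => h.1)
    have hT := abs_sum_waves_sub_le (f := g) (e := e) (μ := ν) (θ := θ)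
      (hch.imp (fun x y h => ⟨h.1, h.2.2.1⟩))
    specialize ih hch
    rw [List.getLast_cons (by simp)]
    set c := (b :: l).getLast (by simp) with hc
    set T := ((waves e (b :: l)).map g).sum with hTdef
    have hT0 : 0 ≤ T := list_sum_map_nonneg hg _
    have hset : {p : ℝ × ℝ | p.1 < p.2} ∩ Ioc a c ×ˢ Ioc a c =
        ({p : ℝ × ℝ | p.1 < p.2} ∩ Ioc a b ×ˢ Ioc a b) ∪ (Ioc a b ×ˢ Ioc b c ∪
          {p : ℝ × ℝ | p.1 < p.2} ∩ Ioc b c ×ˢ Ioc b c) := by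
      ext ⟨x, y⟩
      simp only [mem_inter_iff, mem_ofPred_eq, mem_prod, mem_Ioc, mem_union]
      have := hab.1
      grind
    have hm : MeasurableSet {p : ℝ × ℝ | p.1 < p.2} := measurableSet_lt measurable_fst measurable_snd
    have hmeas : (μ.prod ν).real ({p | p.1 < p.2} ∩ Ioc a c ×ˢ Ioc a c) =
        (μ.prod ν).real ({p | p.1 < p.2} ∩ Ioc a b ×ˢ Ioc a b) + (μ.real (Ioc a b) *
          ν.real (Ioc b c) + (μ.prod ν).real ({p | p.1 < p.2} ∩ Ioc b c ×ˢ Ioc b c)) := by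
      rw [hset, measureReal_union, measureReal_union, measureReal_prod_prod]
      · refine Set.disjoint_left.2 ?_
        rintro ⟨x, y⟩ ⟨hx, hy⟩ ⟨_, hx', _⟩
        exact absurd hx'.1 (not_lt.2 hx.2)
      · exact hm.inter (measurableSet_Ioc.prod measurableSet_Ioc)
      · refine Set.disjoint_left.2 ?_
        rintro ⟨x, y⟩ ⟨_, hx, hy⟩ (⟨_, hy'⟩ | ⟨_, _, hy'⟩)
        · exact absurd hy'.1 (not_lt.2 hy.2)
        · exact absurd hy'.1 (not_lt.2 hy.2)
      · exact (measurableSet_Ioc.prod measurableSet_Ioc).union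
          (hm.inter (measurableSet_Ioc.prod measurableSet_Ioc))
    -- From `x < y ≤ b` it follows that `x` misses the endpoint `b`. Only the open interval enters,
    -- so a large atom of `μ` at `b` does no harm.
    have hdiag : (μ.prod ν).real ({p | p.1 < p.2} ∩ Ioc a b ×ˢ Ioc a b) ≤ ε * ν.real (Ioc a b) := by
      calc _ ≤ (μ.prod ν).real (Ioo a b ×ˢ Ioc a b) := by
            refine measureReal_mono ?_
            rintro ⟨x, y⟩ ⟨hxy, hx, hy⟩
            exact ⟨⟨hx.1, lt_of_lt_of_le hxy hy.2⟩, hy⟩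
        _ = μ.real (Ioo a b) * ν.real (Ioc a b) := measureReal_prod_prod _ _
        _ ≤ _ := by gcongr; exact hab.2.2.2
    have hd0 : 0 ≤ (μ.prod ν).real ({p | p.1 < p.2} ∩ Ioc a b ×ˢ Ioc a b) := measureReal_nonneg
    rw [hmeas, measureReal_Ioc_split μ hab.1.le hb, measureReal_Ioc_split θ hab.1.le hb,
      measureReal_Ioc_split ν hab.1.le hb]
    simp only [waves, pairSum]
    have hμ0 : 0 ≤ μ.real (Ioc a b) := measureReal_nonneg
    have hμ0' : 0 ≤ μ.real (Ioc b c) := measureReal_nonneg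
    have hθ0 : 0 ≤ θ.real (Ioc a b) := measureReal_nonneg
    have hθ0' : 0 ≤ θ.real (Ioc b c) := measureReal_nonneg
    have hνM : ν.real (Ioc b c) ≤ M := (measureReal_mono (subset_univ _)).trans hν
    have hθM : θ.real (Ioc b c) ≤ M := (measureReal_mono (subset_univ _)).trans hθ
    have hTM : T ≤ 2 * M := by linarith [(abs_le.1 hT).2]
    have h1 : |f (e a b) * T - μ.real (Ioc a b) * ν.real (Ioc b c)| ≤
        θ.real (Ioc a b) * (2 * M) + μ.real (Ioc a b) * θ.real (Ioc b c) := by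
      have : f (e a b) * T - μ.real (Ioc a b) * ν.real (Ioc b c) =
          (f (e a b) - μ.real (Ioc a b)) * T + μ.real (Ioc a b) * (T - ν.real (Ioc b c)) := by ring
      rw [this]
      refine (abs_add_le _ _).trans (add_le_add ?_ ?_)
      · rw [abs_mul, abs_of_nonneg hT0]
        exact mul_le_mul hab.2.1 hTM hT0 hθ0
      · rw [abs_mul, abs_of_nonneg hμ0]
        exact mul_le_mul_of_nonneg_left hT hμ0
    have h2 := abs_le.1 h1
    have h3 := abs_le.1 ih
    have h4 := mul_nonneg hμ0' hθ0
    refine abs_le.2 ⟨?_, ?_⟩ <;> nlinarith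

/-- The pairs outside of a large square are negligible. -/
theorem measureReal_prod_lt_le (hμ : μ.real univ ≤ M) (hν : ν.real univ ≤ M) {a c : ℝ}
    (h1 : μ.real (Ioc a c)ᶜ ≤ ε) (h2 : ν.real (Ioc a c)ᶜ ≤ ε) :
    |(μ.prod ν).real {p | p.1 < p.2} -
      (μ.prod ν).real ({p | p.1 < p.2} ∩ Ioc a c ×ˢ Ioc a c)| ≤ 2 * M * ε := by
  have hsub : (μ.prod ν).real ({p | p.1 < p.2} ∩ Ioc a c ×ˢ Ioc a c) ≤
    (μ.prod ν).real {p | p.1 < p.2} := measureReal_mono inter_subset_left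
  rw [abs_of_nonneg (by linarith)]
  have : (μ.prod ν).real {p | p.1 < p.2} ≤
      (μ.prod ν).real ({p | p.1 < p.2} ∩ Ioc a c ×ˢ Ioc a c) +
        ((μ.prod ν).real ((Ioc a c)ᶜ ×ˢ univ) + (μ.prod ν).real (univ ×ˢ (Ioc a c)ᶜ)) := by
    refine (measureReal_mono ?_).trans ((measureReal_union_le _ _).trans
      (add_le_add le_rfl (measureReal_union_le _ _)))
    rintro ⟨x, y⟩ hxy
    by_cases hx : x ∈ Ioc a c <;> by_cases hy : y ∈ Ioc a c <;> simp_all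
  rw [measureReal_prod_prod, measureReal_prod_prod] at this
  have hM : 0 ≤ M := measureReal_nonneg.trans hμ
  have h3 : μ.real (Ioc a c)ᶜ * ν.real univ ≤ ε * M :=
    mul_le_mul h1 hν measureReal_nonneg (measureReal_nonneg.trans h1)
  have h4 : μ.real univ * ν.real (Ioc a c)ᶜ ≤ M * ε :=
    mul_le_mul hμ h2 measureReal_nonneg hM
  linarith

end pairs

/-! ### Fine partitions -/

/-- A finite set whose gaps inside a compact interval are subordinate to a given family of
neighbourhoods and miss the centres of these. -/
theorem exists_finset_gaps {U : ℝ → Set ℝ} (hU : ∀ x, U x ∈ 𝓝 x) {M : ℝ} {F₀ : Finset ℝ}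
    (hF₀ : ∀ x ∈ F₀, x ∈ Icc (-M) M) :
    ∃ F : Finset ℝ, F₀ ⊆ F ∧ (∀ x ∈ F, x ∈ Icc (-M) M) ∧ ∀ a ∈ F, ∀ b ∈ F, a < b →
      (∀ x ∈ F, x ∉ Ioo a b) → ∃ x, Icc a b ⊆ U x ∧ x ∉ Ioo a b := by
  classical
  have : ∀ x, ∃ d > 0, Icc (x - d) (x + d) ⊆ U x := fun x => by
    obtain ⟨d, hd, h⟩ := Metric.nhds_basis_closedBall.mem_iff.1 (hU x)
    exact ⟨d, hd, by rwa [← Real.closedBall_eq_Icc]⟩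
  choose d hd hdU using this
  obtain ⟨T, -, hT⟩ := (isCompact_Icc (a := -M) (b := M)).elim_nhds_subcover
    (fun x => Ioo (x - d x) (x + d x))
    (fun x _ => Ioo_mem_nhds (by linarith [hd x]) (by linarith [hd x]))
  -- The centres and the endpoints of the covering intervals all become points of `F`. A gap whose
  -- midpoint lies in the interval about `x` then contains neither endpoint, hence lies in that
  -- interval, and it does not contain `x`.
  set F := F₀ ∪ (T.biUnion fun x => {x, x - d x, x + d x}).filter (· ∈ Icc (-M) M) with hFdef
  have hFI : ∀ x ∈ F, x ∈ Icc (-M) M := fun x hx => by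
    rcases Finset.mem_union.1 hx with h | h
    · exact hF₀ x h
    · exact (Finset.mem_filter.1 h).2
  refine ⟨F, Finset.subset_union_left, hFI, ?_⟩
  intro a haF b hbF hab hF
  have hF' : ∀ x ∈ T.biUnion fun x => {x, x - d x, x + d x}, x ∉ Ioo a b := fun x hx hxab =>
    hF x (Finset.mem_union_right _ (Finset.mem_filter.2
      ⟨hx, (hFI a haF).1.trans hxab.1.le, hxab.2.le.trans (hFI b hbF).2⟩)) hxab
  have hmem : (a + b) / 2 ∈ Icc (-M) M :=
    ⟨by linarith [(hFI a haF).1], by linarith [(hFI b hbF).2]⟩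
  obtain ⟨x, hxT, hx⟩ := mem_iUnion₂.1 (hT hmem)
  have h1 := hF' x (Finset.mem_biUnion.2 ⟨x, hxT, by simp⟩)
  have h2 := hF' (x - d x) (Finset.mem_biUnion.2 ⟨x, hxT, by simp⟩)
  have h3 := hF' (x + d x) (Finset.mem_biUnion.2 ⟨x, hxT, by simp⟩)
  refine ⟨x, fun y hy => hdU x ?_, h1⟩
  simp only [mem_Ioo, not_and_or, not_lt] at h2 h3 hx
  have h2' : x - d x ≤ a := by rcases h2 with h | h <;> linarith [hx.1, hx.2]
  have h3' : b ≤ x + d x := by rcases h3 with h | h <;> linarith [hx.1, hx.2]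
  exact ⟨h2'.trans hy.1, hy.2.trans h3'⟩

theorem List.Pairwise.le_getLast_of_mem {t : List ℝ} (h : t.Pairwise (· < ·)) (ht : t ≠ [])
    {x : ℝ} (hx : x ∈ t) : x ≤ t.getLast ht := by
  induction t with
  | nil => exact absurd rfl ht
  | cons a t ih =>
    rw [List.pairwise_cons] at h
    rcases List.mem_cons.1 hx with rfl | hx
    · rcases eq_or_ne t [] with rfl | ht'
      · simp
      · rw [List.getLast_cons ht']
        exact (h.1 _ (List.getLast_mem ht')).le
    · rw [List.getLast_cons (List.ne_nil_of_mem hx)]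
      exact ih h.2 _ hx

/-- Consecutive entries of a strictly sorted list. -/
theorem List.Pairwise.isChain_consecutive {t : List ℝ} (h : t.Pairwise (· < ·)) :
    List.IsChain (fun x y => x < y ∧ x ∈ t ∧ y ∈ t ∧ ∀ z ∈ t, z ∉ Ioo x y) t := by
  induction t with
  | nil => exact List.IsChain.nil
  | cons a t ih =>
    rw [List.pairwise_cons] at h
    cases t with
    | nil => exact List.IsChain.singleton _
    | cons b l =>
      rw [List.isChain_cons_cons]
      refine ⟨⟨h.1 b (by simp), by simp, by simp, ?_⟩, (ih h.2).imp ?_⟩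
      · intro z hz hzab
        rcases List.mem_cons.1 hz with rfl | hz
        · exact lt_irrefl _ hzab.1
        rcases List.mem_cons.1 hz with rfl | hz
        · exact lt_irrefl _ hzab.2
        · exact absurd hzab.2 (not_lt.2 ((List.pairwise_cons.1 h.2).1 z hz).le)
      · rintro x y ⟨hxy, hx, hy, hz⟩
        refine ⟨hxy, List.mem_cons_of_mem _ hx, List.mem_cons_of_mem _ hy, fun z hz' hzxy => ?_⟩
        rcases List.mem_cons.1 hz' with rfl | hz'
        · exact absurd (h.1 x hx) (not_lt.2 hzxy.1.le)
        · exact hz z hz' hzxy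

/-- Every point has a neighbourhood of small measure outside of the point itself. -/
theorem exists_nhds_measure_diff_lt (m : Measure ℝ) [IsFiniteMeasure m] {ε : ℝ} (hε : 0 < ε)
    (x : ℝ) : ∃ U ∈ 𝓝 x, m.real (U \ {x}) < ε := by
  have h : Tendsto (fun k : ℕ => m (Ioo (x - 1 / (k + 1)) (x + 1 / (k + 1)) \ {x})) atTop
      (𝓝 (m (⋂ k : ℕ, Ioo (x - 1 / ((k : ℝ) + 1)) (x + 1 / (k + 1)) \ {x}))) := by
    refine tendsto_measure_iInter_atTop
      (fun k => (measurableSet_Ioo.diff (measurableSet_singleton x)).nullMeasurableSet) ?_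
      ⟨0, measure_ne_top _ _⟩
    intro i j hij
    refine sdiff_subset_sdiff_left (Ioo_subset_Ioo ?_ ?_)
    · gcongr
    · gcongr
  have hempty : (⋂ k : ℕ, Ioo (x - 1 / ((k : ℝ) + 1)) (x + 1 / (k + 1)) \ {x}) = ∅ := by
    refine eq_empty_of_forall_notMem fun y hy => ?_
    simp only [mem_iInter] at hy
    have hne : 0 < |y - x| := abs_pos.2 (sub_ne_zero.2 (by simpa using (hy 0).2))
    obtain ⟨k, hk⟩ := exists_nat_one_div_lt hne
    have := (hy k).1
    have : |y - x| < 1 / (k + 1) := abs_lt.2 ⟨by linarith [this.1], by linarith [this.2]⟩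
    linarith
  rw [hempty, measure_empty] at h
  obtain ⟨k, hk⟩ := (h.eventually (gt_mem_nhds (ENNReal.ofReal_pos.2 hε))).exists
  refine ⟨Ioo (x - 1 / (k + 1)) (x + 1 / (k + 1)), Ioo_mem_nhds ?_ ?_, ?_⟩
  · have : (0 : ℝ) < 1 / (k + 1) := by positivity
    linarith
  · have : (0 : ℝ) < 1 / (k + 1) := by positivity
    linarith
  · exact (ENNReal.lt_ofReal_iff_toReal_lt (measure_ne_top _ _)).1 hk

/-- A finite measure is concentrated on a large interval. -/
theorem exists_measureReal_compl_Ioc_lt (m : Measure ℝ) [IsFiniteMeasure m] {ε : ℝ} (hε : 0 < ε) :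
    ∃ M > 0, m.real (Ioc (-M) M)ᶜ < ε := by
  have h : Tendsto (fun k : ℕ => m (Ioc (-((k : ℝ) + 1)) (k + 1))ᶜ) atTop
      (𝓝 (m (⋂ k : ℕ, (Ioc (-((k : ℝ) + 1)) (k + 1))ᶜ))) := by
    refine tendsto_measure_iInter_atTop (fun k => measurableSet_Ioc.compl.nullMeasurableSet) ?_
      ⟨0, measure_ne_top _ _⟩
    intro i j hij
    refine compl_subset_compl.2 (Ioc_subset_Ioc ?_ ?_)
    · have : (i : ℝ) ≤ j := by exact_mod_cast hij
      linarith
    · have : (i : ℝ) ≤ j := by exact_mod_cast hij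
      linarith
  have hempty : (⋂ k : ℕ, (Ioc (-((k : ℝ) + 1)) (k + 1))ᶜ) = ∅ := by
    refine eq_empty_of_forall_notMem fun y hy => ?_
    simp only [mem_iInter] at hy
    obtain ⟨k, hk⟩ := exists_nat_gt |y|
    have := abs_lt.1 hk
    exact hy k ⟨by linarith, by linarith⟩
  rw [hempty, measure_empty] at h
  obtain ⟨k, hk⟩ := (h.eventually (gt_mem_nhds (ENNReal.ofReal_pos.2 hε))).exists
  exact ⟨k + 1, by positivity, (ENNReal.lt_ofReal_iff_toReal_lt (measure_ne_top _ _)).1 hk⟩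

/-- The positive and the negative part of a signed measure are almost carried by disjoint closed
sets. -/
theorem exists_isClosed_separation (s : SignedMeasure ℝ) {ε : ℝ} (hε : 0 < ε) :
    ∃ K K' : Set ℝ, IsClosed K ∧ IsClosed K' ∧ Disjoint K K' ∧
      s.toJordanDecomposition.posPart.real Kᶜ < ε ∧
      s.toJordanDecomposition.negPart.real K'ᶜ < ε := by
  set j := s.toJordanDecomposition
  obtain ⟨A, hA, hpos, hneg⟩ := j.mutuallySingular
  have hε' : ENNReal.ofReal ε ≠ 0 := (ENNReal.ofReal_pos.2 hε).ne'
  obtain ⟨K, hKA, hK, h1⟩ := hA.compl.exists_isClosed_sdiff_lt (μ := j.posPart)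
    (measure_ne_top _ _) hε'
  obtain ⟨K', hKA', hK', h2⟩ := hA.exists_isClosed_sdiff_lt (μ := j.negPart)
    (measure_ne_top _ _) hε'
  refine ⟨K, K', hK, hK', (disjoint_compl_left (a := A)).mono hKA hKA', ?_, ?_⟩
  · rw [measureReal_def, ← ENNReal.lt_ofReal_iff_toReal_lt (measure_ne_top _ _)]
    refine lt_of_le_of_lt ?_ h1
    calc j.posPart Kᶜ ≤ j.posPart (A ∪ Aᶜ \ K) := by
          refine measure_mono fun x hx => ?_
          by_cases hxA : x ∈ A
          · exact Or.inl hxA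
          · exact Or.inr ⟨hxA, hx⟩
      _ ≤ _ := (measure_union_le _ _).trans (by rw [hpos, zero_add])
  · rw [measureReal_def, ← ENNReal.lt_ofReal_iff_toReal_lt (measure_ne_top _ _)]
    refine lt_of_le_of_lt ?_ h2
    calc j.negPart K'ᶜ ≤ j.negPart (Aᶜ ∪ A \ K') := by
          refine measure_mono fun x hx => ?_
          by_cases hxA : x ∈ A
          · exact Or.inr ⟨hxA, hx⟩
          · exact Or.inl hxA
      _ ≤ _ := (measure_union_le _ _).trans (by rw [hneg, zero_add])

/-- The positive or negative parts of a family of signed measures. -/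
noncomputable def jordanPart {n : ℕ} (s : Fin n → SignedMeasure ℝ) (p : Bool × Fin n) :
    Measure ℝ :=
  if p.1 then (s p.2).toJordanDecomposition.posPart else (s p.2).toJordanDecomposition.negPart

instance {n : ℕ} (s : Fin n → SignedMeasure ℝ) (p : Bool × Fin n) :
    IsFiniteMeasure (jordanPart s p) := by
  unfold jordanPart; split_ifs <;> infer_instance

/-- The interaction potential of a family of signed measures. -/
noncomputable def measureQ {n : ℕ} (J : Finset (Fin n)) (s : Fin n → SignedMeasure ℝ) : ℝ :=
  ∑ p ∈ approachingParts J, ((jordanPart s p.1).prod (jordanPart s p.2)).real {x | x.1 < x.2}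

/-- The total strength of a family of signed measures. -/
noncomputable def measureV {n : ℕ} (s : Fin n → SignedMeasure ℝ) : ℝ :=
  ∑ p : Bool × Fin n, (jordanPart s p).real univ

/-- The positive or negative part of the number `s A` falls short of the Jordan part of `A` by
exactly the cancellation inside `A`, which is the smaller of the two Jordan parts. -/
theorem abs_part_sub_jordanPart_le {n : ℕ} (s : Fin n → SignedMeasure ℝ) (p : Bool × Fin n)
    {A : Set ℝ} (hA : MeasurableSet A) {σ : Fin n → ℝ} {e : ℝ}
    (h : |σ p.2 - s p.2 A| ≤ e) :
    |part p σ - (jordanPart s p).real A| ≤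
      e + min ((jordanPart s (true, p.2)).real A) ((jordanPart s (false, p.2)).real A) := by
  have h1 : part p (fun i => s i A) =
      (jordanPart s p).real A - min ((jordanPart s (true, p.2)).real A)
        ((jordanPart s (false, p.2)).real A) := by
    obtain ⟨b, i⟩ := p
    have := (s i).apply_eq_posPart_real_sub_negPart_real hA
    simp only [part, jordanPart, this]
    cases b
    · simp only [Bool.false_eq_true, if_false, if_true, neg_sub]
      rw [min_def]; split_ifs with h
      · rw [max_eq_left (by linarith)]
      · rw [max_eq_right (by linarith)]; ring
    · simp only [Bool.false_eq_true, if_false, if_true]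
      rw [min_def]; split_ifs with h
      · rw [max_eq_right (by linarith)]; ring
      · rw [max_eq_left (by linarith)]
  have h2 := (abs_part_sub_part_le p σ (fun i => s i A)).trans h
  have h3 : 0 ≤ min ((jordanPart s (true, p.2)).real A) ((jordanPart s (false, p.2)).real A) :=
    le_min measureReal_nonneg measureReal_nonneg
  rw [h1] at h2
  have := abs_le.1 h2
  exact abs_le.2 ⟨by linarith, by linarith⟩

/-- A family of interval functions that agrees with signed measures up to an error which is
quadratic off the right endpoint: the discrete functionals approximate the ones of the measures. -/
theorem exists_partition_approx {n : ℕ} (s : Fin n → SignedMeasure ℝ) (ν : Measure ℝ)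
    [IsFiniteMeasure ν] {K : ℝ} (hK : 0 ≤ K) {e : ℝ → ℝ → Fin n → ℝ}
    (he : ∀ a b, a < b → ∀ i, |e a b i - s i (Ioc a b)| ≤ K * ν.real (Ioo a b) * ν.real (Ioc a b))
    (J : Finset (Fin n)) (F₀ : Finset ℝ) {ε : ℝ} (hε : 0 < ε) :
    ∃ t : List ℝ, t.Pairwise (· < ·) ∧ (∀ x ∈ F₀, x ∈ t) ∧
      |fanQ J (waves e t) - measureQ J s| ≤ ε ∧ |fanV (waves e t) - measureV s| ≤ ε := by
  classical
  set κ : Measure ℝ := ν + ∑ p : Bool × Fin n, jordanPart s p with hκ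
  have hpκ : ∀ p, jordanPart s p ≤ κ := fun p => by
    refine le_trans ?_ (le_add_of_nonneg_left (Measure.zero_le ν))
    exact Finset.single_le_sum (f := fun p => jordanPart s p) (fun _ _ => Measure.zero_le _)
      (Finset.mem_univ p)
  have hνκ : ν ≤ κ := le_add_of_nonneg_right (Measure.zero_le _)
  have hreal : ∀ {μ : Measure ℝ}, μ ≤ κ → ∀ A, μ.real A ≤ κ.real A := fun h A =>
    ENNReal.toReal_mono (measure_ne_top _ _) (h A)
  -- This `B` bounds the total mass of `κ`, and `B * δ` will bound the total mass of the error
  -- measure `θ`: the part `κ * K` comes from the quadratic error, `2 * n` from the cancellations.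
  set B : ℝ := κ.real univ * (1 + K) + 2 * n with hB
  have hκ0 : 0 ≤ κ.real univ := measureReal_nonneg
  have hB0 : 0 ≤ B := by positivity
  have hκB : κ.real univ ≤ B := by nlinarith
  obtain ⟨δ, hδ0, hδ1, hδ⟩ : ∃ δ > 0, δ ≤ 1 ∧
      (2 * n * (2 * n) * (3 * B * B + B + 2 * B) + 2 * n * (B + 1)) * δ ≤ ε := by
    set c := 2 * n * (2 * n) * (3 * B * B + B + 2 * B) + 2 * n * (B + 1) with hc
    have hc0 : 0 ≤ c := by positivity
    refine ⟨min 1 (ε / (c + 1)), by positivity, min_le_left _ _, ?_⟩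
    calc c * min 1 (ε / (c + 1)) ≤ (c + 1) * (ε / (c + 1)) := by
          gcongr
          · linarith
          · exact min_le_right _ _
      _ = ε := by field_simp
  obtain ⟨M₁, hM₁0, hM₁⟩ := exists_measureReal_compl_Ioc_lt κ hδ0
  obtain ⟨M₂, hM₂⟩ : ∃ M₂, ∀ x ∈ F₀, |x| ≤ M₂ := by
    refine ⟨∑ x ∈ F₀, |x|, fun x hx => ?_⟩
    exact Finset.single_le_sum (f := fun x : ℝ => |x|) (fun _ _ => abs_nonneg _) hx
  set M := max M₁ M₂ with hM
  have hM0 : 0 < M := lt_max_of_lt_left hM₁0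
  choose k k' hk hk' hkk' hkpos hkneg using fun i => exists_isClosed_separation (s i) hδ0
  -- The closed sets `k i` and `k' i` almost carry the two Jordan parts and are disjoint, so near
  -- every point at least one of them is absent. On a short interval one of the Jordan parts is thus
  -- almost invisible, and there is little cancellation.
  have hU : ∀ x : ℝ, ∃ U ∈ 𝓝 x, κ.real (U \ {x}) < δ ∧
      ∀ i, U ⊆ (k i)ᶜ ∨ U ⊆ (k' i)ᶜ := fun x => by
    obtain ⟨U, hU, hUx⟩ := exists_nhds_measure_diff_lt κ hδ0 x
    have : ∀ i, ∃ T ∈ 𝓝 x, T ⊆ (k i)ᶜ ∨ T ⊆ (k' i)ᶜ := fun i => by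
      by_cases hx : x ∈ k i
      · exact ⟨(k' i)ᶜ, (hk' i).isOpen_compl.mem_nhds (Set.disjoint_left.1 (hkk' i) hx),
          Or.inr le_rfl⟩
      · exact ⟨(k i)ᶜ, (hk i).isOpen_compl.mem_nhds hx, Or.inl le_rfl⟩
    choose T hT hTk using this
    refine ⟨U ∩ ⋂ i, T i, inter_mem hU (iInter_mem.2 hT), ?_, fun i => ?_⟩
    · refine lt_of_le_of_lt (measureReal_mono ?_) hUx
      exact sdiff_subset_sdiff_left inter_subset_left
    · have : U ∩ ⋂ i, T i ⊆ T i := inter_subset_right.trans (iInter_subset _ i)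
      exact (hTk i).imp this.trans this.trans
  choose U hUn hUδ hUk using hU
  have hF₀' : ∀ x ∈ insert (-M) (insert M F₀), x ∈ Icc (-M) M := by
    intro x hx
    rcases Finset.mem_insert.1 hx with rfl | hx
    · exact ⟨le_rfl, by linarith⟩
    rcases Finset.mem_insert.1 hx with rfl | hx
    · exact ⟨by linarith, le_rfl⟩
    · exact abs_le.1 ((hM₂ x hx).trans (le_max_right _ _))
  obtain ⟨F, hF₀F, hFI, hgap⟩ := exists_finset_gaps hUn hF₀'
  have hmF : -M ∈ F := hF₀F (by simp)
  have hMF : M ∈ F := hF₀F (by simp)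
  obtain ⟨t, hsorted, hmem⟩ : ∃ t : List ℝ, t.Pairwise (· < ·) ∧ ∀ x, x ∈ t ↔ x ∈ F :=
    ⟨F.sort, F.sortedLT_sort.pairwise, fun x => Finset.mem_sort _⟩
  refine ⟨t, hsorted, fun x hx => (hmem x).2 (hF₀F (by simp [hx])), ?_⟩
  obtain ⟨a, l, hal⟩ : ∃ a l, t = a :: l := by
    cases h : t with
    | nil => exact absurd ((hmem M).2 hMF) (by simp [h])
    | cons a l => exact ⟨a, l, rfl⟩
  have hchain := hsorted.isChain_consecutive
  have ha : a = -M := by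
    have h1 : a ∈ F := (hmem a).1 (by simp [hal])
    have h2 : -M ∈ a :: l := by rw [← hal]; exact (hmem _).2 hmF
    rw [hal] at hsorted
    rcases List.mem_cons.1 h2 with h | h
    · exact h.symm
    · exact absurd (hFI a h1).1 (not_le.2 ((List.pairwise_cons.1 hsorted).1 _ h))
  rw [hal] at hchain ⊢
  have hlast : (a :: l).getLast (by simp) = M := by
    have h1 : (a :: l).getLast (by simp) ∈ F := (hmem _).1 (by rw [hal]; exact List.getLast_mem _)
    have h2 : M ∈ a :: l := by rw [← hal]; exact (hmem _).2 hMF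
    refine le_antisymm (hFI _ h1).2 ?_
    rw [hal] at hsorted
    exact hsorted.le_getLast_of_mem (by simp) h2
  -- The error measure: the quadratic errors, with one factor already bounded by `δ`, and the mass
  -- of the Jordan parts outside the closed sets that almost carry them.
  set θ : Measure ℝ := (K * δ).toNNReal • ν + ∑ i, ((jordanPart s (true, i)).restrict (k i)ᶜ +
    (jordanPart s (false, i)).restrict (k' i)ᶜ) with hθ
  have hθreal : ∀ A, MeasurableSet A → θ.real A = K * δ * ν.real A +
      ∑ i, ((jordanPart s (true, i)).real (A ∩ (k i)ᶜ) +
        (jordanPart s (false, i)).real (A ∩ (k' i)ᶜ)) := fun A hA => by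
    rw [hθ, measureReal_add_apply, measureReal_nnreal_smul_apply,
      Real.coe_toNNReal _ (by positivity)]
    congr 1
    rw [measureReal_def, Measure.finsetSum_apply, ENNReal.toReal_sum (fun _ _ => measure_ne_top _ _)]
    refine Finset.sum_congr rfl fun i _ => ?_
    rw [Measure.add_apply, ENNReal.toReal_add (measure_ne_top _ _) (measure_ne_top _ _),
      Measure.restrict_apply hA, Measure.restrict_apply hA]
    rfl
  have hθuniv : θ.real univ ≤ B * δ := by
    rw [hθreal univ MeasurableSet.univ]
    have h1 : ∑ i, ((jordanPart s (true, i)).real (univ ∩ (k i)ᶜ) +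
        (jordanPart s (false, i)).real (univ ∩ (k' i)ᶜ)) ≤ ∑ i : Fin n, (δ + δ) := by
      refine Finset.sum_le_sum fun i _ => ?_
      rw [univ_inter, univ_inter]
      exact add_le_add (hkpos i).le (hkneg i).le
    rw [Finset.sum_const, Finset.card_univ, Fintype.card_fin, nsmul_eq_mul] at h1
    have h2 : K * δ * ν.real univ ≤ K * δ * κ.real univ := by
      gcongr; exact hreal hνκ univ
    have h3 : 0 ≤ κ.real univ * δ := by positivity
    calc _ ≤ K * δ * κ.real univ + n * (δ + δ) := add_le_add h2 h1
      _ ≤ _ := by rw [hB]; linarith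
  have hθB : θ.real univ ≤ B := hθuniv.trans (by nlinarith)
  have hchain' : List.IsChain (fun x y => x < y ∧ (∀ p, |part p (e x y) -
      (jordanPart s p).real (Ioc x y)| ≤ θ.real (Ioc x y)) ∧
      ∀ p, (jordanPart s p).real (Ioo x y) ≤ δ) (a :: l) := by
    refine hchain.imp ?_
    rintro x y ⟨hxy, hx, hy, hno⟩
    rw [← hal] at hx hy hno
    obtain ⟨z, hz, hz'⟩ := hgap x ((hmem _).1 hx) y ((hmem _).1 hy) hxy
      fun w hw => hno w ((hmem w).2 hw)
    -- A gap misses the centre `z` of its neighbourhood, the only place in it where a large atom can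
    -- sit; large atoms are therefore points of the partition.
    have hκI : κ.real (Ioo x y) ≤ δ := by
      refine (measureReal_mono ?_).trans (hUδ z).le
      exact fun w hw => ⟨hz (Ioo_subset_Icc_self hw), fun h => hz' (by
        rw [mem_singleton_iff] at h; rwa [← h])⟩
    refine ⟨hxy, fun p => ?_, fun p => (hreal (hpκ p) _).trans hκI⟩
    have hE : |e x y p.2 - s p.2 (Ioc x y)| ≤ K * δ * ν.real (Ioc x y) := by
      refine (he x y hxy p.2).trans ?_
      gcongr
      exact (hreal hνκ _).trans hκI
    refine (abs_part_sub_jordanPart_le s p measurableSet_Ioc hE).trans ?_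
    rw [hθreal _ measurableSet_Ioc]
    gcongr
    refine le_trans ?_ (Finset.single_le_sum (f := fun i =>
      (jordanPart s (true, i)).real (Ioc x y ∩ (k i)ᶜ) +
        (jordanPart s (false, i)).real (Ioc x y ∩ (k' i)ᶜ))
      (fun _ _ => add_nonneg measureReal_nonneg measureReal_nonneg) (Finset.mem_univ p.2))
    have hsub : Ioc x y ⊆ U z := Ioc_subset_Icc_self.trans hz
    rcases hUk z p.2 with h | h
    · refine (min_le_left _ _).trans ?_
      rw [inter_eq_left.2 (hsub.trans h)]
      exact le_add_of_nonneg_right measureReal_nonneg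
    · refine (min_le_right _ _).trans ?_
      rw [inter_eq_left.2 (hsub.trans h)]
      exact le_add_of_nonneg_left measureReal_nonneg
  have hout : ∀ p, (jordanPart s p).real (Ioc a M)ᶜ ≤ δ := fun p => by
    refine (hreal (hpκ p) _).trans ((measureReal_mono ?_).trans hM₁.le)
    rw [ha]
    exact compl_subset_compl.2 (Ioc_subset_Ioc (by simp [hM]) (by simp [hM]))
  have hpB : ∀ p, (jordanPart s p).real univ ≤ B := fun p => (hreal (hpκ p) _).trans hκB
  have hn : (0 : ℝ) ≤ n := Nat.cast_nonneg n
  constructor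
  · rw [fanQ, measureQ, ← Finset.sum_sub_distrib]
    have : ∀ p ∈ approachingParts J, |pairSum (part p.1) (part p.2) (waves e (a :: l)) -
        ((jordanPart s p.1).prod (jordanPart s p.2)).real {x | x.1 < x.2}| ≤
        (3 * B * B + B + 2 * B) * δ := fun p _ => by
      have h1 := abs_pairSum_waves_sub_le (f := part p.1) (g := part p.2) (e := e)
        (μ := jordanPart s p.1) (ν := jordanPart s p.2) (θ := θ) (ε := δ) (M := B)
        (part_nonneg _) (hpB p.2) hθB
        (hchain'.imp fun x y h => ⟨h.1, h.2.1 p.1, h.2.1 p.2, h.2.2 p.1⟩)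
      have h2 := measureReal_prod_lt_le (hpB p.1) (hpB p.2) (hout p.1) (hout p.2)
      rw [hlast] at h1
      have h3 : 2 * B * θ.real (Ioc a M) ≤ 2 * B * (B * δ) := by
        gcongr; exact (measureReal_mono (subset_univ _)).trans hθuniv
      have h4 : (jordanPart s p.1).real (Ioc a M) * θ.real (Ioc a M) ≤ B * (B * δ) :=
        mul_le_mul ((measureReal_mono (subset_univ _)).trans (hpB _))
          ((measureReal_mono (subset_univ _)).trans hθuniv) measureReal_nonneg hB0
      have h5 : δ * (jordanPart s p.2).real (Ioc a M) ≤ δ * B := by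
        gcongr; exact (measureReal_mono (subset_univ _)).trans (hpB _)
      have h6 := abs_le.1 h1
      have h7 := abs_le.1 h2
      exact abs_le.2 ⟨by linarith, by linarith⟩
    refine (Finset.abs_sum_le_sum_abs _ _).trans ((Finset.sum_le_sum this).trans ?_)
    rw [Finset.sum_const, nsmul_eq_mul]
    have hcard : ((approachingParts J).card : ℝ) ≤ 2 * n * (2 * n) := by
      have := Finset.card_le_univ (approachingParts J)
      simp only [Fintype.card_prod, Fintype.card_bool, Fintype.card_fin] at this
      exact_mod_cast this
    refine le_trans ?_ hδ
    calc _ ≤ 2 * n * (2 * n) * ((3 * B * B + B + 2 * B) * δ) := by gcongr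
      _ ≤ _ := by
        have : 0 ≤ 2 * n * (B + 1) * δ := by positivity
        linarith
  · rw [fanV, measureV, ← Finset.sum_sub_distrib]
    have : ∀ p ∈ (Finset.univ : Finset (Bool × Fin n)), |((waves e (a :: l)).map (part p)).sum -
        (jordanPart s p).real univ| ≤ (B + 1) * δ := fun p _ => by
      have h1 := abs_sum_waves_sub_le (f := part p) (e := e) (μ := jordanPart s p) (θ := θ)
        (hchain'.imp fun x y h => ⟨h.1, h.2.1 p⟩)
      rw [hlast] at h1
      have h2 : (jordanPart s p).real univ =
          (jordanPart s p).real (Ioc a M) + (jordanPart s p).real (Ioc a M)ᶜ :=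
        (measureReal_add_measureReal_compl measurableSet_Ioc).symm
      have h3 : θ.real (Ioc a M) ≤ B * δ := (measureReal_mono (subset_univ _)).trans hθuniv
      have h4 := hout p
      have h5 : 0 ≤ (jordanPart s p).real (Ioc a M)ᶜ := measureReal_nonneg
      have h6 := abs_le.1 h1
      exact abs_le.2 ⟨by linarith, by linarith⟩
    refine (Finset.abs_sum_le_sum_abs _ _).trans ((Finset.sum_le_sum this).trans ?_)
    rw [Finset.sum_const, nsmul_eq_mul, Finset.card_univ]
    simp only [Fintype.card_prod, Fintype.card_bool, Fintype.card_fin, Nat.cast_mul,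
      Nat.cast_ofNat]
    refine le_trans ?_ hδ
    have : 0 ≤ 2 * n * (2 * n) * (3 * B * B + B + 2 * B) * δ := by positivity
    linarith

/-! ### The wave measures -/

/-- A vector measure with values in `ℝⁿ` has finite variation. -/
instance {X : Type*} [MeasurableSpace X] {n : ℕ} (m : VectorMeasure X (State n)) :
    IsFiniteMeasure m.variation := by
  set c : Fin n → SignedMeasure X := fun i =>
    m.mapRange (EuclideanSpace.proj (𝕜 := ℝ) i).toLinearMap.toAddMonoidHom
      (EuclideanSpace.proj (𝕜 := ℝ) i).continuous with hc
  have hle : m.variation ≤ ∑ i, (c i).totalVariation := by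
    refine VectorMeasure.variation_le_of_forall_enorm_le fun A _ => ?_
    rw [Measure.finsetSum_apply]
    calc ‖m A‖ₑ ≤ ∑ i, ‖m A i‖ₑ := by
          have h1 : ‖m A‖ ≤ ∑ i, ‖m A i‖ := by
            have h2 : m A = ∑ i, EuclideanSpace.single i (m A i) := by
              ext j; simp
            conv_lhs => rw [h2]
            exact (norm_sum_le _ _).trans (Finset.sum_le_sum fun i _ => by simp)
          rw [← ofReal_norm]
          refine (ENNReal.ofReal_le_ofReal h1).trans ?_
          rw [ENNReal.ofReal_sum_of_nonneg (fun _ _ => norm_nonneg _)]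
          exact Finset.sum_le_sum fun i _ => by rw [ofReal_norm]
      _ ≤ _ := Finset.sum_le_sum fun i _ => by
          exact (c i).enorm_le_totalVariation A
  have : IsFiniteMeasure (∑ i, (c i).totalVariation) := inferInstance
  exact isFiniteMeasure_of_le _ hle

theorem countable_atoms {m : Measure ℝ} [IsFiniteMeasure m] : {x | m {x} ≠ 0}.Countable := by
  have := Measure.countable_meas_pos_of_disjoint_iUnion (μ := m) (As := fun x : ℝ => {x})
    (fun x => measurableSet_singleton x) (fun x y h => by simpa [Function.onFun] using h)
  simpa [pos_iff_ne_zero] using this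

section BV

variable {n : ℕ} {u : ℝ → State n}

theorem BoundedVariationOn.measurable (hu : BoundedVariationOn u univ) : Measurable u := by
  have h : ∀ i, Measurable fun x => u x i := fun i => by
    have h1 : BoundedVariationOn (fun x => u x i) univ :=
      (EuclideanSpace.proj (𝕜 := ℝ) i : State n →L[ℝ] ℝ).lipschitz.comp_boundedVariationOn hu
    obtain ⟨p, q, hp, hq, hpq⟩ :=
      h1.locallyBoundedVariationOn.exists_monotoneOn_sub_monotoneOn
    rw [hpq]
    exact (monotoneOn_univ.1 hp).measurable.sub (monotoneOn_univ.1 hq).measurable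
  have : u = fun x => WithLp.toLp 2 (fun i => u x i) := rfl
  rw [this]
  exact (WithLp.measurable_toLp 2 (Fin n → ℝ)).comp (measurable_pi_lambda _ h)

variable (hu : BoundedVariationOn u univ) (hr : ∀ x, ContinuousWithinAt u (Ici x) x)
include hu hr

theorem vectorMeasure_singleton_eq (x : ℝ) :
    hu.vectorMeasure {x} = u x - Function.leftLim u x := by
  rw [hu.vectorMeasure_singleton, (hr x).rightLim_eq]

theorem vectorMeasure_Ioc_eq {a b : ℝ} (h : a ≤ b) : hu.vectorMeasure (Ioc a b) = u b - u a := by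
  rw [hu.vectorMeasure_Ioc h, (hr a).rightLim_eq, (hr b).rightLim_eq]

theorem vectorMeasure_Ioo_eq {a b : ℝ} (h : a < b) :
    hu.vectorMeasure (Ioo a b) = Function.leftLim u b - u a := by
  rw [hu.vectorMeasure_Ioo h, (hr a).rightLim_eq]

theorem mem_jumpSet_iff (x : ℝ) : x ∈ jumpSet u ↔ hu.vectorMeasure.variation {x} ≠ 0 := by
  rw [Ne, VectorMeasure.variation_apply_eq_zero (measurableSet_singleton x)]
  have : x ∈ jumpSet u ↔ hu.vectorMeasure {x} ≠ 0 := by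
    rw [vectorMeasure_singleton_eq hu hr, sub_ne_zero]
    exact ne_comm
  rw [this, not_iff_not]
  refine ⟨fun h t ht _ => ?_, fun h => h _ le_rfl (measurableSet_singleton x)⟩
  rcases subset_singleton_iff_eq.1 ht with rfl | rfl
  · simp
  · exact h

theorem countable_jumpSet : (jumpSet u).Countable :=
  (countable_atoms (m := hu.vectorMeasure.variation)).mono
    fun x hx => (mem_jumpSet_iff hu hr x).1 hx

theorem norm_jump_le (x : ℝ) :
    ‖u x - Function.leftLim u x‖ ≤ hu.vectorMeasure.variation.real {x} := by
  rw [← vectorMeasure_singleton_eq hu hr]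
  exact VectorMeasure.norm_measure_le_variation

omit hr in
theorem norm_leftLim_le {r : ℝ} (hur : ∀ x, ‖u x‖ ≤ r) (x : ℝ) : ‖Function.leftLim u x‖ ≤ r :=
  le_of_tendsto (hu.tendsto_leftLim x).norm (Eventually.of_forall hur)

/-- The jumps of `u` are atoms of the finite variation measure of `Du`, hence summable; so is
everything that they dominate, in particular the wave strengths at the jumps. -/
theorem integrable_jump_of_le {g : ℝ → ℝ} {C : ℝ}
    (hg : ∀ x, |g x| ≤ C * ‖u x - Function.leftLim u x‖) :
    Integrable g (Measure.count.restrict (jumpSet u)) := by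
  have hc := countable_jumpSet hu hr
  constructor
  · have : Measurable ((jumpSet u).indicator g) :=
      measurable_zero.measurable_of_countable_ne (hc.mono fun x hx => by
        by_contra h
        simp [h] at hx)
    exact ⟨_, this.stronglyMeasurable, (indicator_ae_eq_restrict hc.measurableSet).symm⟩
  · rw [hasFiniteIntegral_iff_norm]
    calc ∫⁻ x in jumpSet u, ENNReal.ofReal ‖g x‖ ∂Measure.count
        ≤ ∫⁻ x in jumpSet u, ENNReal.ofReal C * hu.vectorMeasure.variation {x} ∂Measure.count := by
          refine lintegral_mono fun x => ?_
          have h1 := (hg x).trans (mul_le_mul_of_nonneg_right (le_abs_self C) (norm_nonneg _))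
          have h0 : ‖g x‖ ≤ C * ‖u x - Function.leftLim u x‖ := hg x
          rcases le_or_gt 0 C with hC | hC
          · refine (ENNReal.ofReal_le_ofReal h0).trans ?_
            rw [ENNReal.ofReal_mul hC]
            gcongr
            rw [← vectorMeasure_singleton_eq hu hr, ofReal_norm]
            exact VectorMeasure.enorm_measure_le_variation _ _
          · have : ‖g x‖ ≤ 0 := h0.trans (mul_nonpos_of_nonpos_of_nonneg hC.le (norm_nonneg _))
            rw [ENNReal.ofReal_eq_zero.2 this]
            exact zero_le
      _ = ∑' x : jumpSet u, ENNReal.ofReal C * hu.vectorMeasure.variation {(x : ℝ)} := by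
          rw [lintegral_countable _ hc]
          simp
      _ = ENNReal.ofReal C * hu.vectorMeasure.variation (⋃ x ∈ jumpSet u, {x}) := by
          rw [ENNReal.tsum_mul_left, measure_biUnion hc (fun x _ y _ h => by
            simpa [Function.onFun] using h) (fun x _ => measurableSet_singleton x)]
      _ < ⊤ := ENNReal.mul_lt_top ENNReal.ofReal_lt_top (measure_lt_top _ _)

/-- The jump part of the derivative. -/
theorem inner_vectorMeasure_inter_jumpSet (L : State n) {A : Set ℝ} (hA : MeasurableSet A) :
    inner ℝ L (hu.vectorMeasure (A ∩ jumpSet u)) =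
      ∫ x in A, inner ℝ L (u x - Function.leftLim u x) ∂Measure.count.restrict (jumpSet u) := by
  have hc : (A ∩ jumpSet u).Countable := (countable_jumpSet hu hr).mono inter_subset_right
  have hint : Integrable (fun x => inner ℝ L (u x - Function.leftLim u x))
      (Measure.count.restrict (jumpSet u)) :=
    integrable_jump_of_le hu hr (C := ‖L‖) fun x => abs_real_inner_le_norm _ _
  rw [Measure.restrict_restrict hA, setIntegral_countable _ hc]
  · simp only [measureReal_def, Measure.count_singleton, ENNReal.toReal_one, one_smul]
    have h1 : HasSum (fun x : ↥(A ∩ jumpSet u) => hu.vectorMeasure {(x : ℝ)})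
        (hu.vectorMeasure (A ∩ jumpSet u)) := by
      have : Countable ↥(A ∩ jumpSet u) := hc.to_subtype
      have h2 := hu.vectorMeasure.hasSum_of_disjoint_iUnion
        (f := fun x : ↥(A ∩ jumpSet u) => {(x : ℝ)})
        (fun x => measurableSet_singleton _) (fun x y h => by
          simpa [Function.onFun, Subtype.ext_iff] using h)
      have h3 : ⋃ x : ↥(A ∩ jumpSet u), {(x : ℝ)} = A ∩ jumpSet u := by
        ext y; simp
      rwa [h3] at h2
    have h4 := (innerSL ℝ L).hasSum h1
    rw [innerSL_apply_apply] at h4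
    rw [← h4.tsum_eq]
    refine tsum_congr fun x => ?_
    simp [vectorMeasure_singleton_eq hu hr]
  · have := hint.integrableOn (s := A)
    rwa [IntegrableOn, Measure.restrict_restrict hA] at this

theorem integral_norm_jump_le {A : Set ℝ} (hA : MeasurableSet A) :
    ∫ x in A, ‖u x - Function.leftLim u x‖ ∂Measure.count.restrict (jumpSet u) ≤
      hu.vectorMeasure.variation.real (A ∩ jumpSet u) := by
  have hc : (A ∩ jumpSet u).Countable := (countable_jumpSet hu hr).mono inter_subset_right
  have hint : Integrable (fun x => hu.vectorMeasure.variation.real {x})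
      (Measure.count.restrict (jumpSet u)) := by
    have h := integrable_jump_of_le hu hr (g := fun x => ‖u x - Function.leftLim u x‖) (C := 1)
      fun x => by rw [abs_norm, one_mul]
    refine h.congr (Eventually.of_forall fun x => ?_)
    have h5 : hu.vectorMeasure.variation {x} = ‖hu.vectorMeasure {x}‖ₑ := by
      refine le_antisymm ?_ (VectorMeasure.enorm_measure_le_variation _ _)
      refine VectorMeasure.variation_apply_le_of_forall_enorm_le (μ := hu.vectorMeasure)
        (m := ‖hu.vectorMeasure {x}‖ₑ • Measure.dirac x) (measurableSet_singleton x)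
        (fun E _ hE => ?_) |>.trans ?_
      · rcases subset_singleton_iff_eq.1 hE with rfl | rfl
        · simp
        · simp
      · simp
    simp only [measureReal_def, h5, vectorMeasure_singleton_eq hu hr, toReal_enorm]
  calc _ ≤ ∫ x in A, hu.vectorMeasure.variation.real {x}
          ∂Measure.count.restrict (jumpSet u) := by
        refine integral_mono_of_nonneg (Eventually.of_forall fun x => norm_nonneg _)
          hint.integrableOn (Eventually.of_forall fun x => norm_jump_le hu hr x)
    _ = _ := by
        have hint' := hint.integrableOn (s := A)
        rw [IntegrableOn, Measure.restrict_restrict hA] at hint'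
        rw [Measure.restrict_restrict hA, setIntegral_countable _ hc hint']
        simp only [measureReal_def, Measure.count_singleton, ENNReal.toReal_one, one_smul]
        rw [← ENNReal.tsum_toReal_eq (fun _ => measure_ne_top _ _),
          ← measure_biUnion hc (fun x _ y _ h => by simpa [Function.onFun] using h)
            (fun x _ => measurableSet_singleton x), biUnion_of_singleton]

end BV

/-- The properties of the wave strengths `E` and of the left eigenvectors `l` near the origin. -/
structure FanEstimates {n : ℕ} (G : Finset (Fin n)) (E : State n → State n → Fin n → ℝ)
    (l : Fin n → State n → State n) (η K : ℝ) : Prop where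
  pos : 0 < η
  nonneg : 0 ≤ K
  self : ∀ a ∈ Metric.ball 0 η, E a a = 0
  lipschitz : ∀ a ∈ Metric.ball 0 η, ∀ b ∈ Metric.ball 0 η, ∀ a' ∈ Metric.ball 0 η,
    ∀ b' ∈ Metric.ball 0 η, ∀ i, |E a b i - E a' b' i| ≤ K * (‖a - a'‖ + ‖b - b'‖)
  tangent : ∀ a ∈ Metric.ball 0 η, ∀ b ∈ Metric.ball 0 η, ∀ i,
    |E a b i - inner ℝ (l i a) (b - a)| ≤ K * ‖b - a‖ ^ 2
  left : ∀ a ∈ Metric.ball 0 η, ∀ b ∈ Metric.ball 0 η, ∀ i, ‖l i a - l i b‖ ≤ K * ‖a - b‖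
  glimm : ∀ a ∈ Metric.ball 0 η, ∀ m ∈ Metric.ball 0 η, ∀ b ∈ Metric.ball 0 η, ∀ i,
    |E a b i - E a m i - E m b i| ≤ K * interaction G (E a m) (E m b)

theorem FanEstimates.abs_le {n : ℕ} {G : Finset (Fin n)} {E : State n → State n → Fin n → ℝ}
    {l : Fin n → State n → State n} {η K : ℝ} (h : FanEstimates G E l η K) {a b : State n}
    (ha : a ∈ Metric.ball 0 η) (hb : b ∈ Metric.ball 0 η) (i : Fin n) :
    |E a b i| ≤ K * ‖b - a‖ := by
  have := h.lipschitz a ha b hb a ha a ha i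
  rw [h.self a ha] at this
  simpa using this

theorem interaction_le {n : ℕ} (J : Finset (Fin n)) {σ τ : Fin n → ℝ} {s t : ℝ} (hs : 0 ≤ s)
    (hσ : ∀ i, |σ i| ≤ s) (hτ : ∀ i, |τ i| ≤ t) :
    interaction J σ τ ≤ (2 * n) ^ 2 * (s * t) := by
  -- Without an index, `hτ` gives no sign for `t`, but then the interaction is an empty sum.
  rcases Nat.eq_zero_or_pos n with rfl | hn
  · simp [interaction, approachingParts]
  have ht : 0 ≤ t := (abs_nonneg _).trans (hτ ⟨0, hn⟩)
  calc interaction J σ τ ≤ ∑ _p ∈ approachingParts J, s * t :=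
        Finset.sum_le_sum fun p _ => mul_le_mul ((part_le_abs _ _).trans (hσ _))
          ((part_le_abs _ _).trans (hτ _)) (part_nonneg _ _) hs
    _ ≤ ∑ _p : (Bool × Fin n) × (Bool × Fin n), s * t :=
        Finset.sum_le_sum_of_subset_of_nonneg (Finset.subset_univ _) fun _ _ _ => mul_nonneg hs ht
    _ = _ := by
        rw [Finset.sum_const, Finset.card_univ]
        simp only [Fintype.card_prod, Fintype.card_bool, Fintype.card_fin, nsmul_eq_mul]
        push_cast
        ring

/-! ### Comparison of wave strengths with wave measures. -/

namespace ConservationLaw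

variable {n : ℕ} {S : ConservationLaw n} {B : Set (State n)} {G : Finset (Fin n)} {η K : ℝ}
  {u : ℝ → State n}

section

variable (hF : FanEstimates G (S.E B) S.l η K) (hu : BoundedVariationOn u univ)
  (hr : ∀ x, ContinuousWithinAt u (Ici x) x) {r : ℝ} (hrη : r < η) (hur : ∀ x, ‖u x‖ ≤ r)
include hF hu hrη hur

omit hF hu in
theorem apply_mem_ball (x : ℝ) : u x ∈ Metric.ball (0 : State n) η := by
  simpa using (hur x).trans_lt hrη

omit hF in
theorem leftLim_mem_ball (x : ℝ) : Function.leftLim u x ∈ Metric.ball (0 : State n) η := by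
  simpa using (norm_leftLim_le hu hur x).trans_lt hrη

theorem integrable_left (m : VectorMeasure ℝ (State n)) (i : Fin n) :
    m.Integrable fun x => innerSL ℝ (S.l i (u x)) := by
  have hmem := apply_mem_ball hrη hur
  have h0 : (0 : State n) ∈ Metric.ball (0 : State n) η := by simpa using hF.pos
  have hcont : ContinuousOn (S.l i) (Metric.ball 0 η) := by
    have : LipschitzOnWith ⟨K, hF.nonneg⟩ (S.l i) (Metric.ball 0 η) :=
      LipschitzOnWith.of_dist_le_mul fun a ha b hb => by
        rw [dist_eq_norm, dist_eq_norm]; exact hF.left a ha b hb i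
    exact this.continuousOn
  have hmeas : Measurable fun x => S.l i (u x) := by
    classical
    -- Nothing is known about `S.l i` outside the ball. Cutting it off there does not change its
    -- composition with `u`, which takes its values in the ball.
    have h1 : Measurable ((Metric.ball (0 : State n) η).piecewise (S.l i) 0) :=
      ContinuousOn.measurable_piecewise hcont continuousOn_const measurableSet_ball
    have h2 := h1.comp hu.measurable
    convert h2 using 1
    ext1 x
    simp only [Function.comp_apply]
    rw [piecewise_eq_of_mem _ _ _ (hmem x)]
  refine Integrable.of_bound ((innerSL ℝ).continuous.measurable.comp hmeas).aestronglyMeasurable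
    (‖S.l i 0‖ + K * η) (Eventually.of_forall fun x => ?_)
  simp only [innerSL_apply_norm]
  have h1 := hF.left _ (hmem x) _ h0 i
  have h2 : ‖u x - 0‖ ≤ η := by simpa using ((hur x).trans hrη.le)
  have h3 := norm_sub_norm_le (S.l i (u x)) (S.l i 0)
  have h4 := mul_le_mul_of_nonneg_left h2 hF.nonneg
  linarith

include hr in
/-- On a set where the states are close to each other, the wave measure is close to the component
of the derivative along a fixed left eigenvector. -/
theorem abs_waveMeasure_sub_inner_le {A : Set ℝ} (hA : MeasurableSet A) (i : Fin n) (L : State n)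
    {ω : ℝ} (hω : 0 ≤ ω) (h1 : ∀ x ∈ A, ‖S.l i (u x) - L‖ ≤ ω)
    (h2 : ∀ x ∈ A, |S.strength B u x i - inner ℝ L (u x - Function.leftLim u x)| ≤
      ω * ‖u x - Function.leftLim u x‖) :
    |S.waveMeasure B u i A - inner ℝ L (hu.vectorMeasure A)| ≤
      ω * hu.vectorMeasure.variation.real A := by
  set N := jumpSet u with hN
  have hNm : MeasurableSet N := (countable_jumpSet hu hr).measurableSet
  set m := hu.vectorMeasure with hm
  have hsint : Integrable (fun x => S.strength B u x i) (Measure.count.restrict N) :=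
    integrable_jump_of_le hu hr (C := K) fun x =>
      hF.abs_le (leftLim_mem_ball hu hrη hur x) (apply_mem_ball hrη hur x) i
  have hLint : Integrable (fun x => inner ℝ L (u x - Function.leftLim u x))
      (Measure.count.restrict N) :=
    integrable_jump_of_le hu hr (C := ‖L‖) fun x => abs_real_inner_le_norm _ _
  have hjint : Integrable (fun x => ‖u x - Function.leftLim u x‖)
      (Measure.count.restrict N) :=
    integrable_jump_of_le hu hr (C := 1) fun x => by rw [abs_norm, one_mul]
  have e1 : S.waveMeasure B u i A =
      ((m.restrict Nᶜ).withDensity (fun x => innerSL ℝ (S.l i (u x)))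
        (ContinuousLinearMap.id ℝ (State n →L[ℝ] ℝ))) A +
      ∫ x in A, S.strength B u x i ∂Measure.count.restrict N := by
    rw [waveMeasure, dif_pos hu, _root_.add_apply, withDensityᵥ_apply hsint hA]
  have e2 : m A = m (A ∩ Nᶜ) + m (A ∩ N) := by
    rw [← VectorMeasure.of_union (disjoint_compl_left.mono inter_subset_right inter_subset_right)
      (hA.inter hNm.compl) (hA.inter hNm), ← inter_union_distrib_left, compl_union_self, inter_univ]
  have b1 : ‖((m.restrict Nᶜ).withDensity (fun x => innerSL ℝ (S.l i (u x)))
        (ContinuousLinearMap.id ℝ (State n →L[ℝ] ℝ))) A - inner ℝ L (m (A ∩ Nᶜ))‖ ≤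
      ω * m.variation.real (A ∩ Nᶜ) := by
    have hint := integrable_left hF hu hrη hur (m.restrict Nᶜ) i
    rw [VectorMeasure.withDensity_apply hint]
    have hc : (inner ℝ L (m (A ∩ Nᶜ)) : ℝ) =
        ((m.restrict Nᶜ).restrict A).integral (fun _ => innerSL ℝ L)
          (ContinuousLinearMap.id ℝ (State n →L[ℝ] ℝ)) := by
      rw [VectorMeasure.integral_const, VectorMeasure.restrict_apply _ hA MeasurableSet.univ,
        univ_inter, VectorMeasure.restrict_apply _ hNm.compl hA]
      simp
    rw [hc, ← VectorMeasure.integral_fun_sub hint.restrict (integrable_const _)]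
    refine (VectorMeasure.norm_integral_le_of_norm_le_const (C := ω) ?_).trans ?_
    · rw [VectorMeasure.variation_restrict hA]
      refine (ae_restrict_iff' hA).2 (Eventually.of_forall fun x hx => ?_)
      rw [← map_sub, innerSL_apply_norm]
      exact h1 x hx
    · have h3 : ‖ContinuousLinearMap.id ℝ (State n →L[ℝ] ℝ)‖ ≤ 1 :=
        ContinuousLinearMap.norm_id_le
      rw [VectorMeasure.variation_restrict hA, VectorMeasure.variation_restrict hNm.compl,
        measureReal_restrict_apply_univ, measureReal_restrict_apply hA]
      refine mul_le_mul_of_nonneg_right ?_ measureReal_nonneg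
      nlinarith
  have b2 : ‖∫ x in A, S.strength B u x i ∂Measure.count.restrict N -
      inner ℝ L (m (A ∩ N))‖ ≤ ω * m.variation.real (A ∩ N) := by
    rw [inner_vectorMeasure_inter_jumpSet hu hr L hA,
      ← integral_sub hsint.integrableOn hLint.integrableOn]
    calc _ ≤ ∫ x in A, ω * ‖u x - Function.leftLim u x‖ ∂Measure.count.restrict N := by
          refine norm_integral_le_of_norm_le (hjint.integrableOn.const_mul ω) ?_
          exact (ae_restrict_iff' hA).2 (Eventually.of_forall fun x hx => h2 x hx)
      _ ≤ _ := by
          rw [integral_const_mul]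
          exact mul_le_mul_of_nonneg_left (integral_norm_jump_le hu hr hA) hω
  have e3 : m.variation.real A = m.variation.real (A ∩ Nᶜ) + m.variation.real (A ∩ N) := by
    have := measureReal_inter_add_sdiff (μ := m.variation) (s := A) hNm
    rw [sdiff_eq] at this
    linarith
  rw [e1, e2, e3, inner_add_right, mul_add, ← Real.norm_eq_abs]
  calc _ = ‖(((m.restrict Nᶜ).withDensity (fun x => innerSL ℝ (S.l i (u x)))
        (ContinuousLinearMap.id ℝ (State n →L[ℝ] ℝ))) A - inner ℝ L (m (A ∩ Nᶜ))) +
        (∫ x in A, S.strength B u x i ∂Measure.count.restrict N - inner ℝ L (m (A ∩ N)))‖ := by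
        congr 1; ring
    _ ≤ _ := (norm_add_le _ _).trans (add_le_add b1 b2)

include hr in
-- The continuous part of the derivative has no atoms. At a point without a jump both sides vanish,
-- because `E a a = 0`.
theorem waveMeasure_singleton (x : ℝ) (i : Fin n) :
    S.waveMeasure B u i {x} = S.strength B u x i := by
  have hsint : Integrable (fun x => S.strength B u x i) (Measure.count.restrict (jumpSet u)) :=
    integrable_jump_of_le hu hr (C := K) fun x =>
      hF.abs_le (leftLim_mem_ball hu hrη hur x) (apply_mem_ball hrη hur x) i
  have hNm : MeasurableSet (jumpSet u) := (countable_jumpSet hu hr).measurableSet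
  have hint := integrable_left hF hu hrη hur (hu.vectorMeasure.restrict (jumpSet u)ᶜ) i
  have h1 : ((hu.vectorMeasure.restrict (jumpSet u)ᶜ).withDensity
      (fun x => innerSL ℝ (S.l i (u x))) (ContinuousLinearMap.id ℝ (State n →L[ℝ] ℝ))) {x} = 0 := by
    rw [VectorMeasure.withDensity_apply hint]
    refine VectorMeasure.integral_eq_zero_of_ae ?_
    rw [VectorMeasure.variation_restrict (measurableSet_singleton x),
      VectorMeasure.variation_restrict hNm.compl]
    have : (hu.vectorMeasure.variation.restrict (jumpSet u)ᶜ).restrict {x} = 0 := by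
      rw [Measure.restrict_eq_zero, Measure.restrict_apply (measurableSet_singleton x)]
      by_cases hx : x ∈ jumpSet u
      · rw [singleton_inter_eq_empty.2 (by simpa using hx), measure_empty]
      · have := (mem_jumpSet_iff hu hr x).not.1 hx
        exact measure_mono_null inter_subset_left (by simpa using this)
    rw [this, ae_zero]
    exact Filter.eventually_bot
  rw [waveMeasure, dif_pos hu, _root_.add_apply, h1,
    withDensityᵥ_apply hsint (measurableSet_singleton x), zero_add,
    Measure.restrict_restrict (measurableSet_singleton x)]
  by_cases hx : x ∈ jumpSet u
  · rw [inter_eq_left.2 (by simpa using hx)]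
    simp
  · rw [singleton_inter_eq_empty.2 hx]
    have : Function.leftLim u x = u x := by simpa [jumpSet] using hx
    simp [strength, this, hF.self _ (apply_mem_ball hrη hur x)]

include hr in
/-- The strengths of the waves between two states of `u` are close to the wave measures. -/
theorem abs_E_sub_waveMeasure_le {a b : ℝ} (hab : a < b) (i : Fin n) :
    |S.E B (u a) (u b) i - S.waveMeasure B u i (Ioc a b)| ≤
      (3 * K + (2 * n) ^ 2 * K ^ 3) * hu.vectorMeasure.variation.real (Ioo a b) *
        hu.vectorMeasure.variation.real (Ioc a b) := by
  set m := hu.vectorMeasure with hm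
  -- The interval is split just before `b`. The possibly large jump at `b` is counted exactly by its
  -- own Riemann problem, so its square never enters the error; this produces the factor `variation
  -- (Ioo a b)`.
  set c := Function.leftLim u b with hc
  set ν₁ := m.variation.real (Ioo a b) with hν₁
  have hK := hF.nonneg
  have hν0 : 0 ≤ ν₁ := measureReal_nonneg
  have mem := fun x => apply_mem_ball (u := u) hrη hur x
  have memL := fun x => leftLim_mem_ball hu hrη hur x
  have key : ∀ A ⊆ Ioo a b, ‖m A‖ ≤ ν₁ := fun A hA =>
    (VectorMeasure.norm_measure_le_variation (μ := m)).trans (measureReal_mono hA)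
  have d1 : ∀ x ∈ Ioo a b, ‖u x - u a‖ ≤ ν₁ := fun x hx => by
    rw [← vectorMeasure_Ioc_eq hu hr hx.1.le]
    exact key _ fun y hy => ⟨hy.1, hy.2.trans_lt hx.2⟩
  have d2 : ∀ x ∈ Ioc a b, ‖Function.leftLim u x - u a‖ ≤ ν₁ := fun x hx => by
    rw [← vectorMeasure_Ioo_eq hu hr hx.1]
    exact key _ (Ioo_subset_Ioo_right hx.2)
  have d3 : ∀ x ∈ Ioo a b, ‖u x - Function.leftLim u x‖ ≤ ν₁ := fun x hx => by
    rw [← vectorMeasure_singleton_eq hu hr]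
    exact key _ (by simpa using hx)
  -- On the open interval the left eigenvector is frozen at `u a`. At a jump, one `K * ν₁` comes
  -- from the change of the left eigenvector and another one from the quadratic error of the tangent
  -- approximation of `E`.
  have h1 := abs_waveMeasure_sub_inner_le (B := B) hF hu hr hrη hur
    (measurableSet_Ioo (a := a) (b := b)) i (S.l i (u a)) (ω := 2 * K * ν₁) (by positivity)
    (fun x hx => by
      have := hF.left _ (mem x) _ (mem a) i
      have := mul_le_mul_of_nonneg_left (d1 x hx) hK
      nlinarith [mul_nonneg hK hν0])
    (fun x hx => by
      have e1 := hF.tangent _ (memL x) _ (mem x) i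
      have e2 : |inner ℝ (S.l i (Function.leftLim u x) - S.l i (u a))
          (u x - Function.leftLim u x)| ≤ K * ν₁ * ‖u x - Function.leftLim u x‖ := by
        refine (abs_real_inner_le_norm _ _).trans (mul_le_mul_of_nonneg_right ?_ (norm_nonneg _))
        exact (hF.left _ (memL x) _ (mem a) i).trans
          (mul_le_mul_of_nonneg_left (d2 x ⟨hx.1, hx.2.le⟩) hK)
      have e3 : K * ‖u x - Function.leftLim u x‖ ^ 2 ≤ K * ν₁ * ‖u x - Function.leftLim u x‖ := by
        rw [pow_two, ← mul_assoc]
        exact mul_le_mul_of_nonneg_right (mul_le_mul_of_nonneg_left (d3 x hx) hK) (norm_nonneg _)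
      rw [inner_sub_left] at e2
      rw [strength]
      have e4 := abs_add_le
        (S.E B (Function.leftLim u x) (u x) i - inner ℝ (S.l i (Function.leftLim u x))
          (u x - Function.leftLim u x))
        (inner ℝ (S.l i (Function.leftLim u x)) (u x - Function.leftLim u x) -
          inner ℝ (S.l i (u a)) (u x - Function.leftLim u x))
      rw [sub_add_sub_cancel] at e4
      linarith)
  rw [vectorMeasure_Ioo_eq hu hr hab, ← hc, ← hν₁] at h1
  have h2 : S.waveMeasure B u i (Ioc a b) =
      S.waveMeasure B u i (Ioo a b) + S.E B c (u b) i := by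
    rw [← Ioo_union_right hab, VectorMeasure.of_union (by simp) measurableSet_Ioo
      (measurableSet_singleton b), waveMeasure_singleton hF hu hr hrη hur, strength]
  have dc : ‖c - u a‖ ≤ ν₁ := d2 b ⟨hab, le_rfl⟩
  have h3 := hF.tangent _ (mem a) _ (memL b) i
  have h4 : K * ‖c - u a‖ ^ 2 ≤ K * ν₁ ^ 2 :=
    mul_le_mul_of_nonneg_left (pow_le_pow_left₀ (norm_nonneg _) dc 2) hK
  have h5 := hF.glimm _ (mem a) _ (memL b) _ (mem b) i
  have dj : ‖u b - c‖ ≤ m.variation.real {b} := norm_jump_le hu hr b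
  have hj0 : 0 ≤ m.variation.real {b} := measureReal_nonneg
  have h6 := interaction_le G (σ := S.E B (u a) c) (τ := S.E B c (u b)) (s := K * ν₁)
    (t := K * m.variation.real {b}) (by positivity)
    (fun i => (hF.abs_le (mem a) (memL b) i).trans (mul_le_mul_of_nonneg_left dc hK))
    (fun i => (hF.abs_le (memL b) (mem b) i).trans (mul_le_mul_of_nonneg_left dj hK))
  have h7 := mul_le_mul_of_nonneg_left h6 hK
  have h8 : m.variation.real (Ioc a b) = ν₁ + m.variation.real {b} := by
    rw [← Ioo_union_right hab, measureReal_union (by simp) (measurableSet_singleton b)]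
  rw [h2, h8]
  -- Three errors: the interaction of the fan from `u a` to `c` with the jump at `b`, the tangent
  -- approximation of the former fan, and the frozen eigenvector on the open interval.
  have h9 : |S.E B (u a) (u b) i - (S.waveMeasure B u i (Ioo a b) + S.E B c (u b) i)| ≤
      K * interaction G (S.E B (u a) c) (S.E B c (u b)) + K * ‖c - u a‖ ^ 2 +
        2 * K * ν₁ * ν₁ := by
    rw [abs_le] at h1 h3 h5 ⊢
    constructor <;> linarith [h1.1, h1.2, h3.1, h3.2, h5.1, h5.2]
  refine h9.trans ?_
  have : 0 ≤ K * (ν₁ * m.variation.real {b}) := by positivity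
  have : 0 ≤ (2 * n) ^ 2 * K ^ 3 * ν₁ ^ 2 := by positivity
  linarith

end

end ConservationLaw

/-! ### The functionals as suprema over partitions -/

/-- Passage between the indexing by pairs of signed families and the form of `rho`: different
families contribute all four combinations of signs, one family only the three that involve a
negative part. -/
theorem sum_approachingParts {n : ℕ} {M : Type*} [AddCommMonoid M] (J : Finset (Fin n))
    (f : Bool × Fin n → Bool × Fin n → M) :
    ∑ p ∈ approachingParts J, f p.1 p.2 =
      ∑ i, ∑ j ∈ Finset.univ.filter (· < i), (f (true, i) (true, j) + f (true, i) (false, j) +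
        (f (false, i) (true, j) + f (false, i) (false, j))) +
      ∑ i ∈ J, (f (false, i) (false, i) + f (true, i) (false, i) + f (false, i) (true, i)) := by
  have h : ∀ p : (Bool × Fin n) × (Bool × Fin n),
      (if p.2.2 < p.1.2 ∨ (p.1.2 = p.2.2 ∧ p.1.2 ∈ J ∧ ¬ (p.1.1 = true ∧ p.2.1 = true))
        then f p.1 p.2 else 0) =
      (if p.2.2 < p.1.2 then f p.1 p.2 else 0) +
      (if p.2.2 = p.1.2 then (if p.1.2 ∈ J then
        (if p.1.1 = true ∧ p.2.1 = true then 0 else f p.1 p.2) else 0) else 0) := by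
    rintro ⟨⟨b, i⟩, ⟨b', j⟩⟩
    rcases lt_trichotomy j i with hji | rfl | hji
    · simp [hji, hji.ne]
    · by_cases h1 : j ∈ J <;> by_cases h2 : b = true ∧ b' = true <;> simp [h1, h2]
    · simp [hji.not_gt, hji.ne']
      intro h; exact absurd h.symm hji.ne'
  rw [approachingParts, Finset.sum_filter, Finset.sum_congr rfl fun p _ => h p,
    Finset.sum_add_distrib]
  congr 1
  · simp only [Fintype.sum_prod_type, Fintype.sum_bool, Finset.sum_filter, ← Finset.sum_add_distrib]
    refine Finset.sum_congr rfl fun i _ => Finset.sum_congr rfl fun j _ => ?_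
    split_ifs <;> simp
  · simp only [Fintype.sum_prod_type, Fintype.sum_bool, Finset.sum_ite_eq',
      Finset.mem_univ, if_true, ← Finset.sum_add_distrib]
    rw [← Finset.sum_filter_add_sum_filter_not Finset.univ (fun i => i ∈ J)]
    rw [Finset.filter_univ_mem]
    rw [Finset.sum_congr rfl (g := fun i => f (false, i) (false, i) + f (true, i) (false, i) +
      f (false, i) (true, i)) fun i hi => ?_]
    · rw [Finset.sum_eq_zero (s := Finset.univ.filter fun i => i ∉ J), add_zero]
      intro i hi
      simp [(Finset.mem_filter.1 hi).2]
    · simp only [hi, if_true, and_self, Bool.false_eq_true, and_false, false_and, if_false, zero_add]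
      abel

namespace ConservationLaw

variable {n : ℕ} (S : ConservationLaw n) (B : Set (State n))

theorem rho_eq (J : Finset (Fin n)) (u : ℝ → State n) :
    S.rho B J u = ∑ p ∈ approachingParts J,
      (jordanPart (S.waveMeasure B u) p.1).prod (jordanPart (S.waveMeasure B u) p.2) := by
  rw [sum_approachingParts J (fun p q =>
    (jordanPart (S.waveMeasure B u) p).prod (jordanPart (S.waveMeasure B u) q))]
  have e1 : ∀ i, S.wavePos B u i = jordanPart (S.waveMeasure B u) (true, i) := fun i => by
    simp [jordanPart, wavePos]
  have e2 : ∀ i, S.waveNeg B u i = jordanPart (S.waveMeasure B u) (false, i) := fun i => by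
    simp [jordanPart, waveNeg]
  simp only [rho, waveAbs, e1, e2, Measure.prod_add, Measure.add_prod]
  congr 1
  refine Finset.sum_congr rfl fun i _ => Finset.sum_congr rfl fun j _ => ?_
  abel

theorem QHat_eq (J : Finset (Fin n)) (w : Lp (State n) 1 (volume : Measure ℝ)) :
    S.QHat B J w = ENNReal.ofReal (measureQ J (S.waveMeasure B (bvRepresentative w))) := by
  rw [QHat, rho_eq, Measure.finsetSum_apply, measureQ,
    ENNReal.ofReal_sum_of_nonneg fun _ _ => measureReal_nonneg]
  exact Finset.sum_congr rfl fun p _ => by rw [ofReal_measureReal]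

theorem UpsilonHat_eq (J : Finset (Fin n)) {C₀ : ℝ} (hC : 0 ≤ C₀)
    (w : Lp (State n) 1 (volume : Measure ℝ)) :
    S.UpsilonHat B J C₀ w =
      ENNReal.ofReal (measureV (S.waveMeasure B (bvRepresentative w)) +
        C₀ * measureQ J (S.waveMeasure B (bvRepresentative w))) := by
  have h0 : 0 ≤ measureV (S.waveMeasure B (bvRepresentative w)) :=
    Finset.sum_nonneg fun _ _ => measureReal_nonneg
  have h1 : 0 ≤ measureQ J (S.waveMeasure B (bvRepresentative w)) :=
    Finset.sum_nonneg fun _ _ => measureReal_nonneg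
  rw [UpsilonHat, QHat_eq, ENNReal.ofReal_add h0 (by positivity), ENNReal.ofReal_mul hC]
  congr 1
  rw [measureV, ENNReal.ofReal_sum_of_nonneg fun _ _ => measureReal_nonneg,
    Fintype.sum_prod_type_right]
  refine Finset.sum_congr rfl fun i _ => ?_
  simp only [Fintype.sum_bool]
  simp [waveAbs, wavePos, waveNeg, jordanPart]

end ConservationLaw

theorem waves_map {α β γ : Type*} (E : β → β → γ) (f : α → β) (l : List α) :
    waves E (l.map f) = waves (fun a b => E (f a) (f b)) l := by
  induction l with
  | nil => rfl
  | cons a l ih =>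
    cases l with
    | nil => rfl
    | cons b l => simpa [waves] using ih

theorem map_waves {α β γ : Type*} (E : α → α → β) (f : β → γ) (l : List α) :
    (waves E l).map f = waves (fun a b => f (E a b)) l := by
  induction l with
  | nil => rfl
  | cons a l ih =>
    cases l with
    | nil => rfl
    | cons b l => simpa [waves] using ih

theorem sum_waves_le {α : Type*} {f g : α → α → ℝ} {l : List α}
    (h : ∀ a ∈ l, ∀ b ∈ l, f a b ≤ g a b) : (waves f l).sum ≤ (waves g l).sum := by
  induction l with
  | nil => simp [waves]
  | cons a l ih =>
    cases l with
    | nil => simp [waves]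
    | cons b l =>
      simp only [waves, List.sum_cons]
      exact add_le_add (h a (by simp) b (by simp))
        (ih fun x hx y hy => h x (by simp [hx]) y (by simp [hy]))

theorem sum_waves_const_mul {α : Type*} (c : ℝ) (f : α → α → ℝ) (l : List α) :
    (waves (fun a b => c * f a b) l).sum = c * (waves f l).sum := by
  rw [← map_waves f (fun x => c * x), List.sum_map_mul_left]
  simp

/-- The length of the polygonal path through the points of a list. -/
noncomputable def pathLength {n : ℕ} (l : List (State n)) : ℝ := (waves (fun a b => ‖b - a‖) l).sum

theorem fanV_eq_sum {n : ℕ} (W : List (Fin n → ℝ)) :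
    fanV W = (W.map fun σ => ∑ i, |σ i|).sum := by
  induction W with
  | nil => simp [fanV]
  | cons σ W ih => rw [fanV_cons, ih]; simp

theorem FanEstimates.fanV_waves_le {n : ℕ} {G : Finset (Fin n)}
    {E : State n → State n → Fin n → ℝ} {l : Fin n → State n → State n} {η K : ℝ}
    (h : FanEstimates G E l η K) {s : List (State n)} (hs : ∀ a ∈ s, a ∈ Metric.ball 0 η) :
    fanV (waves E s) ≤ n * K * pathLength s := by
  rw [fanV_eq_sum, map_waves, pathLength, ← sum_waves_const_mul]
  refine sum_waves_le fun a ha b hb => ?_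
  calc ∑ i, |E a b i| ≤ ∑ _i : Fin n, K * ‖b - a‖ :=
        Finset.sum_le_sum fun i _ => h.abs_le (hs a ha) (hs b hb) i
    _ = n * K * ‖b - a‖ := by simp; ring

/-! ### Continuity of the discrete functionals in the wave strengths. -/

section tendsto

variable {α ι : Type*} {𝓕 : Filter ι} {n : ℕ} {e : ι → α → α → Fin n → ℝ} {e₀ : α → α → Fin n → ℝ}

theorem tendsto_sum_part_waves {l : List α}
    (h : ∀ a ∈ l, ∀ b ∈ l, Tendsto (fun k => e k a b) 𝓕 (𝓝 (e₀ a b))) (p : Bool × Fin n) :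
    Tendsto (fun k => ((waves (e k) l).map (part p)).sum) 𝓕
      (𝓝 ((waves e₀ l).map (part p)).sum) := by
  induction l with
  | nil => exact tendsto_const_nhds
  | cons a l ih =>
    cases l with
    | nil => exact tendsto_const_nhds
    | cons b l =>
      simp only [waves, List.map_cons, List.sum_cons]
      exact (((continuous_part p).tendsto _).comp (h a (by simp) b (by simp))).add
        (ih fun x hx y hy => h x (by simp [hx]) y (by simp [hy]))

theorem tendsto_pairSum_waves {l : List α}
    (h : ∀ a ∈ l, ∀ b ∈ l, Tendsto (fun k => e k a b) 𝓕 (𝓝 (e₀ a b))) (p q : Bool × Fin n) :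
    Tendsto (fun k => pairSum (part p) (part q) (waves (e k) l)) 𝓕
      (𝓝 (pairSum (part p) (part q) (waves e₀ l))) := by
  induction l with
  | nil => exact tendsto_const_nhds
  | cons a l ih =>
    cases l with
    | nil => exact tendsto_const_nhds
    | cons b l =>
      have h' : ∀ x ∈ b :: l, ∀ y ∈ b :: l, Tendsto (fun k => e k x y) 𝓕 (𝓝 (e₀ x y)) :=
        fun x hx y hy => h x (by simp [hx]) y (by simp [hy])
      simp only [waves, pairSum]
      exact ((((continuous_part p).tendsto _).comp (h a (by simp) b (by simp))).mul
        (tendsto_sum_part_waves h' q)).add (ih h')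

theorem tendsto_fanV_waves {l : List α}
    (h : ∀ a ∈ l, ∀ b ∈ l, Tendsto (fun k => e k a b) 𝓕 (𝓝 (e₀ a b))) :
    Tendsto (fun k => fanV (waves (e k) l)) 𝓕 (𝓝 (fanV (waves e₀ l))) :=
  tendsto_finsetSum _ fun p _ => tendsto_sum_part_waves h p

theorem tendsto_fanQ_waves {l : List α}
    (h : ∀ a ∈ l, ∀ b ∈ l, Tendsto (fun k => e k a b) 𝓕 (𝓝 (e₀ a b))) (J : Finset (Fin n)) :
    Tendsto (fun k => fanQ J (waves (e k) l)) 𝓕 (𝓝 (fanQ J (waves e₀ l))) :=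
  tendsto_finsetSum _ fun p _ => tendsto_pairSum_waves h p.1 p.2

end tendsto

theorem FanEstimates.tendsto {ι : Type*} {𝓕 : Filter ι} {n : ℕ} {G : Finset (Fin n)}
    {E : State n → State n → Fin n → ℝ} {l : Fin n → State n → State n} {η K : ℝ}
    (h : FanEstimates G E l η K) {f g : ι → State n} {a b : State n}
    (hf : Tendsto f 𝓕 (𝓝 a)) (hg : Tendsto g 𝓕 (𝓝 b))
    (ha : a ∈ Metric.ball 0 η) (hb : b ∈ Metric.ball 0 η) :
    Tendsto (fun k => E (f k) (g k)) 𝓕 (𝓝 (E a b)) := by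
  refine tendsto_pi_nhds.2 fun i => ?_
  rw [tendsto_iff_dist_tendsto_zero]
  have h1 : Tendsto (fun k => K * (‖f k - a‖ + ‖g k - b‖)) 𝓕 (𝓝 (K * (0 + 0))) :=
    ((tendsto_iff_norm_sub_tendsto_zero.1 hf).add (tendsto_iff_norm_sub_tendsto_zero.1 hg)).const_mul
      K
  rw [add_zero, mul_zero] at h1
  refine squeeze_zero' (Eventually.of_forall fun _ => dist_nonneg) ?_ h1
  filter_upwards [hf (Metric.isOpen_ball.mem_nhds ha), hg (Metric.isOpen_ball.mem_nhds hb)]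
    with k hk hk'
  rw [Real.dist_eq]
  exact h.lipschitz _ hk _ hk' _ ha _ hb i

/-- `u` is right continuous, of bounded variation, and its values and variation are at most `v`. -/
structure IsTame {n : ℕ} (v : ℝ) (u : ℝ → State n) : Prop where
  right_continuous : ∀ x, ContinuousWithinAt u (Ici x) x
  boundedVariation : BoundedVariationOn u univ
  norm_le : ∀ x, ‖u x‖ ≤ v
  pathLength_le : ∀ t : List ℝ, t.Pairwise (· < ·) → pathLength (t.map u) ≤ v

/-! ### The functionals of the wave measures dominate those of all partitions. -/

section partition

variable {n : ℕ} {S : ConservationLaw n} {B : Set (State n)} {G J : Finset (Fin n)} {η K v C₀ : ℝ}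
  {u : ℝ → State n}

/-- Wave measures are approximated by the waves of arbitrarily fine partitions. -/
theorem IsTame.exists_partition (hu : IsTame v u) (hF : FanEstimates G (S.E B) S.l η K)
    (hv : v < η) (J : Finset (Fin n)) (F₀ : Finset ℝ) {ε : ℝ} (hε : 0 < ε) :
    ∃ t : List ℝ, t.Pairwise (· < ·) ∧ (∀ x ∈ F₀, x ∈ t) ∧
      |fanQ J (waves (S.E B) (t.map u)) - measureQ J (S.waveMeasure B u)| ≤ ε ∧
      |fanV (waves (S.E B) (t.map u)) - measureV (S.waveMeasure B u)| ≤ ε := by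
  simp only [waves_map]
  have hK := hF.nonneg
  exact exists_partition_approx (S.waveMeasure B u) hu.boundedVariation.vectorMeasure.variation
    (K := 3 * K + (2 * n) ^ 2 * K ^ 3) (by positivity)
    (fun a b hab i => ConservationLaw.abs_E_sub_waveMeasure_le hF hu.boundedVariation
      hu.right_continuous hv hu.norm_le hab i) J F₀ hε

variable (hF : FanEstimates G (S.E B) S.l η K)
  (hv : v < η) (hGJ : G ⊆ J) (hKv : 2 * n * (2 * n) * K * (n * K * v) ≤ 1 / 2)
  (hC₀ : 2 * n * K ≤ C₀)
include hF hv hGJ hKv hC₀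

/-- Any partition is contained in one whose discrete functionals are within `ε` of those of the wave
measures, and refinement only increases the two functionals. The bound on the path length keeps the
strengths of all intermediate lists below `n * K * v`, as monotonicity requires. -/
theorem IsTame.fan_le (hu : IsTame v u) {t : List ℝ} (ht : t.Pairwise (· < ·)) :
    fanQ J (waves (S.E B) (t.map u)) ≤ measureQ J (S.waveMeasure B u) ∧
      fanV (waves (S.E B) (t.map u)) + C₀ * fanQ J (waves (S.E B) (t.map u)) ≤
        measureV (S.waveMeasure B u) + C₀ * measureQ J (S.waveMeasure B u) := by
  have hK := hF.nonneg
  have hC0 : 0 ≤ C₀ := le_trans (by positivity) hC₀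
  have key : ∀ ε > 0, fanQ J (waves (S.E B) (t.map u)) ≤ measureQ J (S.waveMeasure B u) + ε ∧
      fanV (waves (S.E B) (t.map u)) + C₀ * fanQ J (waves (S.E B) (t.map u)) ≤
        measureV (S.waveMeasure B u) + C₀ * measureQ J (S.waveMeasure B u) + (1 + C₀) * ε := by
    intro ε hε
    obtain ⟨t', ht', hmem, hQ, hV⟩ := hu.exists_partition hF hv J t.toFinset hε
    have hsub : t.Sublist t' :=
      List.sublist_of_subperm_of_pairwise (r := (· < ·))
        (List.subperm_of_subset (ht.imp ne_of_lt) fun x hx => hmem x (by simpa using hx)) ht ht'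
    have hball : ∀ a ∈ t'.map u, a ∈ Metric.ball (0 : State n) η := fun a ha => by
      obtain ⟨x, _, rfl⟩ := List.mem_map.1 ha
      simpa using (hu.norm_le x).trans_lt hv
    have h := fan_sublist_le hGJ hK hKv hC₀ (hsub.map u) hball hF.glimm (fun s hs => by
      obtain ⟨t'', ht'', rfl⟩ := List.sublist_map_iff.1 hs
      refine (hF.fanV_waves_le fun a ha => hball a (hs.subset ha)).trans ?_
      exact mul_le_mul_of_nonneg_left (hu.pathLength_le _ (ht'.sublist ht'')) (by positivity))
    have := abs_le.1 hQ
    have := abs_le.1 hV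
    refine ⟨by linarith [h.1], h.2.trans ?_⟩
    nlinarith
  constructor
  · exact le_of_forall_pos_le_add fun ε hε => (key ε hε).1
  · refine le_of_forall_pos_le_add fun ε hε => ?_
    have h1 : 0 < 1 + C₀ := by positivity
    have := (key (ε / (1 + C₀)) (by positivity)).2
    rwa [mul_div_cancel₀ _ h1.ne'] at this

end partition

/-! ### Lower semicontinuity -/

/-- If the functions differ at one point, they differ on an interval to the right of it, which has
positive measure. Hence the right continuous representative is unique and `bvRepresentative` can be
computed from any one. -/
theorem eq_of_ae_eq_of_continuousWithinAt_Ici {E : Type*} [TopologicalSpace E] [T2Space E]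
    {u v : ℝ → E} (h : u =ᵐ[volume] v) (hu : ∀ x, ContinuousWithinAt u (Ici x) x)
    (hv : ∀ x, ContinuousWithinAt v (Ici x) x) : u = v := by
  ext1 x
  by_contra hne
  have h1 : Tendsto (fun y => (u y, v y)) (𝓝[>] x) (𝓝 (u x, v x)) :=
    (((hu x).mono Ioi_subset_Ici_self).tendsto).prodMk_nhds
      ((hv x).mono Ioi_subset_Ici_self).tendsto
  have h2 : ∀ᶠ y in 𝓝[>] x, u y ≠ v y := by
    have : {p : E × E | p.1 ≠ p.2} ∈ 𝓝 (u x, v x) :=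
      (isOpen_ne_fun continuous_fst continuous_snd).mem_nhds hne
    exact h1 this
  obtain ⟨b, hb, hsub⟩ := mem_nhdsGT_iff_exists_Ioo_subset.1 h2
  have h3 : volume (Ioo x b) = 0 := measure_mono_null hsub h
  rw [Real.volume_Ioo, ENNReal.ofReal_eq_zero] at h3
  exact absurd hb (by simpa using h3)

theorem IsTame.isBVRepresentative {n : ℕ} {v : ℝ} {u : ℝ → State n}
    {w : Lp (State n) 1 (volume : Measure ℝ)} (hu : IsTame v u) (h : w =ᵐ[volume] u) :
    IsBVRepresentative w u :=
  ⟨h, hu.right_continuous, hu.boundedVariation⟩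

theorem IsBVRepresentative.eq_bvRepresentative {n : ℕ} {u : ℝ → State n}
    {w : Lp (State n) 1 (volume : Measure ℝ)} (h : IsBVRepresentative w u) :
    bvRepresentative w = u := by
  have he : ∃ u, IsBVRepresentative w u := ⟨u, h⟩
  rw [bvRepresentative, dif_pos he]
  exact eq_of_ae_eq_of_continuousWithinAt_Ici (he.choose_spec.ae_eq.symm.trans h.ae_eq)
    he.choose_spec.right_continuous h.right_continuous

/-- Almost every translation moves all the finitely many points into `T`, and a right neighbourhood
of `0` has positive measure. In this way almost everywhere convergence becomes convergence at all
points of a slightly shifted partition. -/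
theorem exists_shift_mem {T : Set ℝ} (hT : ∀ᵐ x, x ∈ T) (t : List ℝ) {P : ℝ → Prop}
    (hP : ∀ᶠ h in 𝓝[>] (0 : ℝ), P h) : ∃ h, P h ∧ ∀ x ∈ t, x + h ∈ T := by
  have h1 : ∀ᵐ h : ℝ, ∀ x ∈ t, x + h ∈ T := by
    induction t with
    | nil => simp
    | cons a t ih =>
      have : ∀ᵐ h : ℝ, a + h ∈ T := by
        have := (measurePreserving_add_left (volume : Measure ℝ) a).quasiMeasurePreserving.ae hT
        exact this
      filter_upwards [ih, this] with h h1 h2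
      simpa using ⟨h2, h1⟩
  obtain ⟨b, hb, hsub⟩ := mem_nhdsGT_iff_exists_Ioo_subset.1 hP
  by_contra hcon
  push Not at hcon
  have h2 : volume (Ioo 0 b) = 0 := by
    refine measure_mono_null (fun h hh => ?_) h1
    obtain ⟨x, hx, hx'⟩ := hcon h (hsub hh)
    exact fun hall => hx' (hall x hx)
  rw [Real.volume_Ioo, ENNReal.ofReal_eq_zero] at h2
  exact absurd hb (by simpa using h2)

section lsc

variable {n : ℕ} {E : State n → State n → Fin n → ℝ} {l : Fin n → State n → State n}
  {G : Finset (Fin n)} {η K v : ℝ}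

/-- A functional of the waves of a function which is the supremum of a continuous functional over
all partitions is lower semicontinuous. -/
theorem lowerSemicontinuousOn_of_partition (hF : FanEstimates G E l η K) (hv : v < η)
    {D : Set (Lp (State n) 1 (volume : Measure ℝ))}
    (hD : ∀ w ∈ D, ∃ u, w =ᵐ[volume] u ∧ IsTame v u)
    (Φ : List (Fin n → ℝ) → ℝ) (m : (ℝ → State n) → ℝ)
    (hΦ : ∀ (ι : Type) (𝓕 : Filter ι) (e : ι → ℝ → ℝ → Fin n → ℝ) (e₀ : ℝ → ℝ → Fin n → ℝ)
      (t : List ℝ), (∀ a ∈ t, ∀ b ∈ t, Tendsto (fun k => e k a b) 𝓕 (𝓝 (e₀ a b))) →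
      Tendsto (fun k => Φ (waves (e k) t)) 𝓕 (𝓝 (Φ (waves e₀ t))))
    (hle : ∀ u, IsTame v u → ∀ t : List ℝ, t.Pairwise (· < ·) → Φ (waves E (t.map u)) ≤ m u)
    (hsup : ∀ u, IsTame v u → ∀ ε > 0, ∃ t : List ℝ, t.Pairwise (· < ·) ∧
      m u - ε ≤ Φ (waves E (t.map u))) :
    LowerSemicontinuousOn (fun w => ENNReal.ofReal (m (bvRepresentative w))) D := by
  intro w hw y hy
  change y < ENNReal.ofReal (m (bvRepresentative w)) at hy
  change ∀ᶠ w' in 𝓝[D] w, y < ENNReal.ofReal (m (bvRepresentative w'))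
  by_contra hcon
  rw [not_eventually] at hcon
  obtain ⟨ws, hws, hwy⟩ := exists_seq_forall_of_frequently
    (hcon.and_eventually self_mem_nhdsWithin)
  have hlim : Tendsto ws atTop (𝓝 w) := hws.mono_right nhdsWithin_le_nhds
  obtain ⟨φ, hφ, hae⟩ := (tendstoInMeasure_of_tendsto_Lp hlim).exists_seq_tendsto_ae
  obtain ⟨u, hwu, hu⟩ := hD w hw
  choose us hwus hus using fun k => hD (ws k) (hwy k).2
  rw [(hu.isBVRepresentative hwu).eq_bvRepresentative] at hy
  have hk : ∀ k, m (us k) ≤ y.toReal := fun k => by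
    have := (hwy k).1
    rw [((hus k).isBVRepresentative (hwus k)).eq_bvRepresentative, not_lt] at this
    exact (ENNReal.ofReal_le_iff_le_toReal (ne_top_of_lt hy)).1 this
  have hy' : y.toReal < m u := (ENNReal.lt_ofReal_iff_toReal_lt (ne_top_of_lt hy)).1 hy
  have hT : ∀ᵐ x, x ∈ {x | Tendsto (fun k => us (φ k) x) atTop (𝓝 (u x))} := by
    have h1 : ∀ᵐ x, ∀ k, (ws k) x = us k x := ae_all_iff.2 hwus
    filter_upwards [hae, h1, hwu] with x hx h1 h2
    simpa only [h1, h2] using hx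
  obtain ⟨t, ht, htm⟩ := hsup u hu ((m u - y.toReal) / 2) (by linarith)
  have hball : ∀ x, u x ∈ Metric.ball (0 : State n) η := fun x => by
    simpa using (hu.norm_le x).trans_lt hv
  -- By right continuity a small shift of the partition to the right hardly changes the functional
  -- of `u`, so it stays above `y` while the shifted points become points of convergence.
  have hshift : Tendsto (fun h : ℝ => Φ (waves (fun a b => E (u (a + h)) (u (b + h))) t))
      (𝓝[>] 0) (𝓝 (Φ (waves (fun a b => E (u a) (u b)) t))) := by
    have hx : ∀ x, Tendsto (fun h => u (x + h)) (𝓝[>] 0) (𝓝 (u x)) := fun x => by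
      refine ((hu.right_continuous x).mono Ioi_subset_Ici_self).tendsto.comp ?_
      refine tendsto_nhdsWithin_iff.2 ⟨?_, ?_⟩
      · have : Tendsto (fun h : ℝ => x + h) (𝓝 0) (𝓝 (x + 0)) :=
          (continuous_const.add continuous_id).tendsto 0
        rw [add_zero] at this
        exact this.mono_left nhdsWithin_le_nhds
      · filter_upwards [self_mem_nhdsWithin] with h hh
        exact lt_add_of_pos_right x hh
    exact hΦ _ _ _ _ t fun a _ b _ => hF.tendsto (hx a) (hx b) (hball a) (hball b)
  have hlt : y.toReal < Φ (waves (fun a b => E (u a) (u b)) t) := by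
    rw [← waves_map]; linarith
  obtain ⟨h, hh, hhT⟩ := exists_shift_mem hT t (hshift.eventually (lt_mem_nhds hlt))
  have hk2 : Tendsto (fun k => Φ (waves (fun a b => E (us (φ k) (a + h)) (us (φ k) (b + h))) t))
      atTop (𝓝 (Φ (waves (fun a b => E (u (a + h)) (u (b + h))) t))) :=
    hΦ _ _ _ _ t fun a ha b hb => hF.tendsto (hhT a ha) (hhT b hb) (hball _) (hball _)
  obtain ⟨k, hk3⟩ := (hk2.eventually (lt_mem_nhds hh)).exists
  -- The shifted list is a partition for the approximating function too, and its functional is at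
  -- most `m (us (φ k)) ≤ y`, which is the contradiction.
  have h4 := hle _ (hus (φ k)) (t.map (· + h))
    (List.pairwise_map.2 (ht.imp fun hab => by simpa using hab))
  rw [List.map_map, waves_map] at h4
  exact absurd (hk3.trans_le (h4.trans (hk (φ k)))) (lt_irrefl _)

end lsc

theorem ConservationLaw.lowerSemicontinuousOn_hat {n : ℕ} {S : ConservationLaw n}
    {B : Set (State n)} {G J : Finset (Fin n)} {η K v C₀ : ℝ}
    (hF : FanEstimates G (S.E B) S.l η K)
    (hv : v < η) (hGJ : G ⊆ J) (hKv : 2 * n * (2 * n) * K * (n * K * v) ≤ 1 / 2)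
    (hC₀ : 2 * n * K ≤ C₀)
    {D : Set (Lp (State n) 1 (volume : Measure ℝ))}
    (hD : ∀ w ∈ D, ∃ u, w =ᵐ[volume] u ∧ IsTame v u) :
    LowerSemicontinuousOn (S.QHat B J) D ∧ LowerSemicontinuousOn (S.UpsilonHat B J C₀) D := by
  have hK := hF.nonneg
  have hC0 : 0 ≤ C₀ := le_trans (by positivity) hC₀
  constructor
  · rw [funext (S.QHat_eq B J)]
    refine lowerSemicontinuousOn_of_partition hF hv hD (fanQ J)
      (fun u => measureQ J (S.waveMeasure B u)) (fun ι 𝓕 e e₀ t h => tendsto_fanQ_waves h J)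
      (fun u hu t ht => (hu.fan_le hF hv hGJ hKv hC₀ ht).1) fun u hu ε hε => ?_
    obtain ⟨t, ht, -, h, -⟩ := hu.exists_partition hF hv J ∅ hε
    exact ⟨t, ht, by linarith [(abs_le.1 h).1]⟩
  · rw [funext (S.UpsilonHat_eq B J hC0)]
    refine lowerSemicontinuousOn_of_partition hF hv hD (fun W => fanV W + C₀ * fanQ J W)
      (fun u => measureV (S.waveMeasure B u) + C₀ * measureQ J (S.waveMeasure B u))
      (fun ι 𝓕 e e₀ t h => (tendsto_fanV_waves h).add ((tendsto_fanQ_waves h J).const_mul C₀))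
      (fun u hu t ht => (hu.fan_le hF hv hGJ hKv hC₀ ht).2) fun u hu ε hε => ?_
    have hpos : 0 < 1 + C₀ := by positivity
    obtain ⟨t, ht, -, h, h'⟩ := hu.exists_partition hF hv J ∅ (div_pos hε hpos)
    refine ⟨t, ht, ?_⟩
    have h1 := (abs_le.1 h).1
    have h2 := (abs_le.1 h').1
    have h3 : (1 + C₀) * (ε / (1 + C₀)) = ε := mul_div_cancel₀ _ hpos.ne'
    nlinarith

/-! ### The closure of the piecewise constant functions -/

section BV

variable {n : ℕ}

theorem ofReal_pathLength_le (u : ℝ → State n) (t : List ℝ) (ht : t.Pairwise (· < ·)) :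
    ENNReal.ofReal (pathLength (t.map u)) ≤ eVariationOn u univ := by
  have key : ∀ (t : List ℝ) (a : ℝ), (a :: t).Pairwise (· < ·) →
      ENNReal.ofReal (pathLength ((a :: t).map u)) ≤ eVariationOn u (Ici a) := by
    intro t
    induction t with
    | nil => intro a _; simp [pathLength, waves]
    | cons b t ih =>
      intro a h
      have hab : a < b := (List.pairwise_cons.1 h).1 b (by simp)
      have h1 := ih b (List.pairwise_cons.1 h).2
      have h2 : pathLength ((a :: b :: t).map u) =
          ‖u b - u a‖ + pathLength ((b :: t).map u) := by
        simp [pathLength, waves]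
      have h3 : eVariationOn u {a, b} + eVariationOn u (Ici b) ≤ eVariationOn u (Ici a) := by
        refine (eVariationOn.add_le_union u ?_).trans (eVariationOn.mono u ?_)
        · rintro x (rfl | rfl) y hy
          · exact hab.le.trans hy
          · exact hy
        · rintro x ((rfl | rfl) | hx)
          · exact self_mem_Ici
          · exact hab.le
          · exact hab.le.trans hx
      rw [eVariationOn.pair] at h3
      rw [h2]
      refine ENNReal.ofReal_add_le.trans (le_trans ?_ h3)
      rw [edist_comm, edist_eq_enorm_sub, ofReal_norm]
      gcongr
  cases t with
  | nil => simp [pathLength, waves]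
  | cons a t => exact (key t a ht).trans (eVariationOn.mono u (subset_univ _))

theorem neBot_nhdsWithin_inter_Ioi {T : Set ℝ} (hT : ∀ᵐ x, x ∈ T) (x : ℝ) :
    (𝓝[T ∩ Ioi x] x).NeBot := by
  rw [← mem_closure_iff_nhdsWithin_neBot, Metric.mem_closure_iff]
  intro ε hε
  have h1 : ∀ᶠ h in 𝓝[>] (0 : ℝ), h ∈ Ioo 0 ε := Ioo_mem_nhdsGT hε
  obtain ⟨h, hh, hhT⟩ := exists_shift_mem hT [x] h1
  refine ⟨x + h, ⟨hhT x (by simp), by simpa using hh.1⟩, ?_⟩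
  rw [Real.dist_eq, sub_add_cancel_left, abs_neg, abs_of_pos hh.1]
  exact hh.2

/-- A function of bounded variation on a set of full measure coincides almost everywhere with a
right continuous one. -/
theorem exists_isTame {T : Set ℝ} (hT : ∀ᵐ x, x ∈ T) {g : ℝ → State n} {v : ℝ} (hv : 0 ≤ v)
    (hg : ∀ x ∈ T, ‖g x‖ ≤ v) (hgv : eVariationOn g T ≤ ENNReal.ofReal v) :
    ∃ u, g =ᵐ[volume] u ∧ IsTame v u := by
  have hbv : BoundedVariationOn g T := ne_top_of_le_ne_top ENNReal.ofReal_ne_top hgv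
  -- The representative is the right limit of `g` along `T`, which exists at every point, also off
  -- `T`.
  choose u hu using hbv.exists_tendsto_right
  have hne := neBot_nhdsWithin_inter_Ioi hT
  have hvar : eVariationOn u univ ≤ ENNReal.ofReal v := by
    refine iSup_le ?_
    rintro ⟨N, x, hx, -⟩
    -- Shifts that decrease to `0` and keep all chosen points inside `T`: along them the variation
    -- sums of `g` on `T` converge to that of `u`.
    set 𝓕 : Filter ℝ := 𝓝[>] 0 ⊓ 𝓟 {h | ∀ y ∈ (List.range (N + 1)).map x, y + h ∈ T} with h𝓕
    have : 𝓕.NeBot := by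
      rw [h𝓕, inf_principal_neBot_iff]
      intro U hU
      obtain ⟨h, hh, hhT⟩ := exists_shift_mem hT ((List.range (N + 1)).map x) hU
      exact ⟨h, hh, hhT⟩
    have hmem : ∀ i ≤ N, ∀ᶠ h in 𝓕, x i + h ∈ T := fun i hi => by
      have : ∀ᶠ h in 𝓕, ∀ y ∈ (List.range (N + 1)).map x, y + h ∈ T :=
        mem_inf_of_right (mem_principal_self _)
      filter_upwards [this] with h hh
      exact hh _ (List.mem_map.2 ⟨i, List.mem_range.2 (by omega), rfl⟩)
    have hlim : ∀ i ≤ N, Tendsto (fun h => g (x i + h)) 𝓕 (𝓝 (u (x i))) := fun i hi => by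
      refine (hu (x i)).comp (tendsto_nhdsWithin_iff.2 ⟨?_, ?_⟩)
      · have h1 : Tendsto (fun h : ℝ => x i + h) (𝓝 0) (𝓝 (x i + 0)) :=
          (continuous_const.add continuous_id).tendsto 0
        rw [add_zero] at h1
        exact h1.mono_left (inf_le_left.trans nhdsWithin_le_nhds)
      · have h2 : ∀ᶠ h : ℝ in 𝓕, 0 < h := mem_inf_of_left self_mem_nhdsWithin
        filter_upwards [hmem i hi, h2] with h h3 h4
        exact ⟨h3, lt_add_of_pos_right _ h4⟩
    have hsum : Tendsto (fun h => ∑ i ∈ Finset.range N, edist (g (x (i + 1) + h)) (g (x i + h))) 𝓕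
        (𝓝 (∑ i ∈ Finset.range N, edist (u (x (i + 1))) (u (x i)))) :=
      tendsto_finsetSum _ fun i hi =>
        (hlim (i + 1) (Finset.mem_range.1 hi)).edist (hlim i (Finset.mem_range.1 hi).le)
    refine le_of_tendsto hsum ?_
    have : ∀ᶠ h in 𝓕, ∀ i ∈ Finset.range (N + 1), x i + h ∈ T :=
      (Filter.eventually_all_finset _).2 fun i hi => hmem i (by
        have := Finset.mem_range.1 hi; omega)
    filter_upwards [this] with h hh
    refine le_trans ?_ hgv
    exact eVariationOn.sum_le_of_monotoneOn_Iic (u := fun i => x i + h)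
      (fun i _ j _ hij => by simpa using hx hij) fun i hi => hh i (by simp; omega)
  have hbu : BoundedVariationOn u univ := ne_top_of_le_ne_top ENNReal.ofReal_ne_top hvar
  refine ⟨u, ?_, ?_, hbu, fun x => ?_, fun t ht => ?_⟩
  -- On `T` each coordinate is a difference of monotone functions, hence continuous within `T` off a
  -- countable set; at the other points of `T` the right limit along `T` is the value.
  · have hcoord : ∀ i, ∀ᵐ x, x ∈ T → ContinuousWithinAt (fun y => g y i) T x := fun i => by
      have h1 : BoundedVariationOn (fun x => g x i) T :=
        (EuclideanSpace.proj (𝕜 := ℝ) i : State n →L[ℝ] ℝ).lipschitz.comp_boundedVariationOn hbv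
      obtain ⟨p, q, hp, hq, hpq⟩ :=
        h1.locallyBoundedVariationOn.exists_monotoneOn_sub_monotoneOn
      have h2 := hp.countable_not_continuousWithinAt.ae_notMem (volume : Measure ℝ)
      have h3 := hq.countable_not_continuousWithinAt.ae_notMem (volume : Measure ℝ)
      filter_upwards [h2, h3] with x hx1 hx2 hxT
      have hx1' : ContinuousWithinAt p T x := by
        by_contra h; exact hx1 ⟨hxT, h⟩
      have hx2' : ContinuousWithinAt q T x := by
        by_contra h; exact hx2 ⟨hxT, h⟩
      rw [hpq]
      exact hx1'.sub hx2'
    filter_upwards [ae_all_iff.2 hcoord, hT] with x hx hxT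
    ext i
    have h1 := ((EuclideanSpace.proj (𝕜 := ℝ) i : State n →L[ℝ] ℝ).continuous.tendsto (u x)).comp
      (hu x)
    have h2 : Tendsto (fun y => g y i) (𝓝[T ∩ Ioi x] x) (𝓝 (g x i)) :=
      ((hx i hxT).mono inter_subset_left).tendsto
    exact tendsto_nhds_unique h2 h1
  · intro x
    rw [Metric.continuousWithinAt_iff]
    intro ε hε
    have h1 := (hu x) (Metric.closedBall_mem_nhds (u x) (half_pos hε))
    rw [mem_map, mem_nhdsWithin_iff_exists_mem_nhds_inter] at h1
    obtain ⟨U, hU, hUsub⟩ := h1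
    obtain ⟨d, hd, hdU⟩ := Metric.mem_nhds_iff.1 hU
    refine ⟨d, hd, fun y hy hyd => ?_⟩
    rcases eq_or_lt_of_le (mem_Ici.1 hy) with rfl | hxy
    · simpa using hε
    have h2 : u y ∈ Metric.closedBall (u x) (ε / 2) := by
      refine Metric.isClosed_closedBall.mem_of_tendsto (hu y) ?_
      have h3 : Metric.ball x d ∈ 𝓝 y := Metric.isOpen_ball.mem_nhds hyd
      filter_upwards [self_mem_nhdsWithin, mem_nhdsWithin_of_mem_nhds h3] with z hz hz'
      exact hUsub ⟨hdU hz', hz.1, hxy.trans hz.2⟩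
    exact (Metric.mem_closedBall.1 h2).trans_lt (by linarith)
  · refine le_of_tendsto (hu x).norm ?_
    filter_upwards [self_mem_nhdsWithin] with y hy using hg y hy.1
  · exact (ENNReal.ofReal_le_ofReal_iff hv).1 ((ofReal_pathLength_le u t ht).trans hvar)

end BV

/-! ### Values and variation of piecewise constant functions. -/

section piecewise

variable {n : ℕ} {v : ℝ → State n}

theorem eq_of_eventually_eq_Ioo {a b : ℝ} (h : ∀ x ∈ Ioo a b, ∀ᶠ y in 𝓝 x, v y = v x)
    {x y : ℝ} (hx : x ∈ Ioo a b) (hy : y ∈ Ioo a b) : v x = v y := by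
  have hd : ∀ z ∈ Ioo a b, HasDerivAt v 0 z := fun z hz =>
    (hasDerivAt_const z (v z)).congr_of_eventuallyEq (h z hz)
  exact isOpen_Ioo.is_const_of_deriv_eq_zero isPreconnected_Ioo
    (fun z hz => (hd z hz).differentiableAt.differentiableWithinAt)
    (fun z hz => (hd z hz).deriv) hx hy

theorem IsPiecewiseConstant.eventually_eq_leftLim (hv : IsPiecewiseConstant v) (x : ℝ) :
    ∀ᶠ y in 𝓝[<] x, v y = Function.leftLim v x := by
  obtain ⟨F, hF⟩ := hv.locally_const
  have h1 : ∀ᶠ y in 𝓝[<] x, y ∉ F := by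
    have h2 : ((F : Set ℝ) \ {x})ᶜ ∈ 𝓝 x :=
      (F.finite_toSet.sdiff).isClosed.isOpen_compl.mem_nhds (by simp)
    filter_upwards [mem_nhdsWithin_of_mem_nhds h2, self_mem_nhdsWithin] with y hy hy'
    intro hyF
    exact hy ⟨hyF, (mem_Iio.1 hy').ne⟩
  obtain ⟨a, ha, hsub⟩ := mem_nhdsLT_iff_exists_Ioo_subset.1 h1
  have ha' : a < x := ha
  set z := (a + x) / 2
  have hz : z ∈ Ioo a x := ⟨by simp only [z]; linarith, by simp only [z]; linarith⟩
  have hc : ∀ᶠ y in 𝓝[<] x, v y = v z := by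
    filter_upwards [Ioo_mem_nhdsLT ha'] with y hy
    exact eq_of_eventually_eq_Ioo (fun t ht => hF t (hsub ht)) hy hz
  have : Function.leftLim v x = v z :=
    leftLim_eq_of_tendsto (tendsto_const_nhds.congr' (hc.mono fun y hy => hy.symm))
  rwa [this]

/-- The increments of a piecewise constant function are the sums of the jumps. -/
theorem IsPiecewiseConstant.exists_sub_eq_sum (hv : IsPiecewiseConstant v) :
    ∃ F : Finset ℝ, (↑F : Set ℝ) = jumpSet v ∧ ∀ a b, a ≤ b →
      v b - v a = ∑ x ∈ F.filter (fun x => a < x ∧ x ≤ b), (v x - Function.leftLim v x) := by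
  classical
  obtain ⟨F₀, hF₀⟩ := hv.locally_const
  have hsub : jumpSet v ⊆ F₀ := fun x hx => by
    by_contra hxF
    have h1 := (hF₀ x hxF).filter_mono (nhdsWithin_le_nhds (s := Iio x))
    obtain ⟨y, h2, h3⟩ := (h1.and (hv.eventually_eq_leftLim x)).exists
    exact hx (h3.symm.trans h2)
  have hfin : (jumpSet v).Finite := F₀.finite_toSet.subset hsub
  set F := hfin.toFinset with hF
  have hmem : ∀ x, x ∈ F ↔ Function.leftLim v x ≠ v x := fun x => by simp [hF, jumpSet]
  refine ⟨F, hfin.coe_toFinset, fun a b hab => ?_⟩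
  -- Subtracting the accumulated jumps leaves a function that is locally constant on both sides of
  -- every point, hence constant on the line.
  set g : ℝ → State n := fun y => v y - ∑ x ∈ F.filter (· ≤ y), (v x - Function.leftLim v x)
    with hg
  have hnear : ∀ y, ∀ᶠ z in 𝓝 y, ∀ x ∈ F, x ≠ y → (x ≤ z ↔ x ≤ y) := fun y => by
    refine (Filter.eventually_all_finset _).2 fun x _ => ?_
    by_cases hxy : x = y
    · exact Eventually.of_forall fun z h => absurd hxy h
    rcases lt_or_gt_of_ne hxy with h | h
    · filter_upwards [lt_mem_nhds h] with z hz _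
      exact ⟨fun _ => h.le, fun _ => hz.le⟩
    · filter_upwards [gt_mem_nhds h] with z hz _
      exact ⟨fun h' => absurd hz (not_lt.2 h'), fun h' => absurd h (not_lt.2 h')⟩
  have hloc : IsLocallyConstant g := by
    rw [IsLocallyConstant.iff_eventually_eq]
    intro y
    have hR : ∀ᶠ z in 𝓝[>] y, g z = g y := by
      filter_upwards [hv.right y, (hnear y).filter_mono nhdsWithin_le_nhds, self_mem_nhdsWithin]
        with z h1 h2 h3
      simp only [hg, h1]
      congr 1
      refine Finset.sum_congr (Finset.filter_congr fun x hx => ?_) fun _ _ => rfl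
      by_cases hxy : x = y
      · subst hxy; simpa using (mem_Ioi.1 h3).le
      · exact h2 x hx hxy
    have hL : ∀ᶠ z in 𝓝[<] y, g z = g y := by
      filter_upwards [hv.eventually_eq_leftLim y, (hnear y).filter_mono nhdsWithin_le_nhds,
        self_mem_nhdsWithin] with z h1 h2 h3
      have h4 : F.filter (· ≤ z) = (F.filter (· ≤ y)).erase y := by
        ext x
        simp only [Finset.mem_filter, Finset.mem_erase]
        by_cases hxy : x = y
        · subst hxy; simpa using fun _ => mem_Iio.1 h3
        · exact ⟨fun h => ⟨hxy, h.1, (h2 x h.1 hxy).1 h.2⟩, fun h => ⟨h.2.1, (h2 x h.2.1 hxy).2 h.2.2⟩⟩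
      simp only [hg, h1, h4]
      by_cases hyF : y ∈ F
      · rw [← Finset.add_sum_erase (F.filter (· ≤ y)) _ (Finset.mem_filter.2 ⟨hyF, le_rfl⟩)]
        abel
      · rw [Finset.erase_eq_of_notMem (by simp [hyF])]
        have : Function.leftLim v y = v y := by
          by_contra h; exact hyF ((hmem y).2 h)
        rw [this]
    rw [← nhdsLT_sup_nhdsGE, eventually_sup]
    refine ⟨hL, ?_⟩
    rw [← nhdsGT_sup_nhdsWithin_singleton, eventually_sup]
    exact ⟨hR, by simp⟩
  have h := hloc.apply_eq_of_isPreconnected isPreconnected_univ (mem_univ b) (mem_univ a)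
  have h5 : F.filter (· ≤ b) = F.filter (· ≤ a) ∪ F.filter (fun x => a < x ∧ x ≤ b) := by
    ext x
    simp only [Finset.mem_filter, Finset.mem_union]
    constructor
    · rintro ⟨h1, h2⟩
      rcases le_or_gt x a with h3 | h3
      · exact Or.inl ⟨h1, h3⟩
      · exact Or.inr ⟨h1, h3, h2⟩
    · rintro (⟨h1, h2⟩ | ⟨h1, h2, h3⟩)
      · exact ⟨h1, h2.trans hab⟩
      · exact ⟨h1, h3⟩
  simp only [hg] at h
  rw [h5, Finset.sum_union] at h
  · rw [sub_eq_sub_iff_add_eq_add] at h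
    rw [sub_eq_iff_eq_add]
    have h6 : v b + ∑ x ∈ F.filter (· ≤ a), (v x - Function.leftLim v x) =
      ∑ x ∈ F.filter (fun x => a < x ∧ x ≤ b), (v x - Function.leftLim v x) + v a +
        ∑ x ∈ F.filter (· ≤ a), (v x - Function.leftLim v x) := by
      rw [h]; abel
    exact add_right_cancel h6
  · rw [Finset.disjoint_filter]
    exact fun x _ h1 h2 => absurd h2.1 (not_lt.2 h1)

/-- To the left of all jumps an integrable `v` is a constant on a half-line, so it vanishes there.
Both the values and the variation are then controlled by the sum of the jumps. -/
theorem IsPiecewiseConstant.bounds (hv : IsPiecewiseConstant v) (hint : Integrable v) {M : ℝ}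
    (hM : ∀ F : Finset ℝ, (↑F : Set ℝ) = jumpSet v →
      ∑ x ∈ F, ‖v x - Function.leftLim v x‖ ≤ M) :
    (∀ x, ‖v x‖ ≤ M) ∧ eVariationOn v univ ≤ ENNReal.ofReal M := by
  obtain ⟨F, hF, hsum⟩ := hv.exists_sub_eq_sum
  have hMF := hM F hF
  have hle : ∀ a b, a ≤ b → ‖v b - v a‖ ≤ M := fun a b hab => by
    rw [hsum a b hab]
    refine (norm_sum_le _ _).trans (le_trans ?_ hMF)
    exact Finset.sum_le_sum_of_subset_of_nonneg (Finset.filter_subset _ _)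
      fun _ _ _ => norm_nonneg _
  constructor
  · obtain ⟨a, ha⟩ : ∃ a, ∀ x ∈ F, a ≤ x := by
      obtain ⟨a, ha⟩ := F.bddBelow
      exact ⟨a, fun x hx => ha hx⟩
    have hconst : ∀ x < a, v x = v (a - 1) := fun x hx => by
      have key : ∀ y z, y ≤ z → z < a → v z - v y = 0 := fun y z hyz hz => by
        rw [hsum y z hyz, Finset.filter_eq_empty_iff.2, Finset.sum_empty]
        intro t ht h
        exact absurd (ha t ht) (not_le.2 (h.2.trans_lt hz))
      rcases le_total x (a - 1) with h | h
      · exact (sub_eq_zero.1 (key _ _ h (by linarith))).symm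
      · exact sub_eq_zero.1 (key _ _ h hx)
    have hzero : v (a - 1) = 0 := by
      have h1 : IntegrableOn (fun _ => v (a - 1)) (Iio a) :=
        (hint.integrableOn (s := Iio a)).congr_fun (fun x hx => hconst x hx) measurableSet_Iio
      rw [integrableOn_const_iff] at h1
      · rcases h1 with h1 | h1
        · exact enorm_eq_zero.1 h1
        · simp at h1
    intro x
    rcases lt_or_ge x a with hx | hx
    · rw [hconst x hx, hzero, norm_zero]
      exact (Finset.sum_nonneg fun _ _ => norm_nonneg _).trans hMF
    · have := hle (a - 1) x (by linarith)
      rwa [hzero, sub_zero] at this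
  · refine iSup_le ?_
    rintro ⟨N, x, hx, -⟩
    -- The accumulated jump sizes form a nondecreasing function whose increments dominate those of
    -- `v`, so the variation sums telescope.
    set m : ℝ → ℝ := fun y => ∑ z ∈ F.filter (· ≤ y), ‖v z - Function.leftLim v z‖ with hm
    have hstep : ∀ a b, a ≤ b → ‖v b - v a‖ ≤ m b - m a := fun a b hab => by
      have h1 : m b = m a + ∑ z ∈ F.filter (fun z => a < z ∧ z ≤ b),
          ‖v z - Function.leftLim v z‖ := by
        have h2 : (F.filter (· ≤ b)).filter (· ≤ a) = F.filter (· ≤ a) := by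
          ext z; simp only [Finset.mem_filter]
          exact ⟨fun h => ⟨h.1.1, h.2⟩, fun h => ⟨⟨h.1, h.2.trans hab⟩, h.2⟩⟩
        have h3 : (F.filter (· ≤ b)).filter (fun z => ¬ z ≤ a) =
            F.filter (fun z => a < z ∧ z ≤ b) := by
          ext z; simp only [Finset.mem_filter, not_le]
          tauto
        simp only [hm]
        rw [← Finset.sum_filter_add_sum_filter_not (F.filter (· ≤ b)) (· ≤ a), h2, h3]
      rw [h1, hsum a b hab, add_sub_cancel_left]
      exact norm_sum_le _ _
    calc ∑ i ∈ Finset.range N, edist (v (x (i + 1))) (v (x i))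
        ≤ ∑ i ∈ Finset.range N, ENNReal.ofReal (m (x (i + 1)) - m (x i)) := by
          refine Finset.sum_le_sum fun i _ => ?_
          rw [edist_dist, dist_eq_norm]
          exact ENNReal.ofReal_le_ofReal (hstep _ _ (hx (Nat.le_succ i)))
      _ = ENNReal.ofReal (m (x N) - m (x 0)) := by
          rw [← ENNReal.ofReal_sum_of_nonneg, Finset.sum_range_sub (fun i => m (x i))]
          exact fun i _ => (norm_nonneg _).trans (hstep _ _ (hx (Nat.le_succ i)))
      _ ≤ ENNReal.ofReal M := by
          refine ENNReal.ofReal_le_ofReal (le_trans ?_ hMF)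
          have h1 : 0 ≤ m (x 0) := Finset.sum_nonneg fun _ _ => norm_nonneg _
          have h2 : m (x N) ≤ ∑ z ∈ F, ‖v z - Function.leftLim v z‖ :=
            Finset.sum_le_sum_of_subset_of_nonneg (Finset.filter_subset _ _)
              fun _ _ _ => norm_nonneg _
          linarith

end piecewise

/-- Jumps are controlled by wave strengths, and the total strength is less than `δ`; so the
approximating piecewise constant functions have values and variation at most `C * δ`. Both bounds
survive on the set of pointwise convergence of a subsequence, because the variation is lower
semicontinuous. -/
theorem ConservationLaw.exists_isTame_of_mem_D {n : ℕ} {S : ConservationLaw n} {B : Set (State n)}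
    {C C₀ δ : ℝ} (hC : 0 ≤ C) (hC₀ : 0 ≤ C₀) (hδ : 0 ≤ δ)
    (hE : ∀ a b, (∃ σ, S.IsWaveDecomposition B a σ b) → ‖b - a‖ ≤ C * ∑ i, |S.E B a b i|)
    {w : Lp (State n) 1 (volume : Measure ℝ)} (hw : w ∈ S.D B C₀ δ) :
    ∃ u, w =ᵐ[volume] u ∧ IsTame (C * δ) u := by
  obtain ⟨ws, hws, hlim⟩ := mem_closure_iff_seq_limit.1 hw
  choose v hwv hpc hdec hups using hws
  have hbd : ∀ k, (∀ x, ‖v k x‖ ≤ C * δ) ∧ eVariationOn (v k) univ ≤ ENNReal.ofReal (C * δ) := by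
    intro k
    refine (hpc k).bounds ((L1.integrable_coeFn (ws k)).congr (hwv k)) fun F hF => ?_
    calc ∑ x ∈ F, ‖v k x - Function.leftLim (v k) x‖
        ≤ ∑ x ∈ F, C * ∑ i, |S.strength B (v k) x i| :=
          Finset.sum_le_sum fun x _ => hE _ _ (hdec k x)
      _ = C * S.V B (v k) := by
          rw [← Finset.mul_sum, V, ← hF, finsum_mem_coe_finset]
      _ ≤ C * δ := by
          refine mul_le_mul_of_nonneg_left ?_ hC
          have hQ : 0 ≤ S.Q B (v k) :=
            finsum_nonneg fun p => finsum_nonneg fun _ => abs_nonneg _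
          have := hups k
          rw [Upsilon] at this
          nlinarith [mul_nonneg hC₀ hQ]
  obtain ⟨φ, hφ, hae⟩ := (tendstoInMeasure_of_tendsto_Lp hlim).exists_seq_tendsto_ae
  set T : Set ℝ := {x | Tendsto (fun k => v (φ k) x) atTop (𝓝 (w x))} with hTdef
  have hT : ∀ᵐ x, x ∈ T := by
    have h1 : ∀ᵐ x, ∀ k, (ws k) x = v k x := ae_all_iff.2 hwv
    filter_upwards [hae, h1] with x hx h1
    simpa only [hTdef, mem_ofPred_eq, h1] using hx
  refine exists_isTame hT (by positivity) (fun x hx => ?_) ?_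
  · exact le_of_tendsto (Tendsto.norm hx) (Eventually.of_forall fun k => (hbd (φ k)).1 x)
  · by_contra hcon
    rw [not_le] at hcon
    obtain ⟨k, hk⟩ := (eVariationOn.lowerSemicontinuous_aux (F := fun k => v (φ k)) (p := atTop)
      (fun x hx => hx) hcon).exists
    exact absurd ((eVariationOn.mono _ (subset_univ T)).trans (hbd (φ k)).2) (not_le.2 hk)

/-! ### Calculus preliminaries -/

section calculus

/-- Integrals that depend smoothly on a parameter. -/
theorem contDiff_parametric_integral {P : Type} [NormedAddCommGroup P] [NormedSpace ℝ P]
    [FiniteDimensional ℝ P] (m : ℕ) :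
    ∀ {Z : Type} [NormedAddCommGroup Z] [NormedSpace ℝ Z] [CompleteSpace Z] {F : P × ℝ → Z},
      ContDiff ℝ m F → ContDiff ℝ m fun p => ∫ t in (0 : ℝ)..1, F (p, t) := by
  -- The target space stays general in the induction, since the derivative takes its values in `P
  -- →L[ℝ] Z`.
  induction m with
  | zero =>
    intro Z _ _ _ F hF
    rw [Nat.cast_zero, contDiff_zero] at hF ⊢
    exact intervalIntegral.continuous_parametric_intervalIntegral_of_continuous'
      (f := fun p t => F (p, t)) hF 0 1
  | succ m ih =>
    intro Z _ _ _ F hF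
    have : ProperSpace P := FiniteDimensional.proper ℝ P
    have hFd : Differentiable ℝ F := hF.differentiable (by simp)
    set F' : P × ℝ → P →L[ℝ] Z := fun q => (fderiv ℝ F q).comp (ContinuousLinearMap.inl ℝ P ℝ)
      with hF'
    have hF'm : ContDiff ℝ m F' :=
      (hF.fderiv_right (m := m) (by simp)).clm_comp contDiff_const
    have hd : ∀ p t, HasFDerivAt (fun p => F (p, t)) (F' (p, t)) p := fun p t =>
      (hFd (p, t)).hasFDerivAt.comp p (hasFDerivAt_prodMk_left p t)
    have key : ∀ p, HasFDerivAt (fun p => ∫ t in (0 : ℝ)..1, F (p, t))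
        (∫ t in (0 : ℝ)..1, F' (p, t)) p := fun p => by
      obtain ⟨C, hC⟩ := ((isCompact_closedBall p 1).prod (isCompact_Icc (a := (0 : ℝ)) (b := 1)))
        |>.exists_bound_of_continuousOn hF'm.continuous.continuousOn
      refine (intervalIntegral.hasFDerivAt_integral_of_dominated_of_fderiv_le
        (F := fun p t => F (p, t)) (F' := fun p t => F' (p, t)) (bound := fun _ => C)
        (s := Metric.ball p 1) (Metric.ball_mem_nhds p one_pos) ?_ ?_ ?_ ?_ ?_ ?_)
      · exact Eventually.of_forall fun p =>
          (hF.continuous.comp (by fun_prop : Continuous fun t : ℝ => (p, t))).aestronglyMeasurable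
      · exact (hF.continuous.comp
          (by fun_prop : Continuous fun t : ℝ => (p, t))).intervalIntegrable _ _
      · exact (hF'm.continuous.comp
          (by fun_prop : Continuous fun t : ℝ => (p, t))).aestronglyMeasurable
      · refine Eventually.of_forall fun t ht q hq => hC (q, t) ⟨Metric.ball_subset_closedBall hq, ?_⟩
        rw [uIoc_of_le zero_le_one] at ht
        exact ⟨ht.1.le, ht.2⟩
      · exact intervalIntegrable_const
      · exact Eventually.of_forall fun t _ q _ => hd q t
    rw [Nat.cast_succ, contDiff_succ_iff_hasFDerivAt]
    exact ⟨_, ih hF'm, key⟩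

/-- The implicit function theorem in finite dimension. -/
theorem exists_implicitFunction {X Y : Type*} [NormedAddCommGroup X] [NormedSpace ℝ X]
    [FiniteDimensional ℝ X] [NormedAddCommGroup Y] [NormedSpace ℝ Y] [FiniteDimensional ℝ Y]
    {Φ : X × Y → Y} {a : X} {b : Y} (hΦ : ContDiffAt ℝ 2 Φ (a, b)) (h0 : Φ (a, b) = 0)
    {Φ' : Y →ₗ[ℝ] Y} (hd : ∀ y, fderiv ℝ Φ (a, b) (0, y) = Φ' y)
    (hinj : ∀ y, Φ' y = 0 → y = 0) :
    ∃ h : X → Y, ContDiffAt ℝ 2 h a ∧ h a = b ∧ (∀ᶠ x in 𝓝 a, Φ (x, h x) = 0) ∧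
      ∀ᶠ v in 𝓝 (a, b), Φ v = 0 → v.2 = h v.1 := by
  have : CompleteSpace X := FiniteDimensional.complete ℝ X
  have : CompleteSpace Y := FiniteDimensional.complete ℝ Y
  have hinv : (fderiv ℝ Φ (a, b) ∘L .inr ℝ X Y).IsInvertible := by
    refine ⟨(LinearEquiv.ofInjectiveEndo Φ'
      (LinearMap.ker_eq_bot.1 (LinearMap.ker_eq_bot'.2 hinj))).toContinuousLinearEquiv, ?_⟩
    ext y
    simpa using (hd y).symm
  refine ⟨hΦ.implicitFunction two_ne_zero hinv, hΦ.contDiffAt_implicitFunction two_ne_zero hinv,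
    hΦ.implicitFunction_apply_self two_ne_zero hinv, ?_, ?_⟩
  · have := hΦ.eventually_apply_implicitFunction two_ne_zero hinv
    simpa only [h0] using this
  · filter_upwards [hΦ.eventually_apply_eq_iff_implicitFunction two_ne_zero hinv] with v hv hv0
    exact ((hv.1 (hv0.trans h0.symm))).symm

/-- Multiplication by a bump function supported in a small ball. The averaged Jacobian of the
extension is then defined and smooth for all pairs of states. -/
theorem exists_contDiff_extension {X Y : Type*} [NormedAddCommGroup X] [InnerProductSpace ℝ X]
    [FiniteDimensional ℝ X] [NormedAddCommGroup Y] [NormedSpace ℝ Y] {Ω : Set X} (hΩ : IsOpen Ω)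
    {f : X → Y} {m : ℕ} (hf : ContDiffOn ℝ m f Ω) {x : X} (hx : x ∈ Ω) :
    ∃ g : X → Y, ContDiff ℝ m g ∧ g =ᶠ[𝓝 x] f := by
  obtain ⟨ε, hε, hsub⟩ := Metric.isOpen_iff.1 hΩ x hx
  set χ : ContDiffBump x := ⟨ε / 4, ε / 2, by positivity, by linarith⟩
  refine ⟨fun y => χ y • f y, ?_, ?_⟩
  · rw [contDiff_iff_contDiffAt]
    intro y
    by_cases hy : y ∈ Metric.ball x ε
    · exact χ.contDiff.contDiffAt.smul (hf.contDiffAt (hΩ.mem_nhds (hsub hy)))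
    · have h1 : (fun y => χ y • f y) =ᶠ[𝓝 y] fun _ => 0 := by
        have h2 : (Metric.closedBall x (ε / 2))ᶜ ∈ 𝓝 y := by
          refine Metric.isClosed_closedBall.isOpen_compl.mem_nhds fun h => hy ?_
          exact Metric.closedBall_subset_ball (by linarith) h
        filter_upwards [h2] with z hz
        have : χ z = 0 := χ.zero_of_le_dist (le_of_lt (by simpa using hz))
        simp [this]
      exact contDiffAt_const.congr_of_eventuallyEq h1
  · filter_upwards [χ.eventuallyEq_one] with y hy
    simp [hy]

variable {n : ℕ}

/-- The averaged Jacobian matrix, `f w - f u = A(u, w) (w - u)`. -/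
noncomputable def meanJacobian (f : State n → State n) (p : State n × State n) :
    State n →L[ℝ] State n :=
  ∫ t in (0 : ℝ)..1, fderiv ℝ f (p.1 + t • (p.2 - p.1))

theorem contDiff_meanJacobian {f : State n → State n} {m : ℕ} (hf : ContDiff ℝ (m + 1 : ℕ) f) :
    ContDiff ℝ m (meanJacobian f) := by
  refine contDiff_parametric_integral (P := State n × State n) m
    (F := fun q => fderiv ℝ f (q.1.1 + q.2 • (q.1.2 - q.1.1))) ?_
  exact (hf.fderiv_right (m := m) (by simp)).comp (by fun_prop)

theorem meanJacobian_self (f : State n → State n) (u : State n) :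
    meanJacobian f (u, u) = fderiv ℝ f u := by
  simp [meanJacobian]

theorem meanJacobian_apply_sub {f : State n → State n} (hf : ContDiff ℝ 1 f) (u w : State n) :
    meanJacobian f (u, w) (w - u) = f w - f u := by
  have hc : Continuous fun t : ℝ => fderiv ℝ f (u + t • (w - u)) :=
    (hf.continuous_fderiv (by simp)).comp (by fun_prop)
  have hd : ∀ t : ℝ, HasDerivAt (fun t : ℝ => f (u + t • (w - u)))
      (fderiv ℝ f (u + t • (w - u)) (w - u)) t := fun t => by
    have h1 : HasDerivAt (fun t : ℝ => u + t • (w - u)) (w - u) t := by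
      simpa using ((hasDerivAt_id t).smul_const (w - u)).const_add u
    exact ((hf.differentiable (by simp)) _).hasFDerivAt.comp_hasDerivAt t h1
  rw [meanJacobian, ContinuousLinearMap.intervalIntegral_apply (hc.intervalIntegrable _ _),
    intervalIntegral.integral_eq_sub_of_hasDerivAt (fun t _ => hd t)
      ((hc.clm_apply continuous_const).intervalIntegrable _ _)]
  simp

end calculus

/-! ### Eigenvalues and eigenvectors of the averaged Jacobian matrix -/

namespace ConservationLaw

variable {n : ℕ} {S : ConservationLaw n}

/-- A family of matrices `A(u, w)` with `f w - f u = A(u, w) (w - u)` near the origin, with smooth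
eigenvalues `val i` and eigenvectors `vec i`, the latter being normalized by `φ i (vec i) = 1`, where
`φ i` is the basis dual to the right eigenvectors at the origin. -/
structure IsFrame (S : ConservationLaw n) (A : State n × State n → State n →L[ℝ] State n)
    (vec : Fin n → State n × State n → State n) (val : Fin n → State n × State n → ℝ)
    (φ : Fin n → State n →L[ℝ] ℝ) : Prop where
  vec_contDiffAt : ∀ i, ContDiffAt ℝ 2 (vec i) 0
  val_contDiffAt : ∀ i, ContDiffAt ℝ 2 (val i) 0
  f_differentiable : ∀ᶠ u in 𝓝 (0 : State n), HasFDerivAt S.f (A (u, u)) u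
  dual : ∀ i j, φ i (S.r j 0) = if i = j then 1 else 0
  vec_zero : ∀ i, vec i 0 = S.r i 0
  eigen : ∀ i, ∀ᶠ p in 𝓝 (0 : State n × State n), A p (vec i p) = val i p • vec i p
  normalized : ∀ i, ∀ᶠ p in 𝓝 (0 : State n × State n), φ i (vec i p) = 1
  mean : ∀ᶠ p in 𝓝 (0 : State n × State n), A p (p.2 - p.1) = S.f p.2 - S.f p.1
  independent : ∀ᶠ p in 𝓝 (0 : State n × State n), LinearIndependent ℝ fun i => vec i p
  complete : ∀ᶠ p in 𝓝 (0 : State n × State n), ∀ (x : State n) (c : ℝ), x ≠ 0 → A p x = c • x →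
    ∃ i, c = val i p ∧ x = φ i x • vec i p
  val_strictMono : ∀ᶠ p in 𝓝 (0 : State n × State n), StrictMono fun i => val i p
  lam_eq : ∀ᶠ u in 𝓝 (0 : State n), ∀ j, S.lam j u = val j (u, u)

theorem Admissible.r_zero_ne (hS : S.Admissible) (j : Fin n) : S.r j 0 ≠ 0 := by
  obtain ⟨-, -, h1, h2⟩ := (hS.eigenvector j).self_of_nhds
  intro h
  rcases hS.field j with hj | hj
  · have := h1 hj
    rw [h, map_zero] at this
    exact (hS.k_pos j).ne this
  · have := h2 hj
    rw [h, norm_zero] at this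
    exact zero_ne_one this

theorem Admissible.eigen_zero (hS : S.Admissible) (j : Fin n) :
    fderiv ℝ S.f 0 (S.r j 0) = S.lam j 0 • S.r j 0 :=
  (hS.eigenvector j).self_of_nhds.2.1

theorem Admissible.linearIndependent_r (hS : S.Admissible) :
    LinearIndependent ℝ fun j => S.r j 0 :=
  Module.End.eigenvectors_linearIndependent' (fderiv ℝ S.f 0 : State n →ₗ[ℝ] State n)
    (fun j => S.lam j 0) (hS.strictMono 0 hS.zero_mem).injective _
    fun j => ⟨Module.End.mem_eigenspace_iff.2 (hS.eigen_zero j), hS.r_zero_ne j⟩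

theorem exists_basis_eq {v : Fin n → State n} (hv : LinearIndependent ℝ v) :
    ∃ b : Module.Basis (Fin n) ℝ (State n), ∀ i, b i = v i :=
  ⟨Module.Basis.mk hv (hv.span_eq_top_of_card_eq_finrank' (by simp)).ge, fun i => by simp⟩

theorem Admissible.exists_dual (hS : S.Admissible) : ∃ φ : Fin n → State n →L[ℝ] ℝ,
    (∀ i j, φ i (S.r j 0) = if i = j then 1 else 0) ∧ ∀ x, x = ∑ i, φ i x • S.r i 0 := by
  obtain ⟨b, hbi⟩ := exists_basis_eq hS.linearIndependent_r
  refine ⟨fun i => LinearMap.toContinuousLinearMap (b.coord i), fun i j => ?_, fun x => ?_⟩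
  · rw [← hbi]
    simp [Finsupp.single_apply, eq_comm]
  · conv_lhs => rw [← b.sum_repr x]
    simp [hbi]

theorem strictMono_fin_eq_self {m : ℕ} {τ : Fin m → Fin m} (h : StrictMono τ) (i : Fin m) :
    τ i = i := by
  have hb : Function.Bijective τ := Finite.injective_iff_bijective.1 h.injective
  have : (h.orderIsoOfSurjective τ hb.2) = OrderIso.refl _ := Subsingleton.elim _ _
  exact congrArg (fun e : Fin m ≃o Fin m => e i) this

/-- A simple eigenvalue and its normalized eigenvector depend smoothly on the matrix: the system `A
p x = c x`, `φ j x = 1` has an injective linearization in `(x, c)` at the origin, where the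
eigenvalues are distinct. Rankine–Hugoniot equations become eigenvalue problems for `A`, since `A
(u, w) (w - u) = f w - f u`. -/
theorem Admissible.exists_isFrame (hS : S.Admissible) : ∃ A vec val φ, IsFrame S A vec val φ := by
  obtain ⟨f, hf, hfS⟩ := exists_contDiff_extension (m := 4) hS.isOpen hS.contDiffOn hS.zero_mem
  obtain ⟨φ, hφ, hexp⟩ := hS.exists_dual
  set A := meanJacobian f with hA
  have hA3 : ContDiff ℝ 3 A := contDiff_meanJacobian (m := 3) hf
  have hA2 : ContDiff ℝ 2 A := hA3.of_le (by norm_num)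
  have hAd : ∀ᶠ u in 𝓝 (0 : State n), A (u, u) = fderiv ℝ S.f u := by
    filter_upwards [hfS.eventuallyEq_nhds] with u hu
    rw [hA, meanJacobian_self, hu.fderiv_eq]
  have hA0 : A 0 = fderiv ℝ S.f 0 := hAd.self_of_nhds
  have hAe : ∀ i, A 0 (S.r i 0) = S.lam i 0 • S.r i 0 := fun i => by rw [hA0, hS.eigen_zero]
  have hAφ : ∀ j x, φ j (A 0 x) = S.lam j 0 * φ j x := fun j x => by
    conv_lhs => rw [hexp x]
    simp [hAe, hφ, mul_comm]
  have hpair : ∀ j, ∃ h : State n × State n → State n × ℝ, ContDiffAt ℝ 2 h 0 ∧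
      h 0 = (S.r j 0, S.lam j 0) ∧
      ∀ᶠ p in 𝓝 0, A p (h p).1 = (h p).2 • (h p).1 ∧ φ j (h p).1 = 1 := by
    intro j
    set Φ : (State n × State n) × (State n × ℝ) → State n × ℝ := fun q =>
      (A q.1 q.2.1 - q.2.2 • q.2.1, φ j q.2.1 - 1) with hΦ
    have hΦc : ContDiff ℝ 2 Φ :=
      (((hA2.comp contDiff_fst).clm_apply (contDiff_fst.comp contDiff_snd)).sub
        ((contDiff_snd.comp contDiff_snd).smul (contDiff_fst.comp contDiff_snd))).prodMk
        (((φ j).contDiff.comp (contDiff_fst.comp contDiff_snd)).sub contDiff_const)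
    set Φ' : State n × ℝ →ₗ[ℝ] State n × ℝ :=
      { toFun := fun y => (A 0 y.1 - (S.lam j 0 • y.1 + y.2 • S.r j 0), φ j y.1)
        map_add' := fun y z => by
          ext <;> simp [add_smul]; ring
        map_smul' := fun c y => by
          ext <;> simp [mul_sub, mul_add, mul_left_comm, mul_assoc] } with hΦ'
    have hd : ∀ y, fderiv ℝ Φ ((0 : State n × State n), (S.r j 0, S.lam j 0)) (0, y) = Φ' y := by
      intro y
      have h1 : HasFDerivAt (fun y : State n × ℝ => Φ ((0 : State n × State n), y))
          ((fderiv ℝ Φ ((0 : State n × State n), (S.r j 0, S.lam j 0))).comp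
            (ContinuousLinearMap.inr ℝ (State n × State n) (State n × ℝ))) (S.r j 0, S.lam j 0) :=
        ((hΦc.differentiable (by simp)) _).hasFDerivAt.comp _ (hasFDerivAt_prodMk_right _ _)
      have h2 : HasFDerivAt (fun y : State n × ℝ => Φ ((0 : State n × State n), y))
          ((((A 0).comp (ContinuousLinearMap.fst ℝ (State n) ℝ)) -
            (S.lam j 0 • ContinuousLinearMap.fst ℝ (State n) ℝ +
              (ContinuousLinearMap.snd ℝ (State n) ℝ).smulRight (S.r j 0))).prod
            ((φ j).comp (ContinuousLinearMap.fst ℝ (State n) ℝ))) (S.r j 0, S.lam j 0) := by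
        refine HasFDerivAt.prodMk (HasFDerivAt.sub ?_ ?_) ?_
        · exact ((A 0).comp (ContinuousLinearMap.fst ℝ (State n) ℝ)).hasFDerivAt
        · exact (hasFDerivAt_snd (𝕜 := ℝ) (p := (S.r j 0, S.lam j 0))).smul
            (hasFDerivAt_fst (𝕜 := ℝ) (p := (S.r j 0, S.lam j 0)))
        · exact ((φ j).comp (ContinuousLinearMap.fst ℝ (State n) ℝ)).hasFDerivAt.sub_const 1
      have h3 := congrArg (fun L => L y) (h1.unique h2)
      simpa [hΦ'] using h3
    obtain ⟨h, h1, h2, h3, -⟩ := exists_implicitFunction (Φ := Φ) (a := 0)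
      (b := (S.r j 0, S.lam j 0)) hΦc.contDiffAt (by simp [hΦ, hAe, hφ]) hd (by
        intro y hy
        have hy1 : A 0 y.1 - (S.lam j 0 • y.1 + y.2 • S.r j 0) = 0 := congrArg Prod.fst hy
        have hy2 : φ j y.1 = 0 := congrArg Prod.snd hy
        -- Applying `φ j` to the linearized equation kills the terms in `y.1` and leaves `y.2 = 0`;
        -- the other `φ i` give `(λᵢ - λⱼ) φᵢ(y.1) = 0`, with distinct eigenvalues.
        have h4 := congrArg (φ j) hy1
        simp only [map_sub, map_add, map_smul, hAφ, hy2, hφ, map_zero, smul_eq_mul, mul_zero,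
          if_true, mul_one, zero_add, zero_sub, neg_eq_zero] at h4
        have h5 : ∀ i, φ i y.1 = 0 := fun i => by
          by_cases hij : i = j
          · rw [hij, hy2]
          have h6 := congrArg (φ i) hy1
          simp only [map_sub, map_add, map_smul, hAφ, h4, map_zero, smul_eq_mul,
            zero_mul, add_zero, ← sub_mul] at h6
          rcases mul_eq_zero.1 h6 with h7 | h7
          · exact absurd ((hS.strictMono 0 hS.zero_mem).injective (sub_eq_zero.1 h7)) hij
          · exact h7
        refine Prod.ext ?_ h4
        rw [hexp y.1]
        simp [h5])
    refine ⟨h, h1, h2, ?_⟩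
    filter_upwards [h3] with p hp
    simp only [hΦ, Prod.mk_eq_zero, sub_eq_zero] at hp
    exact hp
  choose h h1 h2 h3 using hpair
  set vec : Fin n → State n × State n → State n := fun i p => (h i p).1 with hvec
  set val : Fin n → State n × State n → ℝ := fun i p => (h i p).2 with hval
  have hvecc : ∀ i, ContDiffAt ℝ 2 (vec i) 0 := fun i => contDiffAt_fst.comp _ (h1 i)
  have hvalc : ∀ i, ContDiffAt ℝ 2 (val i) 0 := fun i => contDiffAt_snd.comp _ (h1 i)
  have hval0 : ∀ i, val i 0 = S.lam i 0 := fun i => by simp [hval, h2]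
  have hmono : ∀ᶠ p in 𝓝 (0 : State n × State n), StrictMono fun i => val i p := by
    have : ∀ᶠ p in 𝓝 (0 : State n × State n), ∀ i j, i < j → val i p < val j p := by
      refine eventually_all.2 fun i => eventually_all.2 fun j => ?_
      by_cases hij : i < j
      · have hlt : val i 0 < val j 0 := by
          rw [hval0, hval0]; exact hS.strictMono 0 hS.zero_mem hij
        filter_upwards [((hvalc i).continuousAt.eventually_lt (hvalc j).continuousAt hlt)] with p hp _
        exact hp
      · exact Eventually.of_forall fun p h => absurd h hij
    filter_upwards [this] with p hp i j hij using hp i j hij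
  have heig : ∀ᶠ p in 𝓝 (0 : State n × State n), ∀ i,
      A p (vec i p) = val i p • vec i p ∧ φ i (vec i p) = 1 :=
    eventually_all.2 fun i => h3 i
  have hind : ∀ᶠ p in 𝓝 (0 : State n × State n), LinearIndependent ℝ fun i => vec i p := by
    filter_upwards [hmono, heig] with p hp hp'
    refine Module.End.eigenvectors_linearIndependent' (A p : State n →ₗ[ℝ] State n)
      (fun j => val j p) hp.injective _
      fun j => ⟨Module.End.mem_eigenspace_iff.2 (hp' j).1, fun h0 => ?_⟩
    have := (hp' j).2
    rw [h0, map_zero] at this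
    exact zero_ne_one this
  have hcomp : ∀ᶠ p in 𝓝 (0 : State n × State n), ∀ (x : State n) (c : ℝ), x ≠ 0 →
      A p x = c • x → ∃ i, c = val i p ∧ x = φ i x • vec i p := by
    filter_upwards [hmono, heig, hind] with p hm he hi x c hx hAx
    obtain ⟨b, hbi⟩ := exists_basis_eq hi
    have hxs : x = ∑ i, b.repr x i • vec i p := by
      conv_lhs => rw [← b.sum_repr x]
      simp [hbi]
    have h4 : ∑ i, (b.repr x i * (val i p - c)) • vec i p = 0 := by
      have h5 : A p x = ∑ i, (b.repr x i * val i p) • vec i p := by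
        conv_lhs => rw [hxs]
        simp [he, mul_smul]
      have h6 : c • x = ∑ i, (b.repr x i * c) • vec i p := by
        conv_lhs => rw [hxs, Finset.smul_sum]
        exact Finset.sum_congr rfl fun i _ => by rw [smul_smul, mul_comm]
      simp only [mul_sub, sub_smul, Finset.sum_sub_distrib]
      rw [← h5, ← h6, hAx, sub_self]
    have h5 := Fintype.linearIndependent_iff.1 hi _ h4
    obtain ⟨i, hi0⟩ : ∃ i, b.repr x i ≠ 0 := by
      by_contra hcon
      push Not at hcon
      exact hx (hxs.trans (by simp [hcon]))
    have hci : c = val i p := by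
      rcases mul_eq_zero.1 (h5 i) with h | h
      · exact absurd h hi0
      · linarith
    refine ⟨i, hci, ?_⟩
    have h6 : ∀ k ≠ i, b.repr x k = 0 := fun k hk => by
      rcases mul_eq_zero.1 (h5 k) with h | h
      · exact h
      · exact absurd (hm.injective (show val k p = val i p by linarith)) hk
    have h7 : x = b.repr x i • vec i p := by
      conv_lhs => rw [hxs]
      exact Finset.sum_eq_single i (fun k _ hk => by rw [h6 k hk, zero_smul]) (by simp)
    have h8 : φ i x = b.repr x i := by
      conv_lhs => rw [h7]
      simp [(he i).2]
    rw [h8]; exact h7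
  have hdiag : Tendsto (fun u : State n => (u, u)) (𝓝 0) (𝓝 (0 : State n × State n)) :=
    (by fun_prop : Continuous fun u : State n => (u, u)).tendsto 0
  refine ⟨A, vec, val, φ, hvecc, hvalc, ?_, hφ, fun i => by simp [hvec, h2],
    fun i => (h3 i).mono fun p hp => hp.1, fun i => (h3 i).mono fun p hp => hp.2, ?_, hind, hcomp,
    hmono, ?_⟩
  · filter_upwards [hfS.eventuallyEq_nhds] with u hu
    have := (hf.differentiable (by simp) u).hasFDerivAt.congr_of_eventuallyEq hu.symm
    rwa [hA, meanJacobian_self]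
  · have hp : ∀ᶠ p in 𝓝 (0 : State n × State n), f p.1 = S.f p.1 ∧ f p.2 = S.f p.2 :=
      ((continuous_fst.tendsto (0 : State n × State n)).eventually hfS).and
        ((continuous_snd.tendsto (0 : State n × State n)).eventually hfS)
    filter_upwards [hp] with p hp
    rw [← hp.1, ← hp.2]
    exact meanJacobian_apply_sub (hf.of_le (by norm_num)) p.1 p.2
  · filter_upwards [hdiag.eventually hcomp, hdiag.eventually hmono, hAd,
      hS.isOpen.mem_nhds hS.zero_mem] with u hc hm hAu huΩ
    have hex : ∀ j, ∃ i, S.lam j u = val i (u, u) := fun j => by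
      obtain ⟨x, hx, hfx⟩ := hS.eigenvalue u huΩ j
      rw [← hAu] at hfx
      obtain ⟨i, hi, -⟩ := hc x _ hx hfx
      exact ⟨i, hi⟩
    -- Each eigenvalue of `Df u` is some `val i (u, u)`. Both families are strictly increasing in
    -- the index, so the matching `τ` is an increasing self-map of `Fin n`, the identity.
    choose τ hτ using hex
    have hτm : StrictMono τ := fun i j hij => by
      have := hS.strictMono u huΩ hij
      simp only [hτ] at this
      exact hm.lt_iff_lt.1 this
    intro j
    rw [hτ j, strictMono_fin_eq_self hτm]

end ConservationLaw

/-! ### Regularity of the eigenvectors and the Hugoniot curves -/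

namespace ConservationLaw

variable {n : ℕ} {S : ConservationLaw n} {A : State n × State n → State n →L[ℝ] State n}
  {vec : Fin n → State n × State n → State n} {val : Fin n → State n × State n → ℝ}
  {φ : Fin n → State n →L[ℝ] ℝ}

theorem tendsto_diag : Tendsto (fun u : State n => (u, u)) (𝓝 0) (𝓝 (0 : State n × State n)) :=
  (by fun_prop : Continuous fun u : State n => (u, u)).tendsto 0

theorem contDiffAt_diag {Y : Type*} [NormedAddCommGroup Y] [NormedSpace ℝ Y]
    {g : State n × State n → Y} (h : ContDiffAt ℝ 2 g 0) :
    ContDiffAt ℝ 2 (fun u => g (u, u)) 0 :=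
  ContDiffAt.comp (g := g) (f := fun u : State n => (u, u)) (0 : State n) h
    (by fun_prop : ContDiff ℝ 2 fun u : State n => (u, u)).contDiffAt

theorem IsFrame.lam_contDiffAt (hA : IsFrame S A vec val φ) (j : Fin n) :
    ContDiffAt ℝ 2 (S.lam j) 0 :=
  (contDiffAt_diag (hA.val_contDiffAt j)).congr_of_eventuallyEq (hA.lam_eq.mono fun _ hu => hu j)

theorem IsFrame.r_eq (hS : S.Admissible) (hA : IsFrame S A vec val φ) (j : Fin n) :
    ∀ᶠ u in 𝓝 (0 : State n), S.r j u = φ j (S.r j u) • vec j (u, u) := by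
  have hne : ∀ᶠ u in 𝓝 (0 : State n), S.r j u ≠ 0 :=
    (hS.eigenvector j).self_of_nhds.1.eventually_ne (hS.r_zero_ne j)
  filter_upwards [hS.eigenvector j, hne, hA.f_differentiable, tendsto_diag.eventually hA.complete,
    hA.lam_eq, tendsto_diag.eventually hA.val_strictMono] with u h1 h2 h3 h4 h5 h6
  have h7 : A (u, u) (S.r j u) = val j (u, u) • S.r j u := by
    rw [← h5, ← h1.2.1, h3.fderiv]
  obtain ⟨i, hi, hx⟩ := h4 _ _ h2 h7
  rwa [← h6.injective hi] at hx

/-- The field `r j` is only assumed continuous, but it is collinear with the smooth `vec j`, and its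
normalization determines the factor: `k j / Dλⱼ · vec j` for a genuinely nonlinear field, `1 / |vec
j|` for a linearly degenerate one, where continuity at the origin fixes the sign. -/
theorem IsFrame.contDiffAt_r (hS : S.Admissible) (hA : IsFrame S A vec val φ) (j : Fin n) :
    ContDiffAt ℝ 1 (S.r j) 0 := by
  have hv : ContDiffAt ℝ 1 (fun u : State n => vec j (u, u)) 0 :=
    (contDiffAt_diag (hA.vec_contDiffAt j)).of_le (by norm_num)
  have hv0 : vec j ((0 : State n), (0 : State n)) = S.r j 0 := hA.vec_zero j
  rcases hS.field j with hj | hj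
  · have hd : ContDiffAt ℝ 1 (fun u => fderiv ℝ (S.lam j) u (vec j (u, u))) 0 :=
      ((hA.lam_contDiffAt j).fderiv_right (m := 1) (by norm_num)).clm_apply hv
    have hd0 : fderiv ℝ (S.lam j) 0 (vec j (0, 0)) = S.k j := by
      rw [hv0]; exact (hS.eigenvector j).self_of_nhds.2.2.1 hj
    have hne : fderiv ℝ (S.lam j) 0 (vec j (0, 0)) ≠ 0 := by rw [hd0]; exact (hS.k_pos j).ne'
    have hq : ContDiffAt ℝ 1
        (fun u => (S.k j / fderiv ℝ (S.lam j) u (vec j (u, u))) • vec j (u, u)) 0 :=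
      (contDiffAt_const.div hd hne).smul hv
    refine hq.congr_of_eventuallyEq ?_
    filter_upwards [hA.r_eq hS j, hS.eigenvector j, hd.continuousAt.eventually_ne hne]
      with u h1 h2 h3
    have h4 := h2.2.2.1 hj
    rw [h1, map_smul, smul_eq_mul] at h4
    conv_lhs => rw [h1]
    rw [← h4, mul_div_cancel_right₀ _ h3]
  · have hne : vec j ((0 : State n), (0 : State n)) ≠ 0 := by rw [hv0]; exact hS.r_zero_ne j
    have hq : ContDiffAt ℝ 1 (fun u => (1 / ‖vec j (u, u)‖) • vec j (u, u)) 0 :=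
      (contDiffAt_const.div (hv.norm ℝ hne) (norm_ne_zero_iff.2 hne)).smul hv
    have hpos : ∀ᶠ u in 𝓝 (0 : State n), 0 < φ j (S.r j u) := by
      have h1 : ContinuousAt (fun u => φ j (S.r j u)) 0 :=
        (φ j).continuous.continuousAt.comp (hS.eigenvector j).self_of_nhds.1
      exact h1.eventually_const_lt (by simp [hA.dual])
    refine hq.congr_of_eventuallyEq ?_
    filter_upwards [hA.r_eq hS j, hS.eigenvector j, hpos, hv.continuousAt.eventually_ne hne]
      with u h1 h2 h3 h5
    have h4 := h2.2.2.2 hj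
    rw [h1, norm_smul, Real.norm_eq_abs, abs_of_pos h3] at h4
    conv_lhs => rw [h1]
    rw [eq_div_of_mul_eq (norm_ne_zero_iff.2 h5) h4]

/-- The curve of the states `w` which are connected to `u` by a `j`-th eigenvector of `A(u, w)`,
parametrized by `θ w = θ u + κ s`. -/
theorem IsFrame.exists_hugoniot (hA : IsFrame S A vec val φ) (j : Fin n) {θ : State n → ℝ}
    (hθ : ContDiffAt ℝ 2 θ 0) (κ : ℝ) (hθ' : fderiv ℝ θ 0 (S.r j 0) ≠ 0) :
    ∃ W : ℝ × State n → State n, ContDiffAt ℝ 2 W 0 ∧ W 0 = 0 ∧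
      (∀ᶠ q in 𝓝 (0 : ℝ × State n), W q - q.2 = φ j (W q - q.2) • vec j (q.2, W q) ∧
        θ (W q) - θ q.2 = κ * q.1) ∧
      ∀ᶠ q in 𝓝 (0 : (ℝ × State n) × State n),
        q.2 - q.1.2 = φ j (q.2 - q.1.2) • vec j (q.1.2, q.2) →
        θ q.2 - θ q.1.2 = κ * q.1.1 → q.2 = W q.1 := by
  -- The unknowns are the state `w` and the coefficient of `w - u` along `vec j (u, w)`; the
  -- normalization of `vec j` identifies this coefficient with `φ j (w - u)`. The function `θ` will
  -- be `λⱼ` for a genuinely nonlinear field and `φ j` for a linearly degenerate one.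
  set Φ : (ℝ × State n) × (State n × ℝ) → State n × ℝ := fun q =>
    (q.2.1 - q.1.2 - q.2.2 • vec j (q.1.2, q.2.1), θ q.2.1 - θ q.1.2 - κ * q.1.1) with hΦ
  have hvec : ContDiffAt ℝ 2 (fun q : (ℝ × State n) × (State n × ℝ) => vec j (q.1.2, q.2.1))
      ((0 : ℝ × State n), (0 : State n × ℝ)) :=
    ContDiffAt.comp (g := vec j)
      (f := fun q : (ℝ × State n) × (State n × ℝ) => (q.1.2, q.2.1))
      ((0 : ℝ × State n), (0 : State n × ℝ)) (hA.vec_contDiffAt j)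
      (by fun_prop : ContDiff ℝ 2
        fun q : (ℝ × State n) × (State n × ℝ) => (q.1.2, q.2.1)).contDiffAt
  have hθ1 : ContDiffAt ℝ 2 (fun q : (ℝ × State n) × (State n × ℝ) => θ q.2.1)
      ((0 : ℝ × State n), (0 : State n × ℝ)) :=
    ContDiffAt.comp (g := θ) (f := fun q : (ℝ × State n) × (State n × ℝ) => q.2.1)
      ((0 : ℝ × State n), (0 : State n × ℝ)) hθ
      (by fun_prop : ContDiff ℝ 2 fun q : (ℝ × State n) × (State n × ℝ) => q.2.1).contDiffAt
  have hθ2 : ContDiffAt ℝ 2 (fun q : (ℝ × State n) × (State n × ℝ) => θ q.1.2)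
      ((0 : ℝ × State n), (0 : State n × ℝ)) :=
    ContDiffAt.comp (g := θ) (f := fun q : (ℝ × State n) × (State n × ℝ) => q.1.2)
      ((0 : ℝ × State n), (0 : State n × ℝ)) hθ
      (by fun_prop : ContDiff ℝ 2 fun q : (ℝ × State n) × (State n × ℝ) => q.1.2).contDiffAt
  have hΦc : ContDiffAt ℝ 2 Φ ((0 : ℝ × State n), (0 : State n × ℝ)) :=
    ((by fun_prop : ContDiff ℝ 2 fun q : (ℝ × State n) × (State n × ℝ) =>
      q.2.1 - q.1.2).contDiffAt.sub
      ((by fun_prop : ContDiff ℝ 2 fun q : (ℝ × State n) × (State n × ℝ) =>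
        q.2.2).contDiffAt.smul hvec)).prodMk
      ((hθ1.sub hθ2).sub (by fun_prop : ContDiff ℝ 2 fun q : (ℝ × State n) × (State n × ℝ) =>
        κ * q.1.1).contDiffAt)
  set Φ' : State n × ℝ →L[ℝ] State n × ℝ :=
    (ContinuousLinearMap.fst ℝ (State n) ℝ -
      (ContinuousLinearMap.snd ℝ (State n) ℝ).smulRight (S.r j 0)).prod
      ((fderiv ℝ θ 0).comp (ContinuousLinearMap.fst ℝ (State n) ℝ)) with hΦ'
  have hd : ∀ y, fderiv ℝ Φ ((0 : ℝ × State n), (0 : State n × ℝ)) (0, y) = Φ' y := by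
    intro y
    have h1 : HasFDerivAt (fun y : State n × ℝ => Φ ((0 : ℝ × State n), y))
        ((fderiv ℝ Φ ((0 : ℝ × State n), (0 : State n × ℝ))).comp
          (ContinuousLinearMap.inr ℝ (ℝ × State n) (State n × ℝ))) 0 :=
      (hΦc.differentiableAt (by simp)).hasFDerivAt.comp _ (hasFDerivAt_prodMk_right _ _)
    have h2 : HasFDerivAt (fun y : State n × ℝ => Φ ((0 : ℝ × State n), y)) Φ' 0 := by
      have hv' : DifferentiableAt ℝ (fun y : State n × ℝ => vec j ((0 : State n), y.1)) 0 :=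
        ((hA.vec_contDiffAt j).differentiableAt (by simp)).comp (0 : State n × ℝ)
          (f := fun y : State n × ℝ => ((0 : State n), y.1)) (by fun_prop)
      have hsm := (hasFDerivAt_snd (𝕜 := ℝ) (p := (0 : State n × ℝ))).smul hv'.hasFDerivAt
      have hth : HasFDerivAt (fun y : State n × ℝ => θ y.1)
          ((fderiv ℝ θ 0).comp (ContinuousLinearMap.fst ℝ (State n) ℝ)) 0 :=
        HasFDerivAt.comp (0 : State n × ℝ) (g := θ) (f := Prod.fst)
          (hθ.differentiableAt (by simp)).hasFDerivAt hasFDerivAt_fst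
      have h3 := ((hasFDerivAt_fst (𝕜 := ℝ) (p := (0 : State n × ℝ))).sub_const 0).sub hsm
      have h4 := (hth.sub_const (θ 0)).sub_const (κ * 0)
      have h5 := h3.prodMk h4
      refine (h5.congr_fderiv ?_)
      have hv0 : vec j ((0 : State n), (0 : State n)) = S.r j 0 := hA.vec_zero j
      ext y <;> simp [hΦ', hv0]
    exact congrArg (fun L => L y) (h1.unique h2)
  obtain ⟨h, h1, h2, h3, h4⟩ := exists_implicitFunction (Φ := Φ) (a := 0)
    (b := 0) (Φ' := Φ'.toLinearMap) hΦc (by simp [hΦ]) hd (by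
      intro y hy
      have hy1 : y.1 - y.2 • S.r j 0 = 0 := congrArg Prod.fst hy
      have hy2 : fderiv ℝ θ 0 y.1 = 0 := congrArg Prod.snd hy
      rw [sub_eq_zero.1 hy1, map_smul, smul_eq_mul] at hy2
      have hy3 : y.2 = 0 := (mul_eq_zero.1 hy2).resolve_right hθ'
      refine Prod.ext ?_ hy3
      rw [sub_eq_zero.1 hy1, hy3, zero_smul]; rfl)
  have hcont : ContinuousAt h 0 := h1.continuousAt
  have hmem : Tendsto (fun q : ℝ × State n => (q.2, (h q).1)) (𝓝 0)
      (𝓝 (0 : State n × State n)) := by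
    have h5 : ContinuousAt (fun q : ℝ × State n => (q.2, (h q).1)) 0 :=
      continuousAt_snd.prodMk (continuousAt_fst.comp hcont)
    have h6 : ((0 : ℝ × State n).2, (h 0).1) = 0 := by rw [h2]; rfl
    rw [← h6]
    exact h5.tendsto
  refine ⟨fun q => (h q).1, contDiffAt_fst.comp _ h1, by simp [h2], ?_, ?_⟩
  · filter_upwards [h3, hmem.eventually (hA.normalized j)] with q hq hn
    simp only [hΦ, Prod.mk_eq_zero] at hq
    have h5 : (h q).1 - q.2 = (h q).2 • vec j (q.2, (h q).1) := sub_eq_zero.1 hq.1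
    have h6 : φ j ((h q).1 - q.2) = (h q).2 := by rw [h5]; simp [hn]
    exact ⟨by rw [h6]; exact h5, by linarith [hq.2]⟩
  · have hlift : Tendsto (fun q : (ℝ × State n) × State n => (q.1, (q.2, φ j (q.2 - q.1.2))))
        (𝓝 0) (𝓝 ((0 : ℝ × State n), (0 : State n × ℝ))) := by
      have : Continuous fun q : (ℝ × State n) × State n => (q.1, (q.2, φ j (q.2 - q.1.2))) := by
        fun_prop
      refine this.tendsto' _ _ ?_
      simp [← Prod.zero_eq_mk]
    filter_upwards [hlift.eventually h4] with q hq hq1 hq2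
    have h5 := hq (by
      simp only [hΦ, Prod.mk_eq_zero]
      exact ⟨by rw [← hq1, sub_self], by rw [hq2, sub_self]⟩)
    exact congrArg Prod.fst h5

end ConservationLaw

/-! ### Globally Lipschitz vector fields and their flows -/

open scoped NNReal

section flow

variable {n : ℕ}

/-- Truncation of the coordinates to `[-M, M]`. -/
noncomputable def truncate (M : ℝ) (x : State n) : State n :=
  WithLp.toLp 2 fun i => max (-M) (min M (x i))

theorem lipschitzWith_truncate (M : ℝ) : LipschitzWith 1 (truncate M : State n → State n) := by
  refine LipschitzWith.of_dist_le_mul fun x y => ?_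
  rw [NNReal.coe_one, one_mul, EuclideanSpace.dist_eq, EuclideanSpace.dist_eq]
  refine Real.sqrt_le_sqrt (Finset.sum_le_sum fun i _ => ?_)
  refine pow_le_pow_left₀ dist_nonneg ?_ 2
  simp only [truncate, Real.dist_eq]
  exact (abs_max_sub_max_le_max _ _ _ _).trans (by
    rw [sub_self, abs_zero, max_eq_right (abs_nonneg _)]
    exact (abs_min_sub_min_le_max _ _ _ _).trans (by simp))

theorem norm_truncate_le {M : ℝ} (hM : 0 ≤ M) (x : State n) : ‖truncate M x‖ ≤ √n * M := by
  rw [EuclideanSpace.norm_eq]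
  have h : ∀ i, ‖truncate M x i‖ ^ 2 ≤ M ^ 2 := fun i => by
    refine pow_le_pow_left₀ (norm_nonneg _) ?_ 2
    simp only [truncate, Real.norm_eq_abs]
    exact abs_le.2 ⟨le_max_left _ _, max_le (by linarith) (min_le_left _ _)⟩
  calc √(∑ i, ‖truncate M x i‖ ^ 2) ≤ √(∑ _i : Fin n, M ^ 2) :=
        Real.sqrt_le_sqrt (Finset.sum_le_sum fun i _ => h i)
    _ = √n * M := by
        rw [Finset.sum_const, Finset.card_univ, Fintype.card_fin, nsmul_eq_mul,
          Real.sqrt_mul (Nat.cast_nonneg n), Real.sqrt_sq hM]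

theorem truncate_eq {M : ℝ} {x : State n} (h : ‖x‖ ≤ M) : truncate M x = x := by
  ext i
  have h1 : |x i| ≤ M := by
    rw [← Real.norm_eq_abs]; exact (PiLp.norm_apply_le x i).trans h
  have h2 := abs_le.1 h1
  simp only [truncate]
  rw [min_eq_right h2.2, max_eq_right h2.1]

/-- A `C¹` function coincides locally with a bounded globally Lipschitz one. -/
theorem exists_lipschitz_extension {X : Type*} [NormedAddCommGroup X] [NormedSpace ℝ X]
    {f : X → State n} {x : X} (hf : ContDiffAt ℝ 1 f x) :
    ∃ (g : X → State n) (L : ℝ≥0) (M : ℝ), LipschitzWith L g ∧ (∀ y, ‖g y‖ ≤ M) ∧ g =ᶠ[𝓝 x] f := by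
  obtain ⟨K, t, ht, hK⟩ := hf.exists_lipschitzOnWith
  obtain ⟨g, hg, hgf⟩ := hK.extend_finite_dimension
  have hb : ∀ᶠ y in 𝓝 x, ‖f y‖ < ‖f x‖ + 1 :=
    hf.continuousAt.norm.eventually_lt continuousAt_const (by simp)
  refine ⟨fun y => truncate (‖f x‖ + 1) (g y), _, √n * (‖f x‖ + 1),
    (lipschitzWith_truncate _).comp hg, fun y => norm_truncate_le (by positivity) _, ?_⟩
  filter_upwards [ht, hb] with y hy hy'
  simp only [← hgf hy]
  exact truncate_eq hy'.le

variable {V : State n → State n} {K : ℝ≥0} {M : ℝ}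

/-- The substitution `t ↦ σ * t` on `[0, 1]` reduces both signs of `σ` to Grönwall's inequality
forward in time. -/
theorem dist_le_of_integralCurves (hV : LipschitzWith K V) {γ₁ γ₂ : ℝ → State n} {σ : ℝ}
    (h₁ : ∀ s ∈ uIcc 0 σ, HasDerivWithinAt γ₁ (V (γ₁ s)) (uIcc 0 σ) s)
    (h₂ : ∀ s ∈ uIcc 0 σ, HasDerivWithinAt γ₂ (V (γ₂ s)) (uIcc 0 σ) s) :
    dist (γ₁ σ) (γ₂ σ) ≤ dist (γ₁ 0) (γ₂ 0) * Real.exp (‖σ‖₊ * K) := by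
  have hmaps : MapsTo (fun t : ℝ => σ * t) (Icc 0 1) (uIcc 0 σ) := fun t ht => by
    rw [mem_uIcc]
    rcases le_total 0 σ with h | h
    · exact Or.inl ⟨mul_nonneg h ht.1, mul_le_of_le_one_right h ht.2⟩
    · right
      constructor
      · nlinarith [ht.2]
      · exact mul_nonpos_of_nonpos_of_nonneg h ht.1
  have key : ∀ γ : ℝ → State n, (∀ s ∈ uIcc 0 σ, HasDerivWithinAt γ (V (γ s)) (uIcc 0 σ) s) →
      ∀ t ∈ Icc (0 : ℝ) 1, HasDerivWithinAt (fun t => γ (σ * t)) (σ • V (γ (σ * t))) (Icc 0 1) t :=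
    fun γ h t ht => by
      have h3 : HasDerivWithinAt (fun t : ℝ => σ * t) σ (Icc 0 1) t := by
        simpa using ((hasDerivWithinAt_id t (Icc 0 1)).const_mul σ)
      exact (h (σ * t) (hmaps ht)).scomp t h3 hmaps
  have hv : ∀ _t : ℝ, LipschitzWith (‖σ‖₊ * K) fun x => σ • V x := fun _ =>
    (lipschitzWith_smul σ).comp hV
  have := dist_le_of_trajectories_ODE (a := 0) (b := 1) (δ := dist (γ₁ 0) (γ₂ 0))
    (f := fun t => γ₁ (σ * t)) (g := fun t => γ₂ (σ * t)) hv
    (fun t ht => (key γ₁ h₁ t ht).continuousWithinAt)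
    (fun t ht => (key γ₁ h₁ t (Ico_subset_Icc_self ht)).mono_of_mem_nhdsWithin
      (Icc_mem_nhdsGE_of_mem ht))
    (fun t ht => (key γ₂ h₂ t ht).continuousWithinAt)
    (fun t ht => (key γ₂ h₂ t (Ico_subset_Icc_self ht)).mono_of_mem_nhdsWithin
      (Icc_mem_nhdsGE_of_mem ht)) (by simp) 1 (by simp)
  simpa using this

theorem exists_flow (hV : LipschitzWith K V) (hM : ∀ x, ‖V x‖ ≤ M) :
    ∃ X : ℝ → State n → State n, (∀ u, X 0 u = u) ∧
      (∀ u, ∀ t ∈ Icc (-1 : ℝ) 1, HasDerivWithinAt (fun t => X t u) (V (X t u)) (Icc (-1) 1) t) ∧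
      ∀ u w, ∀ t ∈ Icc (-1 : ℝ) 1, ‖X t u - X t w‖ ≤ Real.exp K * ‖u - w‖ := by
  have hM0 : 0 ≤ M := (norm_nonneg _).trans (hM 0)
  have hex : ∀ u, ∃ α : ℝ → State n, α 0 = u ∧
      ∀ t ∈ Icc (-1 : ℝ) 1, HasDerivWithinAt α (V (α t)) (Icc (-1) 1) t := fun u => by
    have hP : IsPicardLindelof (fun _ => V) (tmin := -1) (tmax := 1) ⟨0, by simp⟩ u ⟨M, hM0⟩ 0
        ⟨M, hM0⟩ K :=
      { lipschitzOnWith := fun t _ => hV.lipschitzOnWith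
        continuousOn := fun x _ => continuousOn_const
        norm_le := fun t _ x _ => hM x
        mul_max_le := by simp }
    exact hP.exists_eq_forall_mem_Icc_hasDerivWithinAt₀
  choose X h0 hX using hex
  refine ⟨fun t u => X u t, h0, hX, fun u w t ht => ?_⟩
  have hsub : uIcc 0 t ⊆ Icc (-1) 1 := uIcc_subset_Icc (by simp) ht
  have := dist_le_of_integralCurves hV
    (fun s hs => (hX u s (hsub hs)).mono hsub) (fun s hs => (hX w s (hsub hs)).mono hsub)
  rw [h0, h0, dist_eq_norm, dist_eq_norm] at this
  refine this.trans ?_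
  rw [mul_comm]
  refine mul_le_mul_of_nonneg_right (Real.exp_le_exp.2 ?_) (norm_nonneg _)
  have : (‖t‖₊ : ℝ) ≤ 1 := by
    rw [coe_nnnorm, Real.norm_eq_abs]; exact abs_le.2 ht
  exact mul_le_of_le_one_left K.2 this

/-- The displacement along the velocities `G`. -/
noncomputable def flowMap (G : ℝ × State n → State n) (s : ℝ) (u : State n) : State n :=
  u + ∫ τ in (0 : ℝ)..s, G (τ, u)

/-- The velocity `G (s, u)` depends on the time and the initial state, not on the current one. Two
curves with this velocity differ by a constant, and no uniqueness theorem for differential equations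
is needed. -/
theorem flowMap_eq_of_hasDerivWithinAt {G : ℝ × State n → State n} (hG : Continuous G)
    {γ : ℝ → State n} {u : State n} {σ : ℝ} (h0 : γ 0 = u)
    (h : ∀ s ∈ uIcc 0 σ, HasDerivWithinAt γ (G (s, u)) (uIcc 0 σ) s) : flowMap G σ u = γ σ := by
  have hc : Continuous fun τ => G (τ, u) := hG.comp (by fun_prop)
  have h1 : ∀ s ∈ uIcc 0 σ, HasDerivWithinAt (fun s => flowMap G s u) (G (s, u)) (uIcc 0 σ) s :=
    fun s _ => ((intervalIntegral.integral_hasDerivAt_right (hc.intervalIntegrable _ _)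
      (hc.stronglyMeasurableAtFilter _ _) hc.continuousAt).const_add u).hasDerivWithinAt
  have h2 : ∀ s ∈ uIcc 0 σ, HasDerivWithinAt (fun s => flowMap G s u - γ s) 0 (uIcc 0 σ) s :=
    fun s hs => by
      have := (h1 s hs).sub (h s hs)
      rw [sub_self] at this
      exact this
  have h3 := (convex_uIcc (0 : ℝ) σ).norm_image_sub_le_of_norm_hasDerivWithin_le (C := 0)
    (fun s hs => h2 s hs) (fun s _ => by simp) left_mem_uIcc right_mem_uIcc
  simp only [zero_mul, norm_le_zero_iff] at h3
  have h4 : flowMap G 0 u - γ 0 = 0 := by simp [flowMap, h0]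
  rw [h4, sub_zero] at h3
  exact sub_eq_zero.1 h3

end flow

section flow

variable {n : ℕ} {V : State n → State n} {X : ℝ → State n → State n} {K : ℝ≥0} {M : ℝ}

/-- `X` is the flow, for times in `[-1, 1]`, of the bounded Lipschitz vector field `V`. -/
structure IsFlow (V : State n → State n) (X : ℝ → State n → State n) (K : ℝ≥0) (M : ℝ) : Prop where
  lipschitz : LipschitzWith K V
  norm_le : ∀ x, ‖V x‖ ≤ M
  zero : ∀ u, X 0 u = u
  deriv : ∀ u, ∀ t ∈ Icc (-1 : ℝ) 1,
    HasDerivWithinAt (fun t => X t u) (V (X t u)) (Icc (-1) 1) t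
  dist_le : ∀ u w, ∀ t ∈ Icc (-1 : ℝ) 1, ‖X t u - X t w‖ ≤ Real.exp K * ‖u - w‖

theorem uIcc_zero_subset_Icc {t : ℝ} (ht : |t| ≤ 1) : uIcc 0 t ⊆ Icc (-1) 1 :=
  uIcc_subset_Icc (by simp) (abs_le.1 ht)

theorem abs_le_of_mem_uIcc {s t : ℝ} (h : s ∈ uIcc 0 t) : |s| ≤ |t| := by
  have := abs_sub_left_of_mem_uIcc h
  simpa using this

variable (hX : IsFlow V X K M)
include hX

theorem IsFlow.deriv' (u : State n) {t : ℝ} (ht : |t| ≤ 1) :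
    ∀ s ∈ uIcc 0 t, HasDerivWithinAt (fun t => X t u) (V (X s u)) (uIcc 0 t) s :=
  fun s hs => (hX.deriv u s (uIcc_zero_subset_Icc ht hs)).mono (uIcc_zero_subset_Icc ht)

theorem IsFlow.norm_sub_le (u : State n) {s t : ℝ} (hs : s ∈ Icc (-1 : ℝ) 1)
    (ht : t ∈ Icc (-1 : ℝ) 1) : ‖X t u - X s u‖ ≤ M * |t - s| :=
  (convex_Icc (-1 : ℝ) 1).norm_image_sub_le_of_norm_hasDerivWithin_le
    (fun s hs => hX.deriv u s hs) (fun _ _ => hX.norm_le _) hs ht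

theorem IsFlow.norm_le' (u : State n) {t : ℝ} (ht : |t| ≤ 1) : ‖X t u‖ ≤ ‖u‖ + M * |t| := by
  have h := hX.norm_sub_le u (s := 0) (by simp) (abs_le.1 ht)
  rw [hX.zero, sub_zero] at h
  have := norm_sub_norm_le (X t u) u
  linarith

theorem IsFlow.eq_of_integralCurve {γ : ℝ → State n} {σ : ℝ} (hσ : |σ| ≤ 1)
    (h : ∀ s ∈ uIcc 0 σ, HasDerivWithinAt γ (V (γ s)) (uIcc 0 σ) s) : γ σ = X σ (γ 0) := by
  have := dist_le_of_integralCurves hX.lipschitz h (hX.deriv' (γ 0) hσ)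
  rw [hX.zero, dist_self, zero_mul] at this
  exact dist_le_zero.1 this

theorem IsFlow.add (u : State n) {s t : ℝ} (hs : |s| ≤ 1) (ht : |t| ≤ 1) (hst : |s + t| ≤ 1) :
    X s (X t u) = X (s + t) u := by
  have hmaps : MapsTo (fun τ => τ + t) (uIcc 0 s) (Icc (-1) 1) := fun τ hτ => by
    have h1 := abs_le.1 hs
    have h2 := abs_le.1 ht
    have h3 := abs_le.1 hst
    rcases mem_uIcc.1 hτ with h | h <;> constructor <;> simp only <;> linarith [h.1, h.2]
  have h : ∀ τ ∈ uIcc 0 s, HasDerivWithinAt (fun τ => X (τ + t) u) (V (X (τ + t) u)) (uIcc 0 s) τ :=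
    fun τ hτ => by
      have h1 := (hX.deriv u (τ + t) (hmaps hτ)).scomp τ
        ((hasDerivWithinAt_id τ (uIcc 0 s)).add_const t) hmaps
      rw [one_smul] at h1
      exact h1
  have := hX.eq_of_integralCurve (γ := fun τ => X (τ + t) u) hs h
  simp only [zero_add] at this
  exact this.symm

/-- The velocities along the flow. -/
noncomputable def flowVelocity (V : State n → State n) (X : ℝ → State n → State n)
    (q : ℝ × State n) : State n :=
  V (X (max (-1) (min 1 q.1)) q.2)

omit hX in
theorem clamp_mem (t : ℝ) : max (-1) (min 1 t) ∈ Icc (-1 : ℝ) 1 :=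
  ⟨le_max_left _ _, max_le (by norm_num) (min_le_left _ _)⟩

omit hX in
theorem clamp_eq {t : ℝ} (ht : |t| ≤ 1) : max (-1) (min 1 t) = t := by
  have := abs_le.1 ht
  rw [min_eq_right this.2, max_eq_right this.1]

omit hX in
theorem abs_clamp_sub_le (s t : ℝ) : |max (-1) (min 1 s) - max (-1) (min 1 t)| ≤ |s - t| := by
  refine (abs_max_sub_max_le_max _ _ _ _).trans ?_
  rw [sub_self, abs_zero, max_eq_right (abs_nonneg _)]
  exact (abs_min_sub_min_le_max _ _ _ _).trans (by simp)

/-- The clamping of the time to `[-1, 1]` makes the velocity globally Lipschitz: the flow is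
`M`-Lipschitz in time and `exp K`-Lipschitz in the state there. -/
theorem IsFlow.exists_lipschitz_flowVelocity : ∃ L, LipschitzWith L (flowVelocity V X) := by
  have hM : 0 ≤ M := (norm_nonneg _).trans (hX.norm_le 0)
  refine ⟨K * (M.toNNReal + (Real.exp K).toNNReal), LipschitzWith.of_dist_le_mul
    fun p q => ?_⟩
  refine (hX.lipschitz.dist_le_mul _ _).trans ?_
  rw [NNReal.coe_mul, mul_assoc]
  refine mul_le_mul_of_nonneg_left ?_ K.2
  rw [NNReal.coe_add, Real.coe_toNNReal _ hM, Real.coe_toNNReal _ (Real.exp_pos _).le, add_mul]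
  refine (dist_triangle _ (X (max (-1) (min 1 q.1)) p.2) _).trans (add_le_add ?_ ?_)
  · rw [dist_eq_norm]
    refine (hX.norm_sub_le _ (clamp_mem _) (clamp_mem _)).trans
      (mul_le_mul_of_nonneg_left ((abs_clamp_sub_le _ _).trans ?_) hM)
    rw [Prod.dist_eq, ← Real.dist_eq]
    exact le_max_left _ _
  · rw [dist_eq_norm]
    refine (hX.dist_le _ _ _ (clamp_mem _)).trans
      (mul_le_mul_of_nonneg_left ?_ (Real.exp_pos _).le)
    rw [Prod.dist_eq, ← dist_eq_norm]
    exact le_max_right _ _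

theorem IsFlow.flowVelocity_zero (u : State n) : flowVelocity V X (0, u) = V u := by
  simp only [flowVelocity]
  rw [clamp_eq (by simp), hX.zero]

theorem IsFlow.norm_flowVelocity_le (q : ℝ × State n) : ‖flowVelocity V X q‖ ≤ M := hX.norm_le _

theorem IsFlow.eventually_mem (ρ : ℝ) (hρ : 0 < ρ) : ∀ᶠ q in 𝓝 (0 : ℝ × State n),
    |q.1| ≤ 1 ∧ ∀ s ∈ uIcc 0 q.1, X s q.2 ∈ Metric.ball (0 : State n) ρ := by
  have h1 : ∀ᶠ q in 𝓝 (0 : ℝ × State n), |q.1| < 1 :=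
    ContinuousAt.eventually_lt (by fun_prop) continuousAt_const (by simp)
  have h2 : ∀ᶠ q in 𝓝 (0 : ℝ × State n), ‖q.2‖ + M * |q.1| < ρ :=
    ContinuousAt.eventually_lt (by fun_prop) continuousAt_const (by simpa using hρ)
  filter_upwards [h1, h2] with q hq1 hq2
  refine ⟨hq1.le, fun s hs => ?_⟩
  have h3 := abs_le_of_mem_uIcc hs
  have h4 := hX.norm_le' q.2 (h3.trans hq1.le)
  have hM : 0 ≤ M := (norm_nonneg _).trans (hX.norm_le 0)
  have h5 := mul_le_mul_of_nonneg_left h3 hM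
  simpa using by linarith

end flow

/-- A property that is relatively open and relatively closed in a connected set holds everywhere. -/
theorem forall_mem_of_isPreconnected {I : Set ℝ} (hI : IsPreconnected I) {P : ℝ → Prop} {x₀ : ℝ}
    (hx₀ : x₀ ∈ I) (h0 : P x₀) (ho : ∀ x ∈ I, P x → ∀ᶠ y in 𝓝[I] x, P y)
    (hc : ∀ x ∈ I, (∃ᶠ y in 𝓝[I] x, P y) → P x) : ∀ x ∈ I, P x := by
  have : PreconnectedSpace I := isPreconnected_iff_preconnectedSpace.1 hI
  have hcl : IsClopen {x : I | P x} := by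
    constructor
    · rw [isClosed_iff_frequently]
      intro x hx
      refine hc x x.2 ?_
      rw [nhdsWithin_eq_map_subtype_coe x.2]
      exact hx
    · rw [isOpen_iff_eventually]
      intro x hx
      have := ho x x.2 hx
      rw [nhdsWithin_eq_map_subtype_coe x.2] at this
      exact this
  have := hcl.eq_univ ⟨⟨x₀, hx₀⟩, h0⟩
  intro x hx
  have h1 : (⟨x, hx⟩ : I) ∈ {x : I | P x} := by rw [this]; trivial
  exact h1

/-! ### Hugoniot curves: separation of the families and local uniqueness. -/

namespace ConservationLaw

variable {n : ℕ} {S : ConservationLaw n} {A : State n × State n → State n →L[ℝ] State n}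
  {vec : Fin n → State n × State n → State n} {val : Fin n → State n × State n → ℝ}
  {φ : Fin n → State n →L[ℝ] ℝ} {V : State n → State n} {X : ℝ → State n → State n} {K : ℝ≥0}
  {M : ℝ} {j : Fin n}

/-- `w` is connected to `u` by a `j`-th eigenvector of the averaged Jacobian matrix. -/
def IsHugoniot (vec : Fin n → State n × State n → State n) (φ : Fin n → State n →L[ℝ] ℝ)
    (j : Fin n) (u w : State n) : Prop :=
  w - u = φ j (w - u) • vec j (u, w)

theorem IsHugoniot.self (u : State n) : IsHugoniot vec φ j u u := by simp [IsHugoniot]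

/-- The states at which the eigenvectors of the averaged matrix are under control. -/
structure IsRegular (S : ConservationLaw n) (vec : Fin n → State n × State n → State n)
    (φ : Fin n → State n →L[ℝ] ℝ) (p : State n × State n) : Prop where
  continuousAt : ∀ i, ContinuousAt (vec i) p
  independent : LinearIndependent ℝ fun i => vec i p
  complete : ∀ c : ℝ, S.f p.2 - S.f p.1 = c • (p.2 - p.1) →
    p.2 = p.1 ∨ ∃ i, IsHugoniot vec φ i p.1 p.2

theorem IsFrame.eventually_isRegular (hA : IsFrame S A vec val φ) :
    ∀ᶠ p in 𝓝 (0 : State n × State n), IsRegular S vec φ p := by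
  have h1 : ∀ᶠ p in 𝓝 (0 : State n × State n), ∀ i, ContinuousAt (vec i) p :=
    eventually_all.2 fun i => ((hA.vec_contDiffAt i).eventually (by simp)).mono
      fun p hp => hp.continuousAt
  filter_upwards [h1, hA.independent, hA.mean, hA.complete] with p h1 h2 h3 h4
  refine ⟨h1, h2, fun c hc => ?_⟩
  by_cases h : p.2 = p.1
  · exact Or.inl h
  · obtain ⟨i, -, hi⟩ := h4 (p.2 - p.1) c (sub_ne_zero.2 h) (h3.trans hc)
    exact Or.inr ⟨i, hi⟩

theorem IsRegular.eq_zero_of_eq {p : State n × State n} (hp : IsRegular S vec φ p) {i k : Fin n}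
    (hik : i ≠ k) {x : State n} {a b : ℝ} (h1 : x = a • vec i p) (h2 : x = b • vec k p) : x = 0 := by
  have h3 := Fintype.linearIndependent_iff.1 hp.independent (Pi.single i a - Pi.single k b) (by
    simp only [Pi.sub_apply, sub_smul, Finset.sum_sub_distrib]
    rw [Fintype.sum_eq_single i (fun l hl => by rw [Pi.single_eq_of_ne hl, zero_smul]),
      Fintype.sum_eq_single k (fun l hl => by rw [Pi.single_eq_of_ne hl, zero_smul]),
      Pi.single_eq_same, Pi.single_eq_same, ← h1, ← h2, sub_self]) i
  rw [Pi.sub_apply, Pi.single_eq_same, Pi.single_eq_of_ne hik, sub_zero] at h3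
  rw [h1, h3, zero_smul]

/-- Near a state of the `j`-th Hugoniot curve, the solutions of the Rankine-Hugoniot equations belong
to that curve. -/
theorem eventually_isHugoniot {u w₀ q₀ : State n} {ℱ : Filter ℝ} {γ : ℝ → State n} {c : ℝ → ℝ}
    (hγ : Tendsto γ ℱ (𝓝 w₀)) (h₀ : IsRegular S vec φ (u, w₀))
    (hreg : ∀ᶠ s in ℱ, IsRegular S vec φ (u, γ s))
    (hRH : ∀ᶠ s in ℱ, ∃ c : ℝ, S.f (γ s) - S.f u = c • (γ s - u))
    (hq : Tendsto (fun s => c s • (γ s - u)) ℱ (𝓝 q₀)) (hq0 : q₀ ≠ 0)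
    (hqj : q₀ = φ j q₀ • vec j (u, w₀)) :
    ∀ᶠ s in ℱ, IsHugoniot vec φ j u (γ s) := by
  -- The rescaled differences converge to a nonzero multiple of `vec j`, which is no multiple of
  -- `vec i`. The factor `c s` allows the limit state to be `u` itself, where the differences tend
  -- to zero but the difference quotients do not.
  have hne : ∀ᶠ s in ℱ, ∀ i, i ≠ j → ¬ IsHugoniot vec φ i u (γ s) := by
    refine eventually_all.2 fun i => ?_
    by_cases hij : i = j
    · exact Eventually.of_forall fun s h => absurd hij h
    have h1 : Tendsto (fun s => vec i (u, γ s)) ℱ (𝓝 (vec i (u, w₀))) :=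
      (h₀.continuousAt i).tendsto.comp (tendsto_const_nhds.prodMk_nhds hγ)
    have h2 : Tendsto (fun s => c s • (γ s - u) - φ i (c s • (γ s - u)) • vec i (u, γ s)) ℱ
        (𝓝 (q₀ - φ i q₀ • vec i (u, w₀))) :=
      hq.sub ((((φ i).continuous.tendsto _).comp hq).smul h1)
    have h3 : q₀ - φ i q₀ • vec i (u, w₀) ≠ 0 := fun h =>
      hq0 (h₀.eq_zero_of_eq hij (sub_eq_zero.1 h) hqj)
    filter_upwards [h2.eventually_ne h3] with s hs _ hi
    refine hs ?_
    rw [map_smul, smul_eq_mul, mul_smul, ← hi, sub_self]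
  filter_upwards [hne, hreg, hRH] with s h1 h2 ⟨c, hc⟩
  rcases h2.complete c hc with h | ⟨i, hi⟩
  · simp only at h
    rw [h]
    exact IsHugoniot.self u
  · by_cases hij : i = j
    · rw [← hij]; exact hi
    · exact absurd hi (h1 i hij)

/-- A curve whose velocity has a component close to `1` leaves a small ball in a short time. -/
theorem abs_le_of_deriv_near_one {ψ : State n →L[ℝ] ℝ} {γ γ' : ℝ → State n} {σ R : ℝ}
    (hd : ∀ s ∈ uIcc 0 σ, HasDerivWithinAt γ (γ' s) (uIcc 0 σ) s)
    (h1 : ∀ s ∈ uIcc 0 σ, |ψ (γ' s) - 1| ≤ 1 / 2)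
    (hR : ∀ s ∈ uIcc 0 σ, γ s ∈ Metric.ball (0 : State n) R) : |σ| ≤ 4 * ‖ψ‖ * R := by
  have h2 : ∀ s ∈ uIcc 0 σ, HasDerivWithinAt (fun s => ψ (γ s) - s) (ψ (γ' s) - 1) (uIcc 0 σ) s :=
    fun s hs => (ψ.hasFDerivAt.comp_hasDerivWithinAt s (hd s hs)).sub (hasDerivWithinAt_id _ _)
  have h3 := (convex_uIcc (0 : ℝ) σ).norm_image_sub_le_of_norm_hasDerivWithin_le (C := 1 / 2)
    (fun s hs => h2 s hs) (fun s hs => h1 s hs) left_mem_uIcc right_mem_uIcc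
  simp only [Real.norm_eq_abs, sub_zero] at h3
  have h4 : ∀ s ∈ uIcc 0 σ, |ψ (γ s)| ≤ ‖ψ‖ * R := fun s hs => by
    refine (ψ.le_opNorm _).trans (mul_le_mul_of_nonneg_left ?_ (norm_nonneg _))
    exact (mem_ball_zero_iff.1 (hR s hs)).le
  have h5 := h4 0 left_mem_uIcc
  have h6 := h4 σ right_mem_uIcc
  have h7 : |σ| ≤ |ψ (γ σ) - σ - ψ (γ 0)| + |ψ (γ σ)| + |ψ (γ 0)| := by
    have := abs_sub_abs_le_abs_sub σ (ψ (γ σ) - ψ (γ 0))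
    have h8 := abs_sub (ψ (γ σ)) (ψ (γ 0))
    have h9 : |σ - (ψ (γ σ) - ψ (γ 0))| = |ψ (γ σ) - σ - ψ (γ 0)| := by
      rw [← abs_neg]; congr 1; ring
    linarith
  linarith

/-- The vector field `V` extends the `j`-th eigenvector field, and `X` is its flow. -/
structure IsFieldFlow (S : ConservationLaw n) (j : Fin n) (V : State n → State n)
    (X : ℝ → State n → State n) (K : ℝ≥0) (M : ℝ) : Prop extends IsFlow V X K M where
  eq_r : V =ᶠ[𝓝 0] S.r j

theorem IsFrame.exists_isFieldFlow (hS : S.Admissible) (hA : IsFrame S A vec val φ) (j : Fin n) :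
    ∃ V X K M, IsFieldFlow S j V X K M := by
  obtain ⟨V, K, M, hV, hM, hVr⟩ := exists_lipschitz_extension (hA.contDiffAt_r hS j)
  obtain ⟨X, h0, hd, hl⟩ := exists_flow hV hM
  exact ⟨V, X, K, M, ⟨hV, hM, h0, hd, hl⟩, hVr⟩

theorem IsFieldFlow.eventually_near_one (hA : IsFrame S A vec val φ)
    (hX : IsFieldFlow S j V X K M) : ∀ᶠ u in 𝓝 (0 : State n), |φ j (V u) - 1| ≤ 1 / 2 := by
  have h1 : ContinuousAt (fun u => |φ j (V u) - 1|) 0 :=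
    (((φ j).continuous.comp hX.lipschitz.continuous).sub continuous_const).abs.continuousAt
  have h2 : |φ j (V 0) - 1| < 1 / 2 := by
    rw [hX.eq_r.self_of_nhds, hA.dual]; norm_num
  exact (h1.eventually_lt continuousAt_const h2).mono fun u hu => hu.le

theorem exists_ball_of_eventually {Y : Type*} [NormedAddCommGroup Y] {P : Y → Prop}
    (h : ∀ᶠ u in 𝓝 (0 : Y), P u) : ∃ R > 0, ∀ u ∈ Metric.ball (0 : Y) R, P u :=
  Metric.eventually_nhds_iff_ball.1 h

/-- A curve with velocity `r j` moves steadily in the direction measured by `φ j`, so it cannot stay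
long in a small ball; for short times it is a trajectory of the Lipschitz extension, and the flow is
unique. -/
theorem IsFieldFlow.integralCurve_unique (hA : IsFrame S A vec val φ)
    (hX : IsFieldFlow S j V X K M) {s₀ : ℝ} (hs₀ : 0 < s₀) :
    ∃ R > 0, ∀ (γ : ℝ → State n) (σ : ℝ), (∀ s ∈ uIcc 0 σ, γ s ∈ Metric.ball (0 : State n) R ∧
      HasDerivWithinAt γ (S.r j (γ s)) (uIcc 0 σ) s) → |σ| ≤ min s₀ 1 ∧ γ σ = X σ (γ 0) := by
  obtain ⟨R, hR, h⟩ := exists_ball_of_eventually ((hX.eventually_near_one hA).and hX.eq_r)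
  have hm : 0 < min s₀ 1 := lt_min hs₀ one_pos
  have hpos : 0 < 4 * ‖φ j‖ + 1 := by positivity
  refine ⟨min R (min s₀ 1 / (4 * ‖φ j‖ + 1)), by positivity, fun γ σ hγ => ?_⟩
  have hR1 : ∀ s ∈ uIcc 0 σ, γ s ∈ Metric.ball (0 : State n) R := fun s hs =>
    Metric.ball_subset_ball (min_le_left _ _) (hγ s hs).1
  have hd : ∀ s ∈ uIcc 0 σ, HasDerivWithinAt γ (V (γ s)) (uIcc 0 σ) s := fun s hs => by
    rw [(h _ (hR1 s hs)).2]; exact (hγ s hs).2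
  have hσ : |σ| ≤ min s₀ 1 := by
    refine (abs_le_of_deriv_near_one hd (fun s hs => (h _ (hR1 s hs)).1)
      (fun s hs => (hγ s hs).1)).trans ?_
    calc 4 * ‖φ j‖ * min R (min s₀ 1 / (4 * ‖φ j‖ + 1))
        ≤ (4 * ‖φ j‖ + 1) * (min s₀ 1 / (4 * ‖φ j‖ + 1)) :=
          mul_le_mul (by linarith) (min_le_right _ _) (by positivity) hpos.le
      _ = min s₀ 1 := mul_div_cancel₀ _ hpos.ne'
  exact ⟨hσ, hX.eq_of_integralCurve (hσ.trans (min_le_right _ _)) hd⟩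

theorem IsFieldFlow.exists_integralCurve (hX : IsFieldFlow S j V X K M) {ρ : ℝ} (hρ : 0 < ρ) :
    ∀ᶠ q in 𝓝 (0 : ℝ × State n), |q.1| ≤ 1 ∧ ∀ s ∈ uIcc 0 q.1,
      X s q.2 ∈ Metric.ball (0 : State n) ρ ∧ V (X s q.2) = S.r j (X s q.2) ∧
      HasDerivWithinAt (fun s => X s q.2) (S.r j (X s q.2)) (uIcc 0 q.1) s := by
  obtain ⟨R, hR, h⟩ := exists_ball_of_eventually hX.eq_r
  filter_upwards [hX.eventually_mem ρ hρ, hX.eventually_mem R hR] with q h1 h2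
  refine ⟨h1.1, fun s hs => ⟨h1.2 s hs, h _ (h2.2 s hs), ?_⟩⟩
  rw [← h _ (h2.2 s hs)]
  exact hX.deriv' q.2 h1.1 s hs

end ConservationLaw

theorem eventually_forall_uIcc {n : ℕ} {P : ℝ × State n → Prop}
    (h : ∀ᶠ q in 𝓝 (0 : ℝ × State n), P q) :
    ∀ᶠ q in 𝓝 (0 : ℝ × State n), ∀ s ∈ uIcc 0 q.1, P (s, q.2) := by
  obtain ⟨R, hR, hP⟩ := Metric.eventually_nhds_iff_ball.1 h
  filter_upwards [Metric.ball_mem_nhds _ hR] with q hq s hs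
  refine hP _ ?_
  rw [mem_ball_zero_iff, Prod.norm_def] at hq ⊢
  exact (max_le_max_right _ (abs_le_of_mem_uIcc hs)).trans_lt hq

namespace ConservationLaw

variable {n : ℕ} {S : ConservationLaw n} {A : State n × State n → State n →L[ℝ] State n}
  {vec : Fin n → State n × State n → State n} {val : Fin n → State n × State n → ℝ}
  {φ : Fin n → State n →L[ℝ] ℝ} {V : State n → State n} {X : ℝ → State n → State n} {K : ℝ≥0}
  {M : ℝ} {j : Fin n}

theorem Admissible.not_linearlyDegenerate (hS : S.Admissible) (h : S.GenuinelyNonlinear j) :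
    ¬ S.LinearlyDegenerate j := fun h' =>
  h 0 hS.zero_mem _ (hS.r_zero_ne j) (hS.eigen_zero j) (h' 0 hS.zero_mem _ (hS.eigen_zero j))

/-- Collinearity with `vec j` is a closed condition and passes to limits. This is the counterpart,
for closedness, of the openness in `eventually_isHugoniot`. -/
theorem eq_smul_of_frequently_isHugoniot {u w₀ q₀ : State n} {ℱ : Filter ℝ} {γ : ℝ → State n}
    {c : ℝ → ℝ} (hγ : Tendsto γ ℱ (𝓝 w₀)) (h₀ : ContinuousAt (vec j) (u, w₀))
    (hq : Tendsto (fun s => c s • (γ s - u)) ℱ (𝓝 q₀))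
    (h : ∃ᶠ s in ℱ, IsHugoniot vec φ j u (γ s)) : q₀ = φ j q₀ • vec j (u, w₀) := by
  by_contra hne
  have h1 : Tendsto (fun s => vec j (u, γ s)) ℱ (𝓝 (vec j (u, w₀))) :=
    h₀.tendsto.comp (tendsto_const_nhds.prodMk_nhds hγ)
  have h2 : Tendsto (fun s => c s • (γ s - u) - φ j (c s • (γ s - u)) • vec j (u, γ s)) ℱ
      (𝓝 (q₀ - φ j q₀ • vec j (u, w₀))) :=
    hq.sub ((((φ j).continuous.tendsto _).comp hq).smul h1)
  obtain ⟨s, hs, hs'⟩ := (h.and_eventually (h2.eventually_ne (sub_ne_zero.2 hne))).exists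
  refine hs' ?_
  rw [map_smul, smul_eq_mul, mul_smul, ← hs, sub_self]

theorem IsHugoniot.of_frequently {u : State n} {I : Set ℝ} {γ : ℝ → State n} {x : ℝ}
    (hγ : ContinuousWithinAt γ I x) (h₀ : ContinuousAt (vec j) (u, γ x))
    (h : ∃ᶠ s in 𝓝[I] x, IsHugoniot vec φ j u (γ s)) : IsHugoniot vec φ j u (γ x) := by
  refine eq_smul_of_frequently_isHugoniot (c := fun _ => 1) hγ.tendsto h₀ ?_ h
  simp only [one_smul]
  exact hγ.tendsto.sub_const u

/-- Away from `u` the difference `γ s - u` itself separates the families. Where the curve meets `u`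
the difference quotients take over, and the velocity must be a `j`-th eigenvector. -/
theorem IsHugoniot.eventually_nhdsWithin {u γ' : State n} {I : Set ℝ} {γ : ℝ → State n} {x : ℝ}
    (hx : x ∈ I) (hγ : HasDerivWithinAt γ γ' I x) (hreg : ∀ s ∈ I, IsRegular S vec φ (u, γ s))
    (hRH : ∀ s ∈ I, ∃ c : ℝ, S.f (γ s) - S.f u = c • (γ s - u))
    (h : IsHugoniot vec φ j u (γ x))
    (h₀ : γ x = u → γ' ≠ 0 ∧ γ' = φ j γ' • vec j (u, u)) :
    ∀ᶠ s in 𝓝[I] x, IsHugoniot vec φ j u (γ s) := by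
  by_cases hu : γ x = u
  · obtain ⟨h1, h2⟩ := h₀ hu
    have hs := hasDerivWithinAt_iff_tendsto_slope.1 hγ
    have hcont : Tendsto γ (𝓝[I \ {x}] x) (𝓝 u) := by
      rw [← hu]; exact (hγ.continuousWithinAt.mono sdiff_subset).tendsto
    have hmem : ∀ᶠ s in 𝓝[I \ {x}] x, s ∈ I \ {x} := eventually_mem_nhdsWithin
    have h3 : ∀ᶠ s in 𝓝[I \ {x}] x, IsHugoniot vec φ j u (γ s) := by
      refine eventually_isHugoniot (S := S) (c := fun s => (s - x)⁻¹) (q₀ := γ') hcont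
        (by have := hreg x hx; rwa [hu] at this) (hmem.mono fun s hs => hreg s hs.1)
        (hmem.mono fun s hs => hRH s hs.1) ?_ h1 h2
      refine hs.congr fun s => ?_
      rw [slope_def_module, hu]
    rw [eventually_nhdsWithin_iff] at h3 ⊢
    filter_upwards [h3] with s hs hsI
    by_cases hsx : s = x
    · rw [hsx]; exact h
    · exact hs ⟨hsI, hsx⟩
  · have hmem : ∀ᶠ s in 𝓝[I] x, s ∈ I := eventually_mem_nhdsWithin
    refine eventually_isHugoniot (S := S) (c := fun _ => 1) (q₀ := γ x - u)
      hγ.continuousWithinAt.tendsto (hreg x hx) (hmem.mono hreg) (hmem.mono hRH) ?_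
      (sub_ne_zero.2 hu) h
    simp only [one_smul]
    exact hγ.continuousWithinAt.tendsto.sub_const u

/-- `W` parametrizes the `j`-th Hugoniot curves by `θ w = θ u + κ s`. -/
structure IsHugoniotCurve (vec : Fin n → State n × State n → State n)
    (φ : Fin n → State n →L[ℝ] ℝ) (j : Fin n) (θ : State n → ℝ) (κ : ℝ)
    (W : ℝ × State n → State n) : Prop where
  contDiffAt : ContDiffAt ℝ 2 W 0
  zero : W 0 = 0
  isHugoniot : ∀ᶠ q in 𝓝 (0 : ℝ × State n), IsHugoniot vec φ j q.2 (W q) ∧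
    θ (W q) - θ q.2 = κ * q.1
  unique : ∀ᶠ q in 𝓝 (0 : (ℝ × State n) × State n), IsHugoniot vec φ j q.1.2 q.2 →
    θ q.2 - θ q.1.2 = κ * q.1.1 → q.2 = W q.1

/-- The velocity of the curves `s ↦ W (s, u)`. -/
noncomputable def curveVelocity (W : ℝ × State n → State n) (q : ℝ × State n) : State n :=
  fderiv ℝ W q (1, 0)

theorem tendsto_zero_prodMk : Tendsto (fun u : State n => ((0 : ℝ), u)) (𝓝 0)
    (𝓝 (0 : ℝ × State n)) :=
  (by fun_prop : Continuous fun u : State n => ((0 : ℝ), u)).tendsto' _ _ rfl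

theorem eventually_nhds_slice {P : ℝ × State n → Prop} (h : ∀ᶠ q in 𝓝 (0 : ℝ × State n), P q) :
    ∀ᶠ u in 𝓝 (0 : State n), ∀ᶠ s in 𝓝 (0 : ℝ), P (s, u) := by
  filter_upwards [tendsto_zero_prodMk.eventually h.eventually_nhds] with u hu
  exact ((by fun_prop : Continuous fun s : ℝ => (s, u)).tendsto 0).eventually hu

section curve

variable {θ : State n → ℝ} {κ : ℝ} {W : ℝ × State n → State n}
  (hW : IsHugoniotCurve vec φ j θ κ W)
include hW

theorem IsHugoniotCurve.apply_zero : ∀ᶠ u in 𝓝 (0 : State n), W (0, u) = u := by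
  have h : Tendsto (fun u : State n => ((0, u), u)) (𝓝 0) (𝓝 (0 : (ℝ × State n) × State n)) :=
    (by fun_prop : Continuous fun u : State n => (((0 : ℝ), u), u)).tendsto' _ _ rfl
  filter_upwards [h.eventually hW.unique] with u hu
  exact (hu (IsHugoniot.self u) (by simp)).symm

theorem IsHugoniotCurve.contDiffAt_velocity : ContDiffAt ℝ 1 (curveVelocity W) 0 :=
  (hW.contDiffAt.fderiv_right (m := 1) (by norm_num)).clm_apply contDiffAt_const

theorem IsHugoniotCurve.hasDerivAt : ∀ᶠ q in 𝓝 (0 : ℝ × State n),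
    HasDerivAt (fun s => W (s, q.2)) (curveVelocity W q) q.1 := by
  filter_upwards [hW.contDiffAt.eventually (by simp)] with q hq
  have h1 : HasFDerivAt W (fderiv ℝ W (q.1, q.2)) (q.1, q.2) :=
    (hq.differentiableAt (by simp)).hasFDerivAt
  have h2 : HasDerivAt (fun s : ℝ => (s, q.2)) ((1 : ℝ), (0 : State n)) q.1 :=
    (hasDerivAt_id q.1).prodMk (hasDerivAt_const _ _)
  exact h1.comp_hasDerivAt q.1 h2

/-- The velocity is the limit of the difference quotients `(W (s, u) - u) / s`, all of which are
multiples of `vec j (u, W (s, u))`. -/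
theorem IsHugoniotCurve.velocity_zero (hA : IsFrame S A vec val φ) :
    ∀ᶠ u in 𝓝 (0 : State n),
      curveVelocity W (0, u) = φ j (curveVelocity W (0, u)) • vec j (u, u) := by
  filter_upwards [tendsto_zero_prodMk.eventually hW.hasDerivAt,
    eventually_nhds_slice hW.isHugoniot, hW.apply_zero,
    tendsto_diag.eventually hA.eventually_isRegular] with u h1 h2 h3 h4
  have h5 := hasDerivAt_iff_tendsto_slope.1 h1
  refine eq_smul_of_frequently_isHugoniot (ℱ := 𝓝[≠] 0) (γ := fun s => W (s, u))
    (c := fun s => (s - 0)⁻¹) ?_ (h4.continuousAt j) ?_ ?_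
  · have := h1.continuousAt.tendsto
    simp only [h3] at this
    exact this.mono_left nhdsWithin_le_nhds
  · refine h5.congr fun s => ?_
    rw [slope_def_module, h3]
  · exact (h2.filter_mono nhdsWithin_le_nhds).frequently.mono fun s hs => hs.1

theorem IsHugoniotCurve.fderiv_velocity_zero (hθ : ∀ᶠ u in 𝓝 0, DifferentiableAt ℝ θ u) :
    ∀ᶠ u in 𝓝 (0 : State n), fderiv ℝ θ u (curveVelocity W (0, u)) = κ := by
  filter_upwards [tendsto_zero_prodMk.eventually hW.hasDerivAt,
    eventually_nhds_slice hW.isHugoniot, hW.apply_zero, hθ] with u h1 h2 h3 h4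
  have h5 : HasDerivAt (fun s => θ (W (s, u))) (fderiv ℝ θ u (curveVelocity W (0, u))) 0 := by
    refine HasFDerivAt.comp_hasDerivAt (f := fun s => W (s, u)) (0 : ℝ) ?_ h1
    simp only [h3]
    exact h4.hasFDerivAt
  have h6 : HasDerivAt (fun s : ℝ => θ u + κ * s) κ 0 := by
    simpa using ((hasDerivAt_id (0 : ℝ)).const_mul κ).const_add (θ u)
  refine h5.unique (h6.congr_of_eventuallyEq ?_)
  filter_upwards [h2] with s hs
  linarith [hs.2]

theorem IsHugoniotCurve.eventually_mem_ball {ρ : ℝ} (hρ : 0 < ρ) : ∀ᶠ q in 𝓝 (0 : ℝ × State n),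
    W q ∈ Metric.ball (0 : State n) ρ := by
  refine hW.contDiffAt.continuousAt.eventually_mem ?_
  rw [hW.zero]
  exact Metric.ball_mem_nhds _ hρ

theorem IsHugoniotCurve.rankineHugoniot (hA : IsFrame S A vec val φ) :
    ∀ᶠ q in 𝓝 (0 : ℝ × State n), S.f (W q) - S.f q.2 = val j (q.2, W q) • (W q - q.2) := by
  have h : Tendsto (fun q : ℝ × State n => (q.2, W q)) (𝓝 0) (𝓝 (0 : State n × State n)) := by
    have := continuousAt_snd.prodMk hW.contDiffAt.continuousAt
    rw [ContinuousAt, hW.zero] at this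
    exact this
  filter_upwards [hW.isHugoniot, h.eventually hA.mean, h.eventually (hA.eigen j)] with q h1 h2 h3
  rw [← h2, h1.1, map_smul, h3, smul_comm]

end curve

theorem IsFrame.exists_isHugoniotCurve (hA : IsFrame S A vec val φ) (j : Fin n) {θ : State n → ℝ}
    (hθ : ContDiffAt ℝ 2 θ 0) (κ : ℝ) (hθ' : fderiv ℝ θ 0 (S.r j 0) ≠ 0) :
    ∃ W, IsHugoniotCurve vec φ j θ κ W := by
  obtain ⟨W, h1, h2, h3, h4⟩ := hA.exists_hugoniot j hθ κ hθ'
  exact ⟨W, h1, h2, h3, h4⟩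

theorem _root_.IsFlow.flowMap_eq (hX : IsFlow V X K M) (u : State n) {σ : ℝ} (hσ : |σ| ≤ 1) :
    flowMap (flowVelocity V X) σ u = X σ u := by
  obtain ⟨L, hL⟩ := hX.exists_lipschitz_flowVelocity
  refine flowMap_eq_of_hasDerivWithinAt (γ := fun s => X s u) hL.continuous (hX.zero u)
    fun s hs => ?_
  have := hX.deriv' u hσ s hs
  rw [flowVelocity]
  simp only
  rwa [clamp_eq ((abs_le_of_mem_uIcc hs).trans hσ)]

/-- The displacement along the velocities `G` describes the `j`-th Lax curves. -/
structure IsLaxFamily (S : ConservationLaw n) (j : Fin n) (G : ℝ × State n → State n) : Prop where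
  uniq : ∀ s₀ > 0, ∃ R > 0, ∀ u w σ, S.IsLax (Metric.ball 0 R) j u σ w →
    |σ| ≤ s₀ ∧ w = flowMap G σ u
  exist : ∀ ρ > 0, ∀ᶠ q in 𝓝 (0 : ℝ × State n),
    S.IsLax (Metric.ball 0 ρ) j q.2 q.1 (flowMap G q.1 q.2)
  zero : ∀ᶠ u in 𝓝 (0 : State n), G (0, u) = S.r j u
  merge : ∀ᶠ q in 𝓝 (0 : ℝ × ℝ × State n), (S.LinearlyDegenerate j ∨ 0 ≤ q.1 ∧ 0 ≤ q.2.1) →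
    flowMap G q.1 (flowMap G q.2.1 q.2.2) = flowMap G (q.1 + q.2.1) q.2.2

end ConservationLaw

namespace ConservationLaw

variable {n : ℕ} {S : ConservationLaw n} {A : State n × State n → State n →L[ℝ] State n}
  {vec : Fin n → State n × State n → State n} {val : Fin n → State n × State n → ℝ}
  {φ : Fin n → State n →L[ℝ] ℝ} {V : State n → State n} {X : ℝ → State n → State n} {K : ℝ≥0}
  {M : ℝ} {j : Fin n}

/-! ### Lax curves of genuinely nonlinear fields -/

theorem IsFrame.eventually_r_ne (hS : S.Admissible) (hA : IsFrame S A vec val φ) (j : Fin n) :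
    ∀ᶠ u in 𝓝 (0 : State n), S.r j u ≠ 0 ∧ S.r j u = φ j (S.r j u) • vec j (u, u) :=
  ((hA.contDiffAt_r hS j).continuousAt.eventually_ne (hS.r_zero_ne j)).and (hA.r_eq hS j)

/-- Both vectors are multiples of `vec j (u, u)`, and `Dλⱼ` takes the same nonzero value `k j` on
them. -/
theorem IsHugoniotCurve.velocity_eq_r (hS : S.Admissible) (hA : IsFrame S A vec val φ)
    (hj : S.GenuinelyNonlinear j) {W : ℝ × State n → State n}
    (hW : IsHugoniotCurve vec φ j (S.lam j) (S.k j) W) :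
    ∀ᶠ u in 𝓝 (0 : State n), curveVelocity W (0, u) = S.r j u := by
  have hd : ∀ᶠ u in 𝓝 (0 : State n), DifferentiableAt ℝ (S.lam j) u :=
    ((hA.lam_contDiffAt j).eventually (by simp)).mono fun u hu => hu.differentiableAt (by simp)
  filter_upwards [hW.velocity_zero hA, hW.fderiv_velocity_zero hd, hA.r_eq hS j,
    hS.eigenvector j] with u h1 h2 h3 h4
  have h5 := h4.2.2.1 hj
  rw [h1, map_smul, smul_eq_mul] at h2
  rw [h3, map_smul, smul_eq_mul] at h5
  have h6 : fderiv ℝ (S.lam j) u (vec j (u, u)) ≠ 0 := fun h => by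
    rw [h, mul_zero] at h2
    exact (hS.k_pos j).ne h2
  rw [h1, h3, mul_right_cancel₀ h6 (h2.trans h5.symm)]

/-- The eigenvalue changes at the rate `k j` along the curve, so a small ball forces `|σ|` to be
small. Every point of the curve solves the Rankine–Hugoniot equations for some family; by
connectedness of the parameter interval the family stays `j`. The implicit function theorem then
identifies the endpoint. -/
theorem IsFrame.shock_unique (hS : S.Admissible) (hA : IsFrame S A vec val φ)
    (hj : S.GenuinelyNonlinear j) {W : ℝ × State n → State n}
    (hW : IsHugoniotCurve vec φ j (S.lam j) (S.k j) W) {s₀ : ℝ} (hs₀ : 0 < s₀) :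
    ∃ R > 0, ∀ u w σ, S.IsShock (Metric.ball 0 R) j u σ w → |σ| ≤ s₀ ∧ w = W (σ, u) := by
  obtain ⟨r₀, hr₀, h0⟩ := exists_ball_of_eventually hW.unique
  have hk := hS.k_pos j
  have hs : 0 < min s₀ (r₀ / 2) := by positivity
  have hlam : ∀ᶠ u in 𝓝 (0 : State n), |S.lam j u - S.lam j 0| < S.k j * min s₀ (r₀ / 2) / 2 :=
    ContinuousAt.eventually_lt
      ((hA.lam_contDiffAt j).continuousAt.sub continuousAt_const).abs continuousAt_const
      (by simp only [sub_self, abs_zero]; positivity)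
  obtain ⟨R₁, hR₁, h1⟩ := exists_ball_of_eventually (hlam.and (hA.eventually_r_ne hS j))
  obtain ⟨R₂, hR₂, h2⟩ := exists_ball_of_eventually hA.eventually_isRegular
  refine ⟨min r₀ (min R₁ R₂), by positivity, ?_⟩
  rintro u w σ ⟨γ, γ', rfl, rfl, -, hγ'0, hγ⟩
  have hm : ∀ s ∈ uIcc 0 σ, ‖γ s‖ < r₀ ∧ ‖γ s‖ < R₁ ∧ ‖γ s‖ < R₂ := fun s hs => by
    have := mem_ball_zero_iff.1 (hγ s hs).1
    simpa only [lt_min_iff] using this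
  have hm0 := hm 0 left_mem_uIcc
  have hmem1 : ∀ s ∈ uIcc 0 σ, γ s ∈ Metric.ball (0 : State n) R₁ := fun s hs =>
    mem_ball_zero_iff.2 (hm s hs).2.1
  have hreg : ∀ s ∈ uIcc 0 σ, IsRegular S vec φ (γ 0, γ s) := fun s hs =>
    h2 _ (mem_ball_zero_iff.2 (by rw [Prod.norm_def]; exact max_lt hm0.2.2 (hm s hs).2.2))
  have hlamγ : ∀ s ∈ uIcc 0 σ, S.lam j (γ s) = S.lam j (γ 0) + S.k j * s := fun s hs =>
    (hγ s hs).2.2.2.1 hj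
  have hσ : |σ| ≤ min s₀ (r₀ / 2) := by
    have h3 := (h1 _ (hmem1 σ right_mem_uIcc)).1
    have h4 := (h1 _ (hmem1 0 left_mem_uIcc)).1
    rw [hlamγ σ right_mem_uIcc] at h3
    have h5 : S.k j * |σ| ≤ S.k j * min s₀ (r₀ / 2) := by
      rw [← abs_of_pos hk, ← abs_mul, abs_of_pos hk]
      have := abs_sub (S.lam j (γ 0) + S.k j * σ - S.lam j 0) (S.lam j (γ 0) - S.lam j 0)
      have h6 : S.lam j (γ 0) + S.k j * σ - S.lam j 0 - (S.lam j (γ 0) - S.lam j 0) =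
        S.k j * σ := by ring
      rw [h6] at this
      linarith
    exact le_of_mul_le_mul_left h5 hk
  refine ⟨hσ.trans (min_le_left _ _), ?_⟩
  have hall := forall_mem_of_isPreconnected (P := fun s => IsHugoniot vec φ j (γ 0) (γ s))
    isPreconnected_uIcc (left_mem_uIcc (a := (0 : ℝ)) (b := σ)) (IsHugoniot.self _)
    (fun x hx hP => by
      refine hP.eventually_nhdsWithin hx (hγ x hx).2.1 hreg (fun s hs => (hγ s hs).2.2.1)
        fun hx0 => ?_
      -- Because of `λⱼ(γ x) = λⱼ(u) + k x`, the curve meets `u` only at the parameter `0`, where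
      -- its velocity is prescribed.
      have hx1 : x = 0 := by
        have h3 := hlamγ x hx
        rw [hx0] at h3
        have h4 : S.k j * x = 0 := by linarith
        exact (mul_eq_zero.1 h4).resolve_left hk.ne'
      rw [hx1, hγ'0]
      exact (h1 _ (hmem1 0 left_mem_uIcc)).2)
    (fun x hx hP => IsHugoniot.of_frequently (hγ x hx).2.1.continuousWithinAt
      ((hreg x hx).continuousAt j) hP)
  have hmem : ((σ, γ 0), γ σ) ∈ Metric.ball (0 : (ℝ × State n) × State n) r₀ := by
    rw [mem_ball_zero_iff, Prod.norm_def, Prod.norm_def]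
    refine max_lt (max_lt ?_ hm0.1) (hm σ right_mem_uIcc).1
    rw [Real.norm_eq_abs]
    have := hσ.trans (min_le_right _ _)
    linarith
  exact h0 _ hmem (hall σ right_mem_uIcc) (by simp only [hlamγ σ right_mem_uIcc]; ring)

/-- The velocities `F` for positive times, continued by the velocities `g` for negative times. -/
noncomputable def laxVelocity (F g : ℝ × State n → State n) (q : ℝ × State n) : State n :=
  F (max q.1 0, q.2) + (g (min q.1 0, q.2) - g (0, q.2))

/-- Truncating the time by `max` and `min` avoids any case distinction at time `0`. For negative
times the value is `g` plus the mismatch `F (0, u) - g (0, u)`, which vanishes where the two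
velocities agree initially. -/
theorem exists_lipschitz_laxVelocity {F g : ℝ × State n → State n} {L₁ L₂ : ℝ≥0}
    (hF : LipschitzWith L₁ F) (hg : LipschitzWith L₂ g) :
    ∃ L, LipschitzWith L (laxVelocity F g) := by
  have h1 : LipschitzWith 1 fun q : ℝ × State n => q.1 := LipschitzWith.prod_fst
  have h2 : LipschitzWith 1 fun q : ℝ × State n => q.2 := LipschitzWith.prod_snd
  exact ⟨_, (hF.comp ((h1.max_const 0).prodMk h2)).add
    ((hg.comp ((h1.min_const 0).prodMk h2)).sub
      (hg.comp ((LipschitzWith.const (0 : ℝ)).prodMk h2)))⟩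

theorem norm_laxVelocity_le {F g : ℝ × State n → State n} {M₁ M₂ : ℝ} (hF : ∀ q, ‖F q‖ ≤ M₁)
    (hg : ∀ q, ‖g q‖ ≤ M₂) (q : ℝ × State n) : ‖laxVelocity F g q‖ ≤ M₁ + (M₂ + M₂) :=
  (norm_add_le _ _).trans (add_le_add (hF _) ((norm_sub_le _ _).trans (add_le_add (hg _) (hg _))))

theorem flowMap_laxVelocity {F g : ℝ × State n → State n} {σ : ℝ} (hσ : 0 ≤ σ) (u : State n) :
    flowMap (laxVelocity F g) σ u = flowMap F σ u := by
  simp only [flowMap]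
  congr 1
  refine intervalIntegral.integral_congr fun s hs => ?_
  rw [uIcc_of_le hσ] at hs
  simp only [laxVelocity]
  rw [max_eq_left hs.1, min_eq_right hs.1, sub_self, add_zero]

theorem IsFieldFlow.exists_flowMap_unique (hA : IsFrame S A vec val φ)
    (hX : IsFieldFlow S j V X K M) {s₀ : ℝ} (hs₀ : 0 < s₀) :
    ∃ R > 0, ∀ u w σ, S.IsRarefaction (Metric.ball 0 R) j u σ w →
      |σ| ≤ s₀ ∧ |σ| ≤ 1 ∧ w = X σ u := by
  obtain ⟨R, hR, h⟩ := hX.integralCurve_unique hA hs₀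
  refine ⟨R, hR, ?_⟩
  rintro u w σ ⟨γ, rfl, rfl, hγ⟩
  obtain ⟨h1, h2⟩ := h γ σ hγ
  exact ⟨h1.trans (min_le_left _ _), h1.trans (min_le_right _ _), h2⟩

theorem IsFieldFlow.isRarefaction (hX : IsFieldFlow S j V X K M) {ρ : ℝ} (hρ : 0 < ρ) :
    ∀ᶠ q in 𝓝 (0 : ℝ × State n),
      |q.1| ≤ 1 ∧ S.IsRarefaction (Metric.ball 0 ρ) j q.2 q.1 (X q.1 q.2) := by
  filter_upwards [hX.exists_integralCurve hρ] with q hq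
  exact ⟨hq.1, fun s => X s q.2, hX.zero _, rfl, fun s hs => ⟨(hq.2 s hs).1, (hq.2 s hs).2.2⟩⟩

theorem IsRarefaction.mono {B B' : Set (State n)} (h : B ⊆ B') {u w : State n} {σ : ℝ}
    (hw : S.IsRarefaction B j u σ w) : S.IsRarefaction B' j u σ w := by
  obtain ⟨γ, h0, h1, h2⟩ := hw
  exact ⟨γ, h0, h1, fun s hs => ⟨h (h2 s hs).1, (h2 s hs).2⟩⟩

theorem IsShock.mono {B B' : Set (State n)} (h : B ⊆ B') {u w : State n} {σ : ℝ}
    (hw : S.IsShock B j u σ w) : S.IsShock B' j u σ w := by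
  obtain ⟨γ, γ', h0, h1, h2, h3, h4⟩ := hw
  exact ⟨γ, γ', h0, h1, h2, h3, fun s hs => ⟨h (h4 s hs).1, (h4 s hs).2⟩⟩

theorem IsShock.mem_left {B : Set (State n)} {u w : State n} {σ : ℝ}
    (hw : S.IsShock B j u σ w) : u ∈ B := by
  obtain ⟨γ, γ', rfl, h1, h2, h3, h4⟩ := hw
  exact (h4 0 left_mem_uIcc).1

theorem eventually_abs_le_half :
    ∀ᶠ q in 𝓝 (0 : ℝ × ℝ × State n), |q.1| ≤ 1 / 2 ∧ |q.2.1| ≤ 1 / 2 := by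
  have h1 : ∀ᶠ q in 𝓝 (0 : ℝ × ℝ × State n), |q.1| < 1 / 2 :=
    ContinuousAt.eventually_lt (by fun_prop) continuousAt_const (by simp)
  have h2 : ∀ᶠ q in 𝓝 (0 : ℝ × ℝ × State n), |q.2.1| < 1 / 2 :=
    ContinuousAt.eventually_lt (by fun_prop) continuousAt_const (by simp)
  filter_upwards [h1, h2] with q h1 h2 using ⟨h1.le, h2.le⟩

/-- The rarefaction flow for nonnegative and the Hugoniot curve for negative parameters both start
with velocity `r j u`, so near the origin they glue to one Lipschitz velocity. Only two rarefactions
compose exactly, by the flow property. -/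
theorem IsFrame.exists_isLaxFamily_of_genuinelyNonlinear (hS : S.Admissible)
    (hA : IsFrame S A vec val φ) (hj : S.GenuinelyNonlinear j) :
    ∃ G L M, LipschitzWith L G ∧ (∀ q, ‖G q‖ ≤ M) ∧ IsLaxFamily S j G := by
  obtain ⟨V, X, K, M, hX⟩ := hA.exists_isFieldFlow hS j
  obtain ⟨W, hW⟩ := hA.exists_isHugoniotCurve j (hA.lam_contDiffAt j) (S.k j)
    (by rw [(hS.eigenvector j).self_of_nhds.2.2.1 hj]; exact (hS.k_pos j).ne')
  obtain ⟨g, L₂, M₂, hg, hM₂, hgW⟩ := exists_lipschitz_extension hW.contDiffAt_velocity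
  obtain ⟨L₁, hL₁⟩ := hX.exists_lipschitz_flowVelocity
  obtain ⟨L, hL⟩ := exists_lipschitz_laxVelocity hL₁ hg
  have hpos : ∀ u σ, 0 ≤ σ → |σ| ≤ 1 →
      flowMap (laxVelocity (flowVelocity V X) g) σ u = X σ u := fun u σ h0 h1 => by
    rw [flowMap_laxVelocity h0, hX.flowMap_eq u h1]
  have hG0 : ∀ u, laxVelocity (flowVelocity V X) g (0, u) = V u := fun u => by
    rw [laxVelocity]
    simp only [max_self, min_self, sub_self, add_zero]
    exact hX.flowVelocity_zero u
  have hsnd : ∀ᶠ q in 𝓝 (0 : ℝ × State n),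
      V q.2 = S.r j q.2 ∧ curveVelocity W (0, q.2) = S.r j q.2 ∧ W (0, q.2) = q.2 :=
    (continuous_snd.tendsto (0 : ℝ × State n)).eventually
      (hX.eq_r.and ((hW.velocity_eq_r hS hA hj).and hW.apply_zero))
  have hneg : ∀ᶠ q in 𝓝 (0 : ℝ × State n), q.1 ≤ 0 →
      flowMap (laxVelocity (flowVelocity V X) g) q.1 q.2 = W q := by
    filter_upwards [hsnd, eventually_forall_uIcc (hgW.and hW.hasDerivAt)] with q h1 h2 hq
    refine flowMap_eq_of_hasDerivWithinAt (γ := fun s => W (s, q.2)) hL.continuous h1.2.2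
      fun s hs => ?_
    have h3 : laxVelocity (flowVelocity V X) g (s, q.2) = curveVelocity W (s, q.2) := by
      have hs0 : s ≤ 0 := by rw [uIcc_of_ge hq] at hs; exact hs.2
      rw [laxVelocity]
      simp only
      rw [max_eq_right hs0, min_eq_left hs0, hX.flowVelocity_zero, (h2 s hs).1,
        (h2 0 left_mem_uIcc).1, h1.1, h1.2.1, add_sub_cancel]
    rw [h3]
    exact (h2 s hs).2.hasDerivWithinAt
  refine ⟨_, L, _, hL, norm_laxVelocity_le hX.norm_flowVelocity_le hM₂, ?_, ?_, ?_, ?_⟩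
  · intro s₀ hs₀
    obtain ⟨r₀, hr₀, h0⟩ := exists_ball_of_eventually hneg
    obtain ⟨R₁, hR₁, h1⟩ := hX.exists_flowMap_unique hA hs₀
    obtain ⟨R₂, hR₂, h2⟩ := hA.shock_unique hS hj hW (lt_min hs₀ (half_pos hr₀))
    refine ⟨min r₀ (min R₁ R₂), by positivity, ?_⟩
    rintro u w σ (⟨hσ, h⟩ | ⟨hσ, h⟩)
    · obtain ⟨h3, h4, h5⟩ := h1 u w σ
        (h.mono (Metric.ball_subset_ball ((min_le_right _ _).trans (min_le_left _ _))))
      exact ⟨h3, by rw [hpos u σ hσ h4, h5]⟩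
    · obtain ⟨h3, h4⟩ := h2 u w σ
        (h.mono (Metric.ball_subset_ball ((min_le_right _ _).trans (min_le_right _ _))))
      refine ⟨h3.trans (min_le_left _ _), ?_⟩
      rw [h4]
      refine (h0 (σ, u) ?_ hσ.le).symm
      rw [mem_ball_zero_iff, Prod.norm_def]
      have h5 := h3.trans (min_le_right _ _)
      have h6 := mem_ball_zero_iff.1 h.mem_left
      refine max_lt ?_ (h6.trans_le (min_le_left _ _))
      rw [Real.norm_eq_abs]
      linarith
  · intro ρ hρ
    filter_upwards [hX.isRarefaction hρ, hneg, hsnd,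
      eventually_forall_uIcc (hW.hasDerivAt.and ((hW.eventually_mem_ball hρ).and
        ((hW.rankineHugoniot hA).and (hW.isHugoniot.and
          (hW.contDiffAt_velocity.eventually (by simp))))))] with q h1 h2 h3 h4
    rcases le_or_gt 0 q.1 with hq | hq
    · left
      rw [hpos _ _ hq h1.1]
      exact ⟨hq, h1.2⟩
    · right
      rw [h2 hq.le]
      refine ⟨hq, fun s => W (s, q.2), fun s => curveVelocity W (s, q.2), h3.2.2, rfl, ?_, h3.2.1,
        fun s hs => ⟨(h4 s hs).2.1, (h4 s hs).1.hasDerivWithinAt, ⟨_, (h4 s hs).2.2.1⟩,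
          fun _ => ?_, fun h => absurd h (hS.not_linearlyDegenerate hj)⟩⟩
      · intro s hs
        have h5 : ContinuousAt (curveVelocity W) (s, q.2) := (h4 s hs).2.2.2.2.continuousAt
        exact (h5.comp (f := fun s : ℝ => (s, q.2)) (by fun_prop)).continuousWithinAt
      · linarith [(h4 s hs).2.2.2.1.2]
  · filter_upwards [hX.eq_r] with u hu
    rw [hG0, hu]
  · filter_upwards [eventually_abs_le_half] with q h1 h2
    obtain ⟨h3, h4⟩ := h2.resolve_left (hS.not_linearlyDegenerate hj)
    have h5 : |q.1 + q.2.1| ≤ 1 := (abs_add_le _ _).trans (by linarith [h1.1, h1.2])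
    have h6 : |q.1| ≤ 1 := by linarith [h1.1]
    have h7 : |q.2.1| ≤ 1 := by linarith [h1.2]
    rw [hpos _ _ h3 h6, hpos _ _ h4 h7, hpos _ _ (add_nonneg h3 h4) h5, hX.add _ h6 h7 h5]

end ConservationLaw

namespace ConservationLaw

variable {n : ℕ} {S : ConservationLaw n} {A : State n × State n → State n →L[ℝ] State n}
  {vec : Fin n → State n × State n → State n} {val : Fin n → State n × State n → ℝ}
  {φ : Fin n → State n →L[ℝ] ℝ} {V : State n → State n} {X : ℝ → State n → State n} {K : ℝ≥0}
  {M : ℝ} {j : Fin n}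

/-! ### Lax curves of linearly degenerate fields -/

theorem eq_of_hasDerivWithinAt_zero {Y : Type*} [NormedAddCommGroup Y] [NormedSpace ℝ Y]
    {g : ℝ → Y} {σ : ℝ} (h : ∀ s ∈ uIcc 0 σ, HasDerivWithinAt g 0 (uIcc 0 σ) s) {s : ℝ}
    (hs : s ∈ uIcc 0 σ) : g s = g 0 := by
  have h3 := (convex_uIcc (0 : ℝ) σ).norm_image_sub_le_of_norm_hasDerivWithin_le (C := 0)
    h (fun s _ => by simp) left_mem_uIcc hs
  simpa [sub_eq_zero] using h3

/-- Linear degeneracy makes `λⱼ` constant along an integral curve. Hence `f - λⱼ(u) · id` has zero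
derivative along it, and the integral curve satisfies the Rankine–Hugoniot equations with speed
`λⱼ(u)`. -/
theorem IsFieldFlow.rankineHugoniot (hS : S.Admissible) (hA : IsFrame S A vec val φ)
    (hX : IsFieldFlow S j V X K M) (hj : S.LinearlyDegenerate j) :
    ∀ᶠ q in 𝓝 (0 : ℝ × State n),
      S.f (X q.1 q.2) - S.f q.2 = S.lam j q.2 • (X q.1 q.2 - q.2) := by
  have hst : ∀ᶠ u in 𝓝 (0 : State n), HasFDerivAt S.f (fderiv ℝ S.f u) u ∧
      fderiv ℝ S.f u (S.r j u) = S.lam j u • S.r j u ∧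
      HasFDerivAt (S.lam j) (fderiv ℝ (S.lam j) u) u ∧ fderiv ℝ (S.lam j) u (S.r j u) = 0 := by
    filter_upwards [hA.f_differentiable, hS.eigenvector j, hS.isOpen.mem_nhds hS.zero_mem,
      (hA.lam_contDiffAt j).eventually (by simp)] with u h1 h2 h3 h4
    exact ⟨h1.differentiableAt.hasFDerivAt, h2.2.1, (h4.differentiableAt (by simp)).hasFDerivAt,
      hj u h3 _ h2.2.1⟩
  obtain ⟨R, hR, h⟩ := exists_ball_of_eventually hst
  filter_upwards [hX.exists_integralCurve hR] with q hq
  have h1 : ∀ s ∈ uIcc 0 q.1, S.lam j (X s q.2) = S.lam j q.2 := fun s hs => by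
    have := eq_of_hasDerivWithinAt_zero (g := fun s => S.lam j (X s q.2)) (σ := q.1)
      (fun s hs => by
        obtain ⟨h2, -, h3⟩ := hq.2 s hs
        have h4 := (h _ h2).2.2.1.comp_hasDerivWithinAt s h3
        rw [(h _ h2).2.2.2] at h4
        exact h4) hs
    simpa [hX.zero] using this
  have h2 := eq_of_hasDerivWithinAt_zero
    (g := fun s => S.f (X s q.2) - S.lam j q.2 • X s q.2) (σ := q.1)
    (fun s hs => by
      obtain ⟨h2, -, h3⟩ := hq.2 s hs
      have h4 := ((h _ h2).1.comp_hasDerivWithinAt s h3).sub (h3.const_smul (S.lam j q.2))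
      rw [(h _ h2).2.1, h1 s hs, sub_self] at h4
      exact h4) right_mem_uIcc
  simp only [hX.zero] at h2
  rwa [smul_sub, sub_eq_sub_iff_sub_eq_sub]

theorem _root_.IsFlow.tendsto_zero (hX : IsFlow V X K M) :
    Tendsto (fun q : ℝ × State n => X q.1 q.2) (𝓝 0) (𝓝 0) := by
  rw [Metric.tendsto_nhds]
  intro ε hε
  filter_upwards [hX.eventually_mem ε hε] with q hq
  exact hq.2 _ right_mem_uIcc

/-- The displacement is an eigenvector of the averaged matrix with eigenvalue `λⱼ(u)`, and near the
origin no other family has an eigenvalue equal to it. -/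
theorem IsFieldFlow.isHugoniot (hS : S.Admissible) (hA : IsFrame S A vec val φ)
    (hX : IsFieldFlow S j V X K M) (hj : S.LinearlyDegenerate j) :
    ∀ᶠ q in 𝓝 (0 : ℝ × State n), IsHugoniot vec φ j q.2 (X q.1 q.2) := by
  have hlim : Tendsto (fun q : ℝ × State n => (q.2, X q.1 q.2)) (𝓝 0)
      (𝓝 (0 : State n × State n)) :=
    (continuous_snd.tendsto (0 : ℝ × State n)).prodMk_nhds hX.tendsto_zero
  have hgap : ∀ᶠ p in 𝓝 (0 : State n × State n), ∀ i, S.lam j p.1 = val i p → i = j := by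
    refine eventually_all.2 fun i => ?_
    by_cases hij : i = j
    · exact Eventually.of_forall fun _ _ => hij
    have h1 : ContinuousAt (fun p : State n × State n => S.lam j p.1) 0 :=
      ContinuousAt.comp (g := S.lam j) (hA.lam_contDiffAt j).continuousAt continuousAt_fst
    have h2 : ContinuousAt (fun p => S.lam j p.1 - val i p) (0 : State n × State n) :=
      h1.sub (hA.val_contDiffAt i).continuousAt
    have h3 : S.lam j (0 : State n × State n).1 - val i 0 ≠ 0 := by
      have h4 := hA.lam_eq.self_of_nhds j
      have h5 := hA.val_strictMono.self_of_nhds.injective.ne hij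
      intro h6
      exact h5 ((sub_eq_zero.1 h6).symm.trans h4)
    filter_upwards [h2.eventually_ne h3] with p hp hp'
    exact absurd (sub_eq_zero.2 hp') hp
  filter_upwards [hX.rankineHugoniot hS hA hj, hlim.eventually hA.mean,
    hlim.eventually hA.complete, hlim.eventually hgap] with q h1 h2 h3 h4
  by_cases hne : X q.1 q.2 - q.2 = 0
  · rw [sub_eq_zero.1 hne]
    exact IsHugoniot.self _
  · obtain ⟨i, hi, hi'⟩ := h3 _ _ hne (h2.trans h1)
    rw [h4 i hi] at hi'
    exact hi'

/-- The function `φ j (X t u - u)` has slope near `1` in `t`, so by the intermediate value theorem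
it attains every small value. A Hugoniot parameter can thus be turned into a time of the flow. -/
theorem IsFieldFlow.exists_time (hA : IsFrame S A vec val φ) (hX : IsFieldFlow S j V X K M)
    {P : ℝ × State n → Prop} (hP : ∀ᶠ q in 𝓝 (0 : ℝ × State n), P q) :
    ∀ᶠ q in 𝓝 (0 : ℝ × State n), ∃ t, P (t, q.2) ∧ φ j (X t q.2 - q.2) = q.1 := by
  obtain ⟨R', hR', h'⟩ := exists_ball_of_eventually
    (hP.and (hX.tendsto_zero.eventually (hX.eventually_near_one hA)))
  set R := min R' 1 with hRdef
  have hR : 0 < R := by positivity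
  have hR1 : R ≤ 1 := min_le_right _ _
  have h : ∀ q ∈ Metric.ball (0 : ℝ × State n) R, _ := fun q hq =>
    h' q (Metric.ball_subset_ball (min_le_left _ _) hq)
  filter_upwards [Metric.ball_mem_nhds (0 : ℝ × State n) (show 0 < R / 4 by positivity)] with q hq
  rw [mem_ball_zero_iff, Prod.norm_def, max_lt_iff, Real.norm_eq_abs] at hq
  have hmem : ∀ t, |t| ≤ R / 2 → (t, q.2) ∈ Metric.ball (0 : ℝ × State n) R := fun t ht => by
    rw [mem_ball_zero_iff, Prod.norm_def, Real.norm_eq_abs]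
    exact max_lt (by simp only; linarith) (by simp only; linarith [hq.2])
  have hb : ∀ t, |t| ≤ R / 2 → |φ j (X t q.2 - q.2) - t| ≤ 1 / 2 * |t| := fun t ht => by
    have ht1 : |t| ≤ 1 := by linarith
    have h2 : ∀ s ∈ uIcc 0 t, HasDerivWithinAt (fun s => φ j (X s q.2 - q.2) - s)
        (φ j (V (X s q.2)) - 1) (uIcc 0 t) s := fun s hs =>
      ((φ j).hasFDerivAt.comp_hasDerivWithinAt s ((hX.deriv' q.2 ht1 s hs).sub_const _)).sub
        (hasDerivWithinAt_id _ _)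
    have h3 := (convex_uIcc (0 : ℝ) t).norm_image_sub_le_of_norm_hasDerivWithin_le (C := 1 / 2)
      h2 (fun s hs => (h _ (hmem s ((abs_le_of_mem_uIcc hs).trans ht))).2) left_mem_uIcc
        right_mem_uIcc
    simpa [hX.zero] using h3
  have hc : ContinuousOn (fun t => φ j (X t q.2 - q.2)) (Icc (-(R / 2)) (R / 2)) := fun t ht => by
    have ht1 : t ∈ Icc (-1 : ℝ) 1 := ⟨by linarith [ht.1], by linarith [ht.2]⟩
    have h2 : ContinuousWithinAt (fun t => X t q.2) (Icc (-(R / 2)) (R / 2)) t :=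
      (hX.deriv q.2 t ht1).continuousWithinAt.mono (Icc_subset_Icc (by linarith) (by linarith))
    exact (φ j).continuous.continuousAt.comp_continuousWithinAt (h2.sub_const _)
  have hR2 : |R / 2| = R / 2 := abs_of_pos (by positivity)
  have h5 := abs_le.1 (hb (R / 2) hR2.le)
  have h6 := abs_le.1 (hb (-(R / 2)) (by rw [abs_neg, hR2]))
  rw [abs_neg, hR2] at h6
  rw [hR2] at h5
  have h7 := abs_lt.1 hq.1
  obtain ⟨t, ht, hzt⟩ := intermediate_value_Icc (by linarith) hc
    (show q.1 ∈ Icc _ _ from ⟨by linarith [h6.2], by linarith [h5.1]⟩)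
  exact ⟨t, (h _ (hmem t (abs_le.2 ht))).1, hzt⟩

/-- For a linearly degenerate field the integral curve is a reparametrized Hugoniot curve, `X t u =
W (φ j (X t u - u), u)`. Differentiation in `t` gives the claim at the points of the flow, and these
fill the Hugoniot curve by `exists_time`. -/
theorem IsHugoniotCurve.velocity_parallel_r (hS : S.Admissible) (hA : IsFrame S A vec val φ)
    (hX : IsFieldFlow S j V X K M) (hj : S.LinearlyDegenerate j) {W : ℝ × State n → State n}
    (hW : IsHugoniotCurve vec φ j (φ j) 1 W) : ∀ᶠ q in 𝓝 (0 : ℝ × State n),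
      S.r j (W q) = φ j (S.r j (W q)) • curveVelocity W q := by
  have hlim : Tendsto (fun q : ℝ × State n => (φ j (X q.1 q.2 - q.2), q.2)) (𝓝 0)
      (𝓝 (0 : ℝ × State n)) := by
    have h1 := ((φ j).continuous.tendsto _).comp
      (hX.tendsto_zero.sub (continuous_snd.tendsto (0 : ℝ × State n)))
    exact (h1.prodMk_nhds (continuous_snd.tendsto (0 : ℝ × State n))).mono_right
      (le_of_eq (by simp [← Prod.zero_eq_mk]))
  have hlim3 : Tendsto (fun q : ℝ × State n => ((φ j (X q.1 q.2 - q.2), q.2), X q.1 q.2)) (𝓝 0)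
      (𝓝 (0 : (ℝ × State n) × State n)) := hlim.prodMk_nhds hX.tendsto_zero
  have hXW : ∀ᶠ q in 𝓝 (0 : ℝ × State n), X q.1 q.2 = W (φ j (X q.1 q.2 - q.2), q.2) := by
    filter_upwards [hX.isHugoniot hS hA hj, hlim3.eventually hW.unique] with q h1 h2
    exact h2 h1 (by simp)
  have hpar : ∀ᶠ q in 𝓝 (0 : ℝ × State n), S.r j (X q.1 q.2) =
      φ j (S.r j (X q.1 q.2)) • curveVelocity W (φ j (X q.1 q.2 - q.2), q.2) := by
    have hlt : ∀ᶠ q in 𝓝 (0 : ℝ × State n), |q.1| < 1 :=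
      ContinuousAt.eventually_lt (by fun_prop) continuousAt_const (by simp)
    filter_upwards [hXW.eventually_nhds, hlim.eventually hW.hasDerivAt, hlt,
      hX.tendsto_zero.eventually hX.eq_r] with q h1 h2 h3 h4
    have h5 : ∀ᶠ t in 𝓝 q.1, X t q.2 = W (φ j (X t q.2 - q.2), q.2) :=
      ((by fun_prop : Continuous fun t : ℝ => (t, q.2)).tendsto q.1).eventually h1
    have h6 : HasDerivAt (fun t => X t q.2) (S.r j (X q.1 q.2)) q.1 := by
      rw [← h4]
      have := abs_lt.1 h3
      exact (hX.deriv q.2 q.1 ⟨this.1.le, this.2.le⟩).hasDerivAt (Icc_mem_nhds this.1 this.2)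
    have h7 : HasDerivAt (fun t => φ j (X t q.2 - q.2)) (φ j (S.r j (X q.1 q.2))) q.1 :=
      (φ j).hasFDerivAt.comp_hasDerivAt q.1 (h6.sub_const _)
    have h8 := HasDerivAt.scomp (h := fun t => φ j (X t q.2 - q.2))
      (g₁ := fun z => W (z, q.2)) q.1 h2 h7
    exact h6.unique (h8.congr_of_eventuallyEq h5)
  filter_upwards [hX.exists_time hA (hXW.and hpar)] with q ⟨t, ⟨h1, h2⟩, h3⟩
  simp only [h3] at h1 h2
  rwa [h1] at h2

/-- Again a connectedness argument. Since `λⱼ` is constant along the curve, it cannot exclude a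
return to `u`; therefore the equation `γ' = r j (γ)` is carried along together with the Hugoniot
relation, so that the velocity is known at such a return. -/
theorem IsFrame.isRarefaction_of_isShock (hS : S.Admissible) (hA : IsFrame S A vec val φ)
    (hj : S.LinearlyDegenerate j) : ∃ R > 0, ∀ ρ ≤ R, ∀ u w σ, σ < 0 →
      S.IsShock (Metric.ball 0 ρ) j u σ w → S.IsRarefaction (Metric.ball 0 ρ) j u σ w := by
  obtain ⟨V, X, K, M, hX⟩ := hA.exists_isFieldFlow hS j
  obtain ⟨W, hW⟩ := hA.exists_isHugoniotCurve j (φ j).contDiff.contDiffAt 1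
    (by rw [(φ j).fderiv, hA.dual]; simp)
  have hst : ∀ᶠ u in 𝓝 (0 : State n), (S.r j u ≠ 0 ∧ S.r j u = φ j (S.r j u) • vec j (u, u)) ∧
      ‖S.r j u‖ = 1 ∧ 0 < φ j (S.r j u) ∧ ContinuousAt (S.r j) u := by
    filter_upwards [hA.eventually_r_ne hS j, hS.eigenvector j, hX.eq_r,
      hX.eventually_near_one hA] with u h1 h2 h3 h4
    rw [h3] at h4
    exact ⟨h1, h2.2.2.2 hj, by linarith [(abs_le.1 h4).1], h2.1⟩
  have hlim : Tendsto (fun p : State n × State n => (φ j (p.2 - p.1), p.1)) (𝓝 0)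
      (𝓝 (0 : ℝ × State n)) :=
    (by fun_prop : Continuous fun p : State n × State n => (φ j (p.2 - p.1), p.1)).tendsto' _ _
      (by simp [← Prod.zero_eq_mk])
  have hlim3 : Tendsto (fun p : State n × State n => ((φ j (p.2 - p.1), p.1), p.2)) (𝓝 0)
      (𝓝 (0 : (ℝ × State n) × State n)) := hlim.prodMk_nhds (continuous_snd.tendsto _)
  obtain ⟨R₁, hR₁, h1⟩ := exists_ball_of_eventually hst
  obtain ⟨R₂, hR₂, h2⟩ := exists_ball_of_eventually (hA.eventually_isRegular.and
    ((hlim3.eventually hW.unique).and ((hlim.eventually hW.hasDerivAt).and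
      (hlim.eventually (hW.velocity_parallel_r hS hA hX hj)))))
  refine ⟨min R₁ R₂, by positivity, fun ρ hρ u w σ hσ => ?_⟩
  rintro ⟨γ, γ', rfl, rfl, hγc, hγ'0, hγ⟩
  set I := uIcc 0 σ with hI
  have hmem1 : ∀ s ∈ I, γ s ∈ Metric.ball (0 : State n) R₁ := fun s hs =>
    Metric.ball_subset_ball (hρ.trans (min_le_left _ _)) (hγ s hs).1
  have hmem2 : ∀ s ∈ I, (γ 0, γ s) ∈ Metric.ball (0 : State n × State n) R₂ := fun s hs => by
    have h3 := mem_ball_zero_iff.1 (hγ s hs).1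
    have h4 := mem_ball_zero_iff.1 (hγ 0 left_mem_uIcc).1
    rw [mem_ball_zero_iff, Prod.norm_def]
    exact (max_lt h4 h3).trans_le (hρ.trans (min_le_right _ _))
  have huniq : UniqueDiffOn ℝ I := by
    rw [hI, uIcc_of_ge hσ.le]; exact uniqueDiffOn_Icc hσ
  have hall := forall_mem_of_isPreconnected
    (P := fun s => γ' s = S.r j (γ s) ∧ IsHugoniot vec φ j (γ 0) (γ s))
    isPreconnected_uIcc (left_mem_uIcc (a := (0 : ℝ)) (b := σ)) ⟨hγ'0, IsHugoniot.self _⟩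
    (fun x hx ⟨hP1, hP2⟩ => by
      have h3 : ∀ᶠ s in 𝓝[I] x, IsHugoniot vec φ j (γ 0) (γ s) :=
        hP2.eventually_nhdsWithin hx (hγ x hx).2.1 (fun s hs => (h2 _ (hmem2 s hs)).1)
          (fun s hs => (hγ s hs).2.2.1) fun hx0 => by
            rw [hP1, hx0]; exact (h1 _ (hmem1 0 left_mem_uIcc)).1
      have h4 : ∀ᶠ s in 𝓝[I] x, 0 < φ j (γ' s) := by
        have h5 : ContinuousWithinAt (fun s => φ j (γ' s)) I x :=
          (φ j).continuous.continuousAt.comp_continuousWithinAt (hγc x hx)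
        refine h5.tendsto.eventually_const_lt ?_
        rw [hP1]
        exact (h1 _ (hmem1 x hx)).2.2.1
      have hEq : ∀ s ∈ I, IsHugoniot vec φ j (γ 0) (γ s) →
          γ s = W (φ j (γ s - γ 0), γ 0) := fun s hs h =>
        (h2 _ (hmem2 s hs)).2.1 h (by simp)
      filter_upwards [eventually_eventually_nhdsWithin.2 h3, h3, h4,
        eventually_mem_nhdsWithin] with s h5 h6 h7 hs
      refine ⟨?_, h6⟩
      obtain ⟨-, -, h8, h9⟩ := h2 _ (hmem2 s hs)
      have h10 : HasDerivWithinAt (fun s => φ j (γ s - γ 0)) (φ j (γ' s)) I s :=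
        (φ j).hasFDerivAt.comp_hasDerivWithinAt s ((hγ s hs).2.1.sub_const _)
      have h11 := HasDerivAt.scomp_hasDerivWithinAt (h := fun s => φ j (γ s - γ 0))
        (g₁ := fun z => W (z, γ 0)) s h8 h10
      have h12 : γ' s = φ j (γ' s) • curveVelocity W (φ j (γ s - γ 0), γ 0) := by
        refine (huniq s hs).eq_deriv _ (hγ s hs).2.1 (h11.congr_of_eventuallyEq ?_ (hEq s hs h6))
        filter_upwards [h5, eventually_mem_nhdsWithin] with s' h13 h14 using hEq s' h14 h13
      simp only at h9
      rw [← hEq s hs h6] at h9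
      obtain ⟨-, h14, h15, -⟩ := h1 _ (hmem1 s hs)
      have h16 := (hγ s hs).2.2.2.2 hj
      -- The velocities `γ' s` and `r j (γ s)` are positive multiples of one vector and both have
      -- length one.
      rw [h12, norm_smul, Real.norm_eq_abs, abs_of_pos h7] at h16
      rw [h9, norm_smul, Real.norm_eq_abs, abs_of_pos h15] at h14
      have h17 : ‖curveVelocity W (φ j (γ s - γ 0), γ 0)‖ ≠ 0 := fun h => by
        rw [h, mul_zero] at h14; exact zero_ne_one h14
      rw [h12, h9, mul_right_cancel₀ h17 (h16.trans h14.symm)])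
    (fun x hx hP => by
      refine ⟨?_, IsHugoniot.of_frequently (hγ x hx).2.1.continuousWithinAt
        ((h2 _ (hmem2 x hx)).1.continuousAt j) (hP.mono fun s hs => hs.2)⟩
      have h3 : ContinuousWithinAt (fun s => S.r j (γ s)) I x :=
        ContinuousAt.comp_continuousWithinAt (g := S.r j) (h1 _ (hmem1 x hx)).2.2.2
          (hγ x hx).2.1.continuousWithinAt
      by_contra hne
      have h4 : ∀ᶠ s in 𝓝[I] x, γ' s - S.r j (γ s) ≠ 0 :=
        ((hγc x hx).sub h3).tendsto.eventually_ne (sub_ne_zero.2 hne)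
      obtain ⟨s, h5, h6⟩ := (hP.and_eventually h4).exists
      exact h6 (sub_eq_zero.2 h5.1))
  refine ⟨γ, rfl, rfl, fun s hs => ⟨(hγ s hs).1, ?_⟩⟩
  rw [← (hall s hs).1]
  exact (hγ s hs).2.1

/-- Shock and rarefaction curves coincide, so the flow of `r j` describes the Lax curve for both
signs, and the flow property makes all merges exact. -/
theorem IsFrame.exists_isLaxFamily_of_linearlyDegenerate (hS : S.Admissible)
    (hA : IsFrame S A vec val φ) (hj : S.LinearlyDegenerate j) :
    ∃ G L M, LipschitzWith L G ∧ (∀ q, ‖G q‖ ≤ M) ∧ IsLaxFamily S j G := by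
  obtain ⟨V, X, K, M, hX⟩ := hA.exists_isFieldFlow hS j
  obtain ⟨L, hL⟩ := hX.exists_lipschitz_flowVelocity
  refine ⟨_, L, M, hL, hX.norm_flowVelocity_le, ?_, ?_, ?_, ?_⟩
  · intro s₀ hs₀
    obtain ⟨R₁, hR₁, h1⟩ := hX.exists_flowMap_unique hA hs₀
    obtain ⟨R₂, hR₂, h2⟩ := hA.isRarefaction_of_isShock hS hj
    refine ⟨min R₁ R₂, by positivity, fun u w σ h => ?_⟩
    have h3 : S.IsRarefaction (Metric.ball 0 (min R₁ R₂)) j u σ w := by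
      rcases h with h | h
      · exact h.2
      · exact h2 _ (min_le_right _ _) _ _ _ h.1 h.2
    obtain ⟨h4, h5, h6⟩ := h1 u w σ (h3.mono (Metric.ball_subset_ball (min_le_left _ _)))
    exact ⟨h4, by rw [hX.flowMap_eq u h5, h6]⟩
  · intro ρ hρ
    have hnorm : ∀ᶠ u in 𝓝 (0 : State n), ‖S.r j u‖ = 1 :=
      (hS.eigenvector j).mono fun u hu => hu.2.2.2 hj
    filter_upwards [hX.exists_integralCurve hρ,
      eventually_forall_uIcc (hX.rankineHugoniot hS hA hj),
      eventually_forall_uIcc (hX.tendsto_zero.eventually hnorm)] with q h1 h2 h3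
    rw [hX.flowMap_eq _ h1.1]
    rcases le_or_gt 0 q.1 with hq | hq
    · exact Or.inl ⟨hq, fun s => X s q.2, hX.zero _, rfl,
        fun s hs => ⟨(h1.2 s hs).1, (h1.2 s hs).2.2⟩⟩
    · refine Or.inr ⟨hq, fun s => X s q.2, fun s => V (X s q.2), hX.zero _, rfl, ?_, ?_,
        fun s hs => ⟨(h1.2 s hs).1, ?_, ⟨_, h2 s hs⟩, fun h => absurd hj
          (hS.not_linearlyDegenerate h), fun _ => ?_⟩⟩
      · exact hX.lipschitz.continuous.comp_continuousOn
          fun s hs => (h1.2 s hs).2.2.continuousWithinAt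
      · have := (h1.2 0 left_mem_uIcc).2.1
        rw [hX.zero] at this
        simp only [hX.zero, this]
      · simp only [(h1.2 s hs).2.1]; exact (h1.2 s hs).2.2
      · simp only [(h1.2 s hs).2.1]; exact h3 s hs
  · filter_upwards [hX.eq_r] with u hu
    rw [hX.flowVelocity_zero, hu]
  · filter_upwards [eventually_abs_le_half] with q h1 _
    have h5 : |q.1 + q.2.1| ≤ 1 := (abs_add_le _ _).trans (by linarith [h1.1, h1.2])
    have h6 : |q.1| ≤ 1 := by linarith [h1.1]
    have h7 : |q.2.1| ≤ 1 := by linarith [h1.2]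
    rw [hX.flowMap_eq _ h6, hX.flowMap_eq _ h7, hX.flowMap_eq _ h5, hX.add _ h6 h7 h5]

theorem Admissible.exists_isLaxFamily (hS : S.Admissible) : ∃ (G : Fin n → ℝ × State n → State n)
    (L : ℝ≥0) (M : ℝ), (∀ j, LipschitzWith L (G j)) ∧ (∀ j q, ‖G j q‖ ≤ M) ∧
      ∀ j, IsLaxFamily S j (G j) := by
  obtain ⟨A, vec, val, φ, hA⟩ := hS.exists_isFrame
  have : ∀ j, ∃ G L M, LipschitzWith L G ∧ (∀ q, ‖G q‖ ≤ M) ∧ IsLaxFamily S j G := fun j => by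
    rcases hS.field j with hj | hj
    · exact hA.exists_isLaxFamily_of_genuinelyNonlinear hS hj
    · exact hA.exists_isLaxFamily_of_linearlyDegenerate hS hj
  choose G L M hL hM hG using this
  refine ⟨G, Finset.univ.sup L, ∑ j, |M j|, fun j => (hL j).weaken (Finset.le_sup (Finset.mem_univ j)),
    fun j q => (hM j q).trans ((le_abs_self _).trans
      (Finset.single_le_sum (f := fun j => |M j|) (fun i _ => abs_nonneg _) (Finset.mem_univ j))), hG⟩

end ConservationLaw

/-! ### Estimates for the displacements along Lipschitz velocities -/

section displacement

variable {n : ℕ} {G H : ℝ × State n → State n} {L : ℝ≥0} {M : ℝ}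

theorem dist_prodMk_left {u w : State n} (s : ℝ) : dist (s, u) (s, w) = ‖u - w‖ := by
  rw [Prod.dist_eq, dist_self, dist_eq_norm]
  exact max_eq_right (norm_nonneg _)

theorem dist_prodMk_right {u : State n} (s t : ℝ) : dist (s, u) (t, u) = |s - t| := by
  rw [Prod.dist_eq, dist_self, Real.dist_eq]
  exact max_eq_left (abs_nonneg _)

theorem continuous_slice (hG : LipschitzWith L G) (u : State n) : Continuous fun τ => G (τ, u) :=
  hG.continuous.comp (by fun_prop)

theorem flowMap_zero (u : State n) : flowMap G 0 u = u := by simp [flowMap]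

theorem norm_flowMap_sub_le (hM : ∀ q, ‖G q‖ ≤ M) (s : ℝ) (u : State n) :
    ‖flowMap G s u - u‖ ≤ M * |s| := by
  rw [flowMap, add_sub_cancel_left]
  simpa using intervalIntegral.norm_integral_le_of_norm_le_const (a := 0) (b := s)
    (f := fun τ => G (τ, u)) fun τ _ => hM _

theorem norm_flowMap_sub_flowMap_sub_le (hG : LipschitzWith L G) (s : ℝ) (u w : State n) :
    ‖flowMap G s u - flowMap G s w - (u - w)‖ ≤ L * |s| * ‖u - w‖ := by
  have h1 : flowMap G s u - flowMap G s w - (u - w) =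
      ∫ τ in (0 : ℝ)..s, (G (τ, u) - G (τ, w)) := by
    rw [intervalIntegral.integral_sub ((continuous_slice hG u).intervalIntegrable _ _)
      ((continuous_slice hG w).intervalIntegrable _ _), flowMap, flowMap]
    abel
  rw [h1]
  refine (intervalIntegral.norm_integral_le_of_norm_le_const (C := L * ‖u - w‖)
    fun τ _ => ?_).trans (le_of_eq ?_)
  · rw [← dist_eq_norm]
    exact (hG.dist_le_mul _ _).trans (le_of_eq (by rw [dist_prodMk_left]))
  · rw [sub_zero]; ring

theorem norm_flowMap_sub_flowMap_le (hG : LipschitzWith L G) (s : ℝ) (u w : State n) :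
    ‖flowMap G s u - flowMap G s w‖ ≤ (1 + L * |s|) * ‖u - w‖ := by
  have h := norm_flowMap_sub_flowMap_sub_le hG s u w
  have h2 := norm_sub_norm_le (flowMap G s u - flowMap G s w) (u - w)
  linarith

theorem norm_flowMap_sub_flowMap_time_le (hG : LipschitzWith L G) (s t : ℝ) (u : State n) :
    ‖flowMap G s u - flowMap G t u - (s - t) • G (0, u)‖ ≤ L * (|s| + |t|) * |s - t| := by
  have hc := continuous_slice hG u
  have h1 : flowMap G s u - flowMap G t u - (s - t) • G (0, u) =
      ∫ τ in t..s, (G (τ, u) - G (0, u)) := by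
    rw [intervalIntegral.integral_sub (hc.intervalIntegrable _ _)
      (continuous_const.intervalIntegrable _ _), intervalIntegral.integral_const, flowMap, flowMap,
      ← intervalIntegral.integral_add_adjacent_intervals (hc.intervalIntegrable 0 t)
      (hc.intervalIntegrable t s)]
    abel
  rw [h1]
  refine intervalIntegral.norm_integral_le_of_norm_le_const fun τ hτ => ?_
  rw [← dist_eq_norm]
  refine (hG.dist_le_mul _ _).trans (mul_le_mul_of_nonneg_left ?_ L.2)
  rw [dist_prodMk_right, sub_zero]
  have h2 : τ ∈ uIcc t s := uIoc_subset_uIcc hτ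
  rcases mem_uIcc.1 h2 with h | h
  · exact (abs_le_max_abs_abs h.1 h.2).trans (max_le (by linarith [abs_nonneg s])
      (by linarith [abs_nonneg t]))
  · exact (abs_le_max_abs_abs h.1 h.2).trans (max_le (by linarith [abs_nonneg t])
      (by linarith [abs_nonneg s]))

/-- After time `t` the two curves continue with the velocities `G (τ, flowMap G t u)` and `G (τ + t,
u)`, whose arguments differ by at most `(1 + M) |t|`; this is integrated over a time `|s|`. -/
theorem norm_flowMap_merge_le (hG : LipschitzWith L G) (hM : ∀ q, ‖G q‖ ≤ M) (s t : ℝ)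
    (u : State n) :
    ‖flowMap G s (flowMap G t u) - flowMap G (s + t) u‖ ≤ L * (1 + M) * (|s| * |t|) := by
  have hc := continuous_slice hG u
  have hc2 : Continuous fun τ => G (τ + t, u) := hc.comp (continuous_add_const t)
  have hM0 : 0 ≤ M := (norm_nonneg _).trans (hM 0)
  have h1 : flowMap G s (flowMap G t u) - flowMap G (s + t) u =
      ∫ τ in (0 : ℝ)..s, (G (τ, flowMap G t u) - G (τ + t, u)) := by
    rw [intervalIntegral.integral_sub ((continuous_slice hG _).intervalIntegrable _ _)
      (hc2.intervalIntegrable _ _),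
      intervalIntegral.integral_comp_add_right (fun τ => G (τ, u)) t, zero_add]
    have h2 := intervalIntegral.integral_add_adjacent_intervals
      (hc.intervalIntegrable (μ := volume) 0 t) (hc.intervalIntegrable t (s + t))
    have h3 : flowMap G s (flowMap G t u) =
      flowMap G t u + ∫ τ in (0 : ℝ)..s, G (τ, flowMap G t u) := rfl
    have h4 : flowMap G t u = u + ∫ τ in (0 : ℝ)..t, G (τ, u) := rfl
    have h5 : flowMap G (s + t) u = u + ∫ τ in (0 : ℝ)..(s + t), G (τ, u) := rfl
    rw [h3, h5, ← h2]
    nth_rewrite 1 [h4]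
    abel
  rw [h1]
  refine (intervalIntegral.norm_integral_le_of_norm_le_const (C := L * ((1 + M) * |t|))
    fun τ _ => ?_).trans (le_of_eq ?_)
  · rw [← dist_eq_norm]
    refine (hG.dist_le_mul _ _).trans (mul_le_mul_of_nonneg_left ?_ L.2)
    rw [Prod.dist_eq]
    refine max_le ?_ ?_
    · rw [Real.dist_eq, sub_add_cancel_left, abs_neg]
      nlinarith [abs_nonneg t]
    · rw [dist_eq_norm]
      refine (norm_flowMap_sub_le hM t u).trans ?_
      nlinarith [abs_nonneg t]
  · rw [sub_zero]; ring

/-- Each displacement changes by at most `L |s|` times the shift of its initial state, and the other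
displacement shifts that state by at most `M |t|`. No derivative of the velocities is needed. -/
theorem norm_flowMap_comm_le (hG : LipschitzWith L G) (hH : LipschitzWith L H)
    (hGM : ∀ q, ‖G q‖ ≤ M) (hHM : ∀ q, ‖H q‖ ≤ M) (s t : ℝ) (u : State n) :
    ‖flowMap G s (flowMap H t u) - flowMap H t (flowMap G s u)‖ ≤ 2 * L * M * (|s| * |t|) := by
  have h1 : flowMap G s (flowMap H t u) - flowMap H t (flowMap G s u) =
      (flowMap G s (flowMap H t u) - flowMap G s u - (flowMap H t u - u)) -
      (flowMap H t (flowMap G s u) - flowMap H t u - (flowMap G s u - u)) := by abel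
  rw [h1]
  refine (norm_sub_le _ _).trans ((add_le_add (norm_flowMap_sub_flowMap_sub_le hG _ _ _)
    (norm_flowMap_sub_flowMap_sub_le hH _ _ _)).trans ?_)
  have hL : (0 : ℝ) ≤ L := L.2
  have h2 := mul_le_mul_of_nonneg_left (norm_flowMap_sub_le hHM t u)
    (mul_nonneg hL (abs_nonneg s))
  have h3 := mul_le_mul_of_nonneg_left (norm_flowMap_sub_le hGM s u)
    (mul_nonneg hL (abs_nonneg t))
  refine (add_le_add h2 h3).trans (le_of_eq ?_)
  ring

/-- The Lipschitz bounds in the state and in the time leave errors with a factor that vanishes at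
the origin. Strict differentiability at this one point is all that the inverse function theorem
requires, although Lax curves need not be smoother. -/
theorem hasStrictFDerivAt_flowMap (hG : LipschitzWith L G) :
    HasStrictFDerivAt (fun q : ℝ × State n => flowMap G q.1 q.2)
      (ContinuousLinearMap.snd ℝ ℝ (State n) +
        (ContinuousLinearMap.fst ℝ ℝ (State n)).smulRight (G 0)) 0 := by
  rw [hasStrictFDerivAt_iff_isLittleO, Asymptotics.isLittleO_iff]
  intro c hc
  have hL : (0 : ℝ) ≤ L := L.2
  have hlim : Tendsto (fun p : (ℝ × State n) × (ℝ × State n) =>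
      L * |p.1.1| + L * (|p.1.1| + |p.2.1|) + L * ‖p.2.2‖) (𝓝 (0, 0)) (𝓝 0) :=
    (by fun_prop : Continuous fun p : (ℝ × State n) × (ℝ × State n) =>
      L * |p.1.1| + L * (|p.1.1| + |p.2.1|) + L * ‖p.2.2‖).tendsto' _ _ (by simp)
  filter_upwards [hlim.eventually_lt_const hc] with p hp
  have h1 := norm_flowMap_sub_flowMap_sub_le hG p.1.1 p.1.2 p.2.2
  have h2 := norm_flowMap_sub_flowMap_time_le hG p.1.1 p.2.1 p.2.2
  have h3 : ‖(p.1.1 - p.2.1) • (G (0, p.2.2) - G 0)‖ ≤ |p.1.1 - p.2.1| * (L * ‖p.2.2‖) := by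
    rw [norm_smul, Real.norm_eq_abs]
    refine mul_le_mul_of_nonneg_left ?_ (abs_nonneg _)
    rw [← dist_eq_norm]
    refine (hG.dist_le_mul _ _).trans (mul_le_mul_of_nonneg_left (le_of_eq ?_) hL)
    rw [Prod.zero_eq_mk, dist_prodMk_left, sub_zero]
  have h4 : ‖p.1.2 - p.2.2‖ ≤ ‖p.1 - p.2‖ := norm_snd_le (p.1 - p.2)
  have h5 : |p.1.1 - p.2.1| ≤ ‖p.1 - p.2‖ := norm_fst_le (p.1 - p.2)
  have h6 : flowMap G p.1.1 p.1.2 - flowMap G p.2.1 p.2.2 -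
      (ContinuousLinearMap.snd ℝ ℝ (State n) +
        (ContinuousLinearMap.fst ℝ ℝ (State n)).smulRight (G 0)) (p.1 - p.2) =
      (flowMap G p.1.1 p.1.2 - flowMap G p.1.1 p.2.2 - (p.1.2 - p.2.2)) +
      (flowMap G p.1.1 p.2.2 - flowMap G p.2.1 p.2.2 - (p.1.1 - p.2.1) • G (0, p.2.2)) +
      (p.1.1 - p.2.1) • (G (0, p.2.2) - G 0) := by
    simp [smul_sub]
    abel
  rw [h6]
  refine (norm_add₃_le).trans ((add_le_add (add_le_add h1 h2) h3).trans ?_)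
  have h7 := mul_le_mul_of_nonneg_left h4 (mul_nonneg hL (abs_nonneg p.1.1))
  have h8 := mul_le_mul_of_nonneg_left h5
    (mul_nonneg hL (add_nonneg (abs_nonneg p.1.1) (abs_nonneg p.2.1)))
  have h9 := mul_le_mul_of_nonneg_right h5 (mul_nonneg hL (norm_nonneg p.2.2))
  have h10 := mul_le_mul_of_nonneg_right hp.le (norm_nonneg (p.1 - p.2))
  linarith

end displacement

/-! ### Composition of displacements -/

section stage

variable {n : ℕ} {G : ℕ → ℝ × State n → State n} {L : ℝ≥0} {M : ℝ}

/-- The states reached from `u` by the first displacements along `G 0, G 1, …`, at the parameters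
`σ 0, σ 1, …`. -/
noncomputable def stage (G : ℕ → ℝ × State n → State n) (σ : ℕ → ℝ) (u : State n) : ℕ → State n
  | 0 => u
  | k + 1 => flowMap (G k) (σ k) (stage G σ u k)

theorem stage_congr {σ τ : ℕ → ℝ} {k : ℕ} (h : ∀ i < k, σ i = τ i) (u : State n) :
    stage G σ u k = stage G τ u k := by
  induction k with
  | zero => rfl
  | succ k ih => rw [stage, stage, ih fun i hi => h i (hi.trans (Nat.lt_succ_self k)),
      h k (Nat.lt_succ_self k)]

theorem stage_of_eq_zero {σ : ℕ → ℝ} (h : ∀ i, σ i = 0) (u : State n) (k : ℕ) :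
    stage G σ u k = u := by
  induction k with
  | zero => rfl
  | succ k ih => rw [stage, ih, h, flowMap_zero]

theorem norm_stage_sub_le (hM : ∀ k q, ‖G k q‖ ≤ M) (σ : ℕ → ℝ) (u : State n) (k : ℕ) :
    ‖stage G σ u k - u‖ ≤ M * ∑ i ∈ Finset.range k, |σ i| := by
  induction k with
  | zero => simp [stage]
  | succ k ih =>
    rw [Finset.sum_range_succ, mul_add, stage]
    have h := norm_flowMap_sub_le (hM k) (σ k) (stage G σ u k)
    have h2 := norm_add_le (flowMap (G k) (σ k) (stage G σ u k) - stage G σ u k)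
      (stage G σ u k - u)
    rw [sub_add_sub_cancel] at h2
    linarith

theorem norm_stage_sub_sum_le (hL : ∀ k, LipschitzWith L (G k)) (hM : ∀ k q, ‖G k q‖ ≤ M)
    (σ : ℕ → ℝ) (u : State n) (k : ℕ) :
    ‖stage G σ u k - u - ∑ i ∈ Finset.range k, σ i • G i (0, u)‖ ≤
      L * (1 + M) * (∑ i ∈ Finset.range k, |σ i|) ^ 2 := by
  induction k with
  | zero => simp [stage]
  | succ k ih =>
    have hM0 : 0 ≤ M := (norm_nonneg _).trans (hM 0 0)
    have hL0 : (0 : ℝ) ≤ L := L.2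
    rw [Finset.sum_range_succ, Finset.sum_range_succ, stage]
    set w := stage G σ u k
    set T := ∑ i ∈ Finset.range k, |σ i| with hT
    have hT0 : 0 ≤ T := Finset.sum_nonneg fun _ _ => abs_nonneg _
    have h1 := norm_flowMap_sub_flowMap_time_le (hL k) (σ k) 0 w
    rw [flowMap_zero, sub_zero, abs_zero, add_zero] at h1
    have h2 : ‖σ k • (G k (0, w) - G k (0, u))‖ ≤ |σ k| * (L * (M * T)) := by
      rw [norm_smul, Real.norm_eq_abs]
      refine mul_le_mul_of_nonneg_left ?_ (abs_nonneg _)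
      rw [← dist_eq_norm]
      refine ((hL k).dist_le_mul _ _).trans (mul_le_mul_of_nonneg_left ?_ hL0)
      rw [dist_prodMk_left]
      exact norm_stage_sub_le hM σ u k
    have h3 : flowMap (G k) (σ k) w - u -
        (∑ i ∈ Finset.range k, σ i • G i (0, u) + σ k • G k (0, u)) =
        (w - u - ∑ i ∈ Finset.range k, σ i • G i (0, u)) +
        (flowMap (G k) (σ k) w - w - σ k • G k (0, w)) + σ k • (G k (0, w) - G k (0, u)) := by
      rw [smul_sub]; abel
    rw [h3]
    refine norm_add₃_le.trans ((add_le_add (add_le_add ih h1) h2).trans ?_)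
    have h4 : 0 ≤ L * M * |σ k| ^ 2 := by positivity
    have h5 : 0 ≤ L * |σ k| * T * (2 + M) := by positivity
    nlinarith

/-- An extra wave `t` of family `k`, applied after the whole fan, is moved to its place. Commuting
it past the later wave `i` costs `2 L M |t| |σ i|`, merging it with the wave `k` costs `B`, and the
later displacements amplify errors by at most `1 + L` each. -/
theorem norm_stage_update_sub_le (hL : ∀ k, LipschitzWith L (G k)) (hM : ∀ k q, ‖G k q‖ ≤ M)
    {σ σ' : ℕ → ℝ} (hσ : ∀ i, |σ i| ≤ 1) {k : ℕ} {t B : ℝ} (hσ' : ∀ i, i ≠ k → σ' i = σ i)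
    (hk : σ' k = t + σ k) (u : State n) (hB0 : 0 ≤ B)
    (hB : ‖flowMap (G k) (t + σ k) (stage G σ u k) -
      flowMap (G k) t (flowMap (G k) (σ k) (stage G σ u k))‖ ≤ B) {m : ℕ} (hm : k + 1 ≤ m) :
    ‖stage G σ' u m - flowMap (G k) t (stage G σ u m)‖ ≤
      (1 + L) ^ m * (B + 2 * L * M * ∑ i ∈ Finset.Ico (k + 1) m, |t| * |σ i|) := by
  have hM0 : 0 ≤ M := (norm_nonneg _).trans (hM 0 0)
  have hL0 : (0 : ℝ) ≤ L := L.2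
  induction m, hm using Nat.le_induction with
  | base =>
    rw [stage, stage, hk, stage_congr (τ := σ) (fun i hi => hσ' i hi.ne)]
    refine hB.trans ?_
    rw [Finset.Ico_self, Finset.sum_empty, mul_zero, add_zero]
    exact le_mul_of_one_le_left hB0 (one_le_pow₀ (by linarith))
  | succ m hm ih =>
    rw [stage, stage, hσ' m (by lia), Finset.sum_Ico_succ_top hm]
    have h1 := norm_flowMap_sub_flowMap_le (hL m) (σ m) (stage G σ' u m)
      (flowMap (G k) t (stage G σ u m))
    have h2 := norm_flowMap_comm_le (hL m) (hL k) (hM m) (hM k) (σ m) t (stage G σ u m)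
    have h3 := norm_sub_le_norm_sub_add_norm_sub
      (flowMap (G m) (σ m) (stage G σ' u m))
      (flowMap (G m) (σ m) (flowMap (G k) t (stage G σ u m)))
      (flowMap (G k) t (flowMap (G m) (σ m) (stage G σ u m)))
    have h4 : (1 + L * |σ m|) * ‖stage G σ' u m - flowMap (G k) t (stage G σ u m)‖ ≤
        (1 + L) * ((1 + L) ^ m * (B + 2 * L * M * ∑ i ∈ Finset.Ico (k + 1) m, |t| * |σ i|)) := by
      refine mul_le_mul ?_ ih (norm_nonneg _) (by linarith)
      have := mul_le_mul_of_nonneg_left (hσ m) hL0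
      linarith
    have h5 : 2 * L * M * (|σ m| * |t|) ≤ (1 + L : ℝ) ^ (m + 1) * (2 * L * M * (|t| * |σ m|)) := by
      rw [mul_comm |σ m|]
      exact le_mul_of_one_le_left (by positivity) (one_le_pow₀ (by linarith))
    have h6 : (1 + L : ℝ) ^ (m + 1) = (1 + L) * (1 + L) ^ m := by ring
    rw [h6] at h5 ⊢
    linarith

/-- The waves of the second fan `τ` are absorbed into the first one in their order. After `k` of
them the strengths below `k` are sums and the others are still those of `σ`; each absorption is an
instance of the preceding estimate. -/
theorem norm_stage_stage_sub_le (hL : ∀ k, LipschitzWith L (G k)) (hM : ∀ k q, ‖G k q‖ ≤ M)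
    {σ τ : ℕ → ℝ} (hσ : ∀ i, |σ i| ≤ 1 / 2) (hτ : ∀ i, |τ i| ≤ 1 / 2) (u : State n) {δ : ℕ → ℝ}
    (hδ0 : ∀ k, 0 ≤ δ k)
    (hδ : ∀ k, ‖flowMap (G k) (τ k + σ k) (stage G (σ + τ) u k) -
      flowMap (G k) (τ k) (flowMap (G k) (σ k) (stage G (σ + τ) u k))‖ ≤ L * (1 + M) * δ k)
    {m k : ℕ} (hk : k ≤ m) :
    ‖stage G τ (stage G σ u m) k - stage G (fun i => if i < k then σ i + τ i else σ i) u m‖ ≤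
      (1 + L) ^ k * ∑ j ∈ Finset.range k, (1 + L) ^ m * (2 * L * (1 + M) *
        (δ j + ∑ i ∈ Finset.Ico (j + 1) m, |τ j| * |σ i|)) := by
  have hM0 : 0 ≤ M := (norm_nonneg _).trans (hM 0 0)
  have hL0 : (0 : ℝ) ≤ L := L.2
  induction k with
  | zero => simp [stage]
  | succ k ih =>
    have ih := ih (Nat.le_of_succ_le hk)
    set ρ : ℕ → ℝ := fun i => if i < k then σ i + τ i else σ i with hρ
    set ρ' : ℕ → ℝ := fun i => if i < k + 1 then σ i + τ i else σ i with hρ'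
    have hρ1 : ∀ i, |ρ i| ≤ 1 := fun i => by
      simp only [hρ]
      split_ifs
      · exact (abs_add_le _ _).trans (by linarith [hσ i, hτ i])
      · linarith [hσ i]
    -- The first `k` waves are already merged, so the next merge takes place at a state of the fan
    -- `σ + τ`, as in the hypothesis on `δ`.
    have hst : stage G ρ u k = stage G (σ + τ) u k := stage_congr (fun i hi => by
      simp [hρ, hi]) u
    have hρk : ρ k = σ k := by simp [hρ]
    have h1 := norm_stage_update_sub_le hL hM hρ1 (σ' := ρ') (k := k) (t := τ k)
      (B := L * (1 + M) * δ k) (fun i hi => by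
        simp only [hρ, hρ']
        have : i < k + 1 ↔ i < k := by lia
        simp only [this]) (by simp [hρ', hρk, add_comm]) u (by have := hδ0 k; positivity)
      (by rw [hst, hρk]; exact hδ k) hk
    have h2 : ∑ i ∈ Finset.Ico (k + 1) m, |τ k| * |ρ i| =
        ∑ i ∈ Finset.Ico (k + 1) m, |τ k| * |σ i| := Finset.sum_congr rfl fun i hi => by
      have : ¬ i < k := by have := (Finset.mem_Ico.1 hi).1; lia
      simp [hρ, this]
    rw [h2] at h1
    have h3 := norm_flowMap_sub_flowMap_le (hL k) (τ k) (stage G τ (stage G σ u m) k)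
      (stage G ρ u m)
    rw [stage]
    have h4 := norm_sub_le_norm_sub_add_norm_sub
      (flowMap (G k) (τ k) (stage G τ (stage G σ u m) k))
      (flowMap (G k) (τ k) (stage G ρ u m)) (stage G ρ' u m)
    rw [norm_sub_rev (flowMap (G k) (τ k) (stage G ρ u m))] at h4
    have h5 : (1 + L * |τ k|) * ‖stage G τ (stage G σ u m) k - stage G ρ u m‖ ≤
        (1 + L) * ((1 + L) ^ k * ∑ j ∈ Finset.range k, (1 + L) ^ m * (2 * L * (1 + M) *
        (δ j + ∑ i ∈ Finset.Ico (j + 1) m, |τ j| * |σ i|))) := by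
      refine mul_le_mul ?_ ih (norm_nonneg _) (by linarith)
      have := mul_le_mul_of_nonneg_left (hτ k) hL0
      linarith
    set P := ∑ i ∈ Finset.Ico (k + 1) m, |τ k| * |σ i| with hP
    have hP0 : 0 ≤ P := Finset.sum_nonneg fun _ _ => by positivity
    have h6 : (1 + L : ℝ) ^ m * (L * (1 + M) * δ k + 2 * L * M * P) ≤
        (1 + L) ^ (k + 1) * ((1 + L) ^ m * (2 * L * (1 + M) * (δ k + P))) := by
      have h7 : L * (1 + M) * δ k + 2 * L * M * P ≤ 2 * L * (1 + M) * (δ k + P) := by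
        have h8 : 0 ≤ L * (1 + M) * δ k := by have := hδ0 k; positivity
        have h9 : 0 ≤ L * P := by positivity
        nlinarith
      have h10 : (1 : ℝ) ≤ (1 + L) ^ (k + 1) := one_le_pow₀ (by linarith)
      refine (mul_le_mul_of_nonneg_left h7 (by positivity)).trans
        (le_mul_of_one_le_left ?_ h10)
      have := hδ0 k
      positivity
    rw [Finset.sum_range_succ, mul_add]
    have h11 : (1 + L : ℝ) ^ (k + 1) = (1 + L) * (1 + L) ^ k := by ring
    have h12 : (1 + L : ℝ) ^ (k + 1) * ∑ j ∈ Finset.range k, (1 + L) ^ m * (2 * L * (1 + M) *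
        (δ j + ∑ i ∈ Finset.Ico (j + 1) m, |τ j| * |σ i|)) =
        (1 + L) * ((1 + L) ^ k * ∑ j ∈ Finset.range k, (1 + L) ^ m * (2 * L * (1 + M) *
        (δ j + ∑ i ∈ Finset.Ico (j + 1) m, |τ j| * |σ i|))) := by rw [h11, mul_assoc]
    rw [h12]
    linarith

end stage

/-! ### Wave fans -/

section zeroExtend

variable {n : ℕ} {α : Type*} [Zero α]

/-- The extension by zero of a finite sequence. -/
def zeroExtend (σ : Fin n → α) (k : ℕ) : α := if h : k < n then σ ⟨k, h⟩ else 0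

theorem zeroExtend_val (σ : Fin n → α) (i : Fin n) : zeroExtend σ i = σ i := by
  simp [zeroExtend]

theorem zeroExtend_of_le (σ : Fin n → α) {k : ℕ} (h : n ≤ k) : zeroExtend σ k = 0 := by
  simp [zeroExtend, h]

theorem zeroExtend_induction {P : ℕ → α → Prop} (σ : Fin n → α) (h : ∀ i : Fin n, P i (σ i))
    (h0 : ∀ k, n ≤ k → P k 0) (k : ℕ) : P k (zeroExtend σ k) := by
  by_cases hk : k < n
  · have := h ⟨k, hk⟩
    rwa [← zeroExtend_val σ ⟨k, hk⟩] at this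
  · rw [zeroExtend_of_le σ (not_lt.1 hk)]; exact h0 k (not_lt.1 hk)

end zeroExtend

theorem zeroExtend_add {n : ℕ} (σ τ : Fin n → ℝ) :
    zeroExtend (σ + τ) = zeroExtend σ + zeroExtend τ := by
  ext k
  simp only [zeroExtend, Pi.add_apply]
  split_ifs <;> simp

/-- A lower bound for the interaction of two wave fans by the products of the strengths. -/
theorem sum_le_interaction {n : ℕ} (J : Finset (Fin n)) (σ τ δ : Fin n → ℝ)
    (hδ : ∀ j, δ j ≤ |τ j| * |σ j|) (hδ0 : ∀ j, j ∉ J ∨ 0 ≤ τ j ∧ 0 ≤ σ j → δ j ≤ 0) :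
    ∑ j, (δ j + ∑ i ∈ Finset.univ.filter (j < ·), |τ j| * |σ i|) ≤ interaction J σ τ := by
  rw [interaction, sum_approachingParts J fun p q => part p σ * part q τ, Finset.sum_add_distrib,
    add_comm]
  refine add_le_add (le_of_eq ?_) ?_
  · rw [Finset.sum_comm' (t' := Finset.univ) (s' := fun i => Finset.univ.filter (· < i))
      (by simp)]
    refine Finset.sum_congr rfl fun i _ => Finset.sum_congr rfl fun j _ => ?_
    rw [← part_true_add_part_false i σ, ← part_true_add_part_false j τ]
    ring
  · calc ∑ j, δ j ≤ ∑ j ∈ J, δ j := by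
          rw [← Finset.sum_add_sum_compl J δ]
          have := Finset.sum_nonpos (s := Jᶜ) (f := δ)
            fun j hj => hδ0 j (Or.inl (Finset.mem_compl.1 hj))
          linarith
      _ ≤ _ := Finset.sum_le_sum fun j _ => by
          have h1 := part_nonneg (true, j) σ
          have h2 := part_nonneg (false, j) σ
          have h3 := part_nonneg (true, j) τ
          have h4 := part_nonneg (false, j) τ
          by_cases h : 0 ≤ τ j ∧ 0 ≤ σ j
          · exact (hδ0 j (Or.inr h)).trans (by positivity)
          · refine (hδ j).trans ?_
            rw [← part_true_add_part_false j σ, ← part_true_add_part_false j τ]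
            -- Not both strengths are nonnegative, so the product of the positive parts vanishes;
            -- the three remaining products are those counted for `j ∈ J`.
            have h5 : part (true, j) σ * part (true, j) τ = 0 := by
              simp only [part, if_true]
              rcases not_and_or.1 h with h | h
              · rw [max_eq_right (not_le.1 h).le, mul_zero]
              · rw [max_eq_right (not_le.1 h).le, zero_mul]
            linarith

section waveMap

variable {n : ℕ} {G : Fin n → ℝ × State n → State n} {L : ℝ≥0} {M : ℝ}

/-- The state on the right of a wave fan `σ`, if `u` is the state on its left. -/
noncomputable def waveMap (G : Fin n → ℝ × State n → State n) (σ : Fin n → ℝ) (u : State n) :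
    State n :=
  stage (zeroExtend G) (zeroExtend σ) u n

theorem waveMap_zero (u : State n) : waveMap G 0 u = u :=
  stage_of_eq_zero (zeroExtend_induction (P := fun _ s => s = 0) 0 (fun _ => rfl) fun _ _ => rfl) _ _

theorem lipschitzWith_zeroExtend (hL : ∀ j, LipschitzWith L (G j)) (k : ℕ) :
    LipschitzWith L (zeroExtend G k) :=
  zeroExtend_induction (P := fun _ g => LipschitzWith L g) G hL
    (fun _ _ => (LipschitzWith.const (0 : State n)).weaken (zero_le)) k

theorem norm_zeroExtend_le (hM0 : 0 ≤ M) (hM : ∀ j q, ‖G j q‖ ≤ M) (k : ℕ) (q : ℝ × State n) :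
    ‖zeroExtend G k q‖ ≤ M :=
  zeroExtend_induction (P := fun _ g => ‖g q‖ ≤ M) G (fun j => hM j q)
    (fun _ _ => by simpa using hM0) k

theorem norm_waveMap_sub_le (hM0 : 0 ≤ M) (hM : ∀ j q, ‖G j q‖ ≤ M) (σ : Fin n → ℝ)
    (u : State n) : ‖waveMap G σ u - u‖ ≤ M * ∑ i, |σ i| := by
  have h := norm_stage_sub_le (norm_zeroExtend_le hM0 hM) (zeroExtend σ) u n
  simpa only [Finset.sum_range, zeroExtend_val, waveMap] using h

theorem norm_waveMap_sub_sum_le (hL : ∀ j, LipschitzWith L (G j)) (hM0 : 0 ≤ M)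
    (hM : ∀ j q, ‖G j q‖ ≤ M) (σ : Fin n → ℝ) (u : State n) :
    ‖waveMap G σ u - u - ∑ i, σ i • G i (0, u)‖ ≤ L * (1 + M) * (∑ i, |σ i|) ^ 2 := by
  have h := norm_stage_sub_sum_le (lipschitzWith_zeroExtend hL) (norm_zeroExtend_le hM0 hM)
    (zeroExtend σ) u n
  simpa only [Finset.sum_range, zeroExtend_val, waveMap] using h

/-- Commutations cost `|τ j| |σ i|` with `j < i`, a wave of the left fan that is faster than one of
the right fan. Merges cost `|τ j| |σ j|` unless they are exact. These are precisely the approaching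
pairs, so the total error is a multiple of the amount of interaction. -/
theorem norm_waveMap_waveMap_sub_le (hL : ∀ j, LipschitzWith L (G j)) (hM0 : 0 ≤ M)
    (hM : ∀ j q, ‖G j q‖ ≤ M) (J : Finset (Fin n)) {σ τ : Fin n → ℝ} {u : State n}
    (hσ : ∀ i, |σ i| ≤ 1 / 2) (hτ : ∀ i, |τ i| ≤ 1 / 2)
    (hmerge : ∀ j, j ∉ J ∨ 0 ≤ τ j ∧ 0 ≤ σ j →
      flowMap (G j) (τ j) (flowMap (G j) (σ j) (stage (zeroExtend G) (zeroExtend (σ + τ)) u j)) =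
      flowMap (G j) (τ j + σ j) (stage (zeroExtend G) (zeroExtend (σ + τ)) u j)) :
    ‖waveMap G τ (waveMap G σ u) - waveMap G (σ + τ) u‖ ≤
      (1 + L) ^ n * ((1 + L) ^ n * (2 * L * (1 + M))) * interaction J σ τ := by
  classical
  set δ : Fin n → ℝ := fun j => if j ∉ J ∨ 0 ≤ τ j ∧ 0 ≤ σ j then 0 else |τ j| * |σ j| with hδ
  have hδ0 : ∀ j, 0 ≤ δ j := fun j => by simp only [hδ]; split_ifs <;> positivity
  have hL0 : (0 : ℝ) ≤ L := L.2
  have h := norm_stage_stage_sub_le (lipschitzWith_zeroExtend hL) (norm_zeroExtend_le hM0 hM)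
    (σ := zeroExtend σ) (τ := zeroExtend τ) (δ := zeroExtend δ)
    (zeroExtend_induction (P := fun _ s => |s| ≤ 1 / 2) σ hσ (fun _ _ => by norm_num))
    (zeroExtend_induction (P := fun _ s => |s| ≤ 1 / 2) τ hτ (fun _ _ => by norm_num)) u
    (zeroExtend_induction (P := fun _ s => 0 ≤ s) δ hδ0 (fun _ _ => le_rfl))
    (fun k => by
      by_cases hk : k < n
      · have h1 := zeroExtend_val G ⟨k, hk⟩
        have h2 := zeroExtend_val σ ⟨k, hk⟩
        have h3 := zeroExtend_val τ ⟨k, hk⟩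
        have h4 := zeroExtend_val δ ⟨k, hk⟩
        simp only at h1 h2 h3 h4
        rw [h1, h2, h3, h4, ← zeroExtend_add, norm_sub_rev]
        by_cases hj : (⟨k, hk⟩ : Fin n) ∉ J ∨ 0 ≤ τ ⟨k, hk⟩ ∧ 0 ≤ σ ⟨k, hk⟩
        · have h5 := hmerge ⟨k, hk⟩ hj
          simp only at h5
          rw [h5, sub_self, norm_zero]
          have := hδ0 ⟨k, hk⟩
          positivity
        · have h6 : δ ⟨k, hk⟩ = |τ ⟨k, hk⟩| * |σ ⟨k, hk⟩| := if_neg hj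
          rw [h6]
          exact norm_flowMap_merge_le (hL _) (hM _) _ _ _
      · have hk := not_lt.1 hk
        rw [zeroExtend_of_le σ hk, zeroExtend_of_le τ hk, zeroExtend_of_le δ hk, add_zero,
          flowMap_zero, flowMap_zero, sub_self, norm_zero, mul_zero]) (le_refl n)
  have h1 : stage (zeroExtend G)
      (fun i => if i < n then zeroExtend σ i + zeroExtend τ i else zeroExtend σ i) u n =
      waveMap G (σ + τ) u := stage_congr (fun i hi => by
        rw [if_pos hi, zeroExtend_add]; rfl) u
  rw [h1] at h
  refine h.trans ?_
  rw [← Finset.mul_sum, ← Finset.mul_sum]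
  have h2 : ∑ j ∈ Finset.range n, (zeroExtend δ j + ∑ i ∈ Finset.Ico (j + 1) n,
      |zeroExtend τ j| * |zeroExtend σ i|) =
      ∑ j, (δ j + ∑ i ∈ Finset.univ.filter (j < ·), |τ j| * |σ i|) := by
    rw [Finset.sum_range]
    refine Finset.sum_congr rfl fun j _ => ?_
    rw [zeroExtend_val, zeroExtend_val]
    congr 1
    have h3 : Finset.Ico ((j : ℕ) + 1) n = (Finset.range n).filter ((j : ℕ) < ·) := by
      ext i; simp; lia
    rw [h3, Finset.sum_filter, Finset.sum_range, Finset.sum_filter]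
    refine Finset.sum_congr rfl fun i _ => ?_
    simp only [zeroExtend_val, Fin.lt_def]
  rw [h2]
  have h3 := sum_le_interaction J σ τ δ (fun j => by
    simp only [hδ]; split_ifs
    · positivity
    · exact le_rfl) (fun j hj => by simp only [hδ]; rw [if_pos hj])
  calc _ = (1 + L) ^ n * ((1 + L) ^ n * (2 * L * (1 + M))) *
        ∑ j, (δ j + ∑ i ∈ Finset.univ.filter (j < ·), |τ j| * |σ i|) := by ring
    _ ≤ _ := mul_le_mul_of_nonneg_left h3 (by positivity)

/-- The evaluation of `zeroExtend`. -/
noncomputable def evalExtend (n k : ℕ) : (Fin n → ℝ) →L[ℝ] ℝ :=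
  if h : k < n then ContinuousLinearMap.proj ⟨k, h⟩ else 0

theorem evalExtend_apply (k : ℕ) (σ : Fin n → ℝ) : evalExtend n k σ = zeroExtend σ k := by
  simp only [evalExtend, zeroExtend]
  split_ifs <;> simp

theorem hasStrictFDerivAt_stage (hL : ∀ j, LipschitzWith L (G j)) (k : ℕ) :
    HasStrictFDerivAt
      (fun p : (Fin n → ℝ) × State n => stage (zeroExtend G) (zeroExtend p.1) p.2 k)
      (ContinuousLinearMap.snd ℝ (Fin n → ℝ) (State n) + ∑ i ∈ Finset.range k,
        ((evalExtend n i).comp (ContinuousLinearMap.fst ℝ (Fin n → ℝ) (State n))).smulRight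
          (zeroExtend G i 0)) 0 := by
  induction k with
  | zero =>
    rw [Finset.range_zero, Finset.sum_empty, add_zero]
    exact hasStrictFDerivAt_snd (𝕜 := ℝ) (p := (0 : (Fin n → ℝ) × State n))
  | succ k ih =>
    have h1 := ((evalExtend n k).comp
      (ContinuousLinearMap.fst ℝ (Fin n → ℝ) (State n))).hasStrictFDerivAt (x := 0)
    have h2 := h1.prodMk ih
    have h3 := hasStrictFDerivAt_flowMap (lipschitzWith_zeroExtend hL k)
    have h0 : (((evalExtend n k).comp (ContinuousLinearMap.fst ℝ (Fin n → ℝ) (State n))) 0,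
        stage (zeroExtend G) (zeroExtend (0 : (Fin n → ℝ) × State n).1)
          (0 : (Fin n → ℝ) × State n).2 k) = (0 : ℝ × State n) := by
      have h4 : stage (zeroExtend G) (zeroExtend (0 : (Fin n → ℝ) × State n).1)
          (0 : (Fin n → ℝ) × State n).2 k = 0 := stage_of_eq_zero
        (zeroExtend_induction (P := fun _ s => s = 0) 0 (fun _ => rfl) fun _ _ => rfl) _ _
      rw [map_zero, h4]; rfl
    have h5 : HasStrictFDerivAt (fun q : ℝ × State n => flowMap (zeroExtend G k) q.1 q.2)
      (ContinuousLinearMap.snd ℝ ℝ (State n) +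
        (ContinuousLinearMap.fst ℝ ℝ (State n)).smulRight (zeroExtend G k 0))
      (((evalExtend n k).comp (ContinuousLinearMap.fst ℝ (Fin n → ℝ) (State n))) 0,
        stage (zeroExtend G) (zeroExtend (0 : (Fin n → ℝ) × State n).1)
          (0 : (Fin n → ℝ) × State n).2 k) := by rw [h0]; exact h3
    have h6 := h5.comp (0 : (Fin n → ℝ) × State n) h2
    have h7 : (fun p : (Fin n → ℝ) × State n =>
        stage (zeroExtend G) (zeroExtend p.1) p.2 (k + 1)) =
        (fun q : ℝ × State n => flowMap (zeroExtend G k) q.1 q.2) ∘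
        (fun p : (Fin n → ℝ) × State n =>
          (((evalExtend n k).comp (ContinuousLinearMap.fst ℝ (Fin n → ℝ) (State n))) p,
            stage (zeroExtend G) (zeroExtend p.1) p.2 k)) := by
      ext1 p
      simp [stage, evalExtend_apply]
    rw [h7]
    refine h6.congr_fderiv ?_
    rw [Finset.sum_range_succ, ← add_assoc]
    rfl

theorem tendsto_stage (hL : ∀ j, LipschitzWith L (G j)) (k : ℕ) :
    Tendsto (fun p : (Fin n → ℝ) × State n => stage (zeroExtend G) (zeroExtend p.1) p.2 k)
      (𝓝 0) (𝓝 0) := by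
  have h := (hasStrictFDerivAt_stage hL k).continuousAt.tendsto
  have h4 : stage (zeroExtend G) (zeroExtend (0 : (Fin n → ℝ) × State n).1)
      (0 : (Fin n → ℝ) × State n).2 k = 0 := stage_of_eq_zero
    (zeroExtend_induction (P := fun _ s => s = 0) 0 (fun _ => rfl) fun _ _ => rfl) _ _
  rwa [h4] at h

/-- `h` is a local inverse of the wave fans: `h (a, b)` are the strengths of the waves between `a`
and `b`. -/
structure IsWaveStrength (G : Fin n → ℝ × State n → State n)
    (h : State n × State n → Fin n → ℝ) (K : ℝ≥0) : Prop where
  tendsto : Tendsto h (𝓝 0) (𝓝 0)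
  left_inv : ∀ᶠ p in 𝓝 (0 : (Fin n → ℝ) × State n), h (p.2, waveMap G p.1 p.2) = p.1
  right_inv : ∀ᶠ q in 𝓝 (0 : State n × State n), waveMap G (h q) q.1 = q.2
  lipschitz : ∃ s ∈ 𝓝 (0 : State n × State n), LipschitzOnWith K h s

/-- The inverse function theorem for `(σ, u) ↦ (u, waveMap G σ u)`: its strict derivative at the
origin sends `(σ, u)` to `(u, u + ∑ σᵢ rᵢ(0))`, which is invertible because the eigenvectors form a
basis. -/
theorem exists_isWaveStrength (hL : ∀ j, LipschitzWith L (G j)) {φ : Fin n → State n →L[ℝ] ℝ}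
    (hφ : ∀ i j, φ i (G j 0) = if i = j then 1 else 0) (hexp : ∀ x, x = ∑ i, φ i x • G i 0) :
    ∃ h K, IsWaveStrength G h K := by
  set D := ContinuousLinearMap.snd ℝ (Fin n → ℝ) (State n) + ∑ i ∈ Finset.range n,
    ((evalExtend n i).comp (ContinuousLinearMap.fst ℝ (Fin n → ℝ) (State n))).smulRight
      (zeroExtend G i 0) with hD
  have hDa : ∀ p, D p = p.2 + ∑ i, p.1 i • G i 0 := fun p => by
    simp [hD, Finset.sum_range, evalExtend_apply, zeroExtend_val]
  set T : ((Fin n → ℝ) × State n) ≃L[ℝ] (State n × State n) :=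
    ContinuousLinearEquiv.equivOfInverse
      ((ContinuousLinearMap.snd ℝ (Fin n → ℝ) (State n)).prod D)
      ((ContinuousLinearMap.pi fun i => (φ i).comp
        (ContinuousLinearMap.snd ℝ (State n) (State n) -
          ContinuousLinearMap.fst ℝ (State n) (State n))).prod
        (ContinuousLinearMap.fst ℝ (State n) (State n)))
      (fun p => by
        refine Prod.ext (funext fun i => ?_) rfl
        simp [hDa, hφ])
      (fun q => by
        refine Prod.ext rfl ?_
        have := hexp (q.2 - q.1)
        simp only [ContinuousLinearMap.prod_apply, hDa]
        simp only [ContinuousLinearMap.coe_fst', ContinuousLinearMap.coe_pi',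
          ContinuousLinearMap.comp_apply, sub_apply,
          ContinuousLinearMap.coe_snd']
        rw [← this, add_sub_cancel]) with hT
  have hF : HasStrictFDerivAt (fun p : (Fin n → ℝ) × State n => (p.2, waveMap G p.1 p.2))
      (T : ((Fin n → ℝ) × State n) →L[ℝ] (State n × State n)) 0 :=
    (hasStrictFDerivAt_snd (p := (0 : (Fin n → ℝ) × State n))).prodMk (hasStrictFDerivAt_stage hL n)
  have hF0 : (((0 : (Fin n → ℝ) × State n)).2,
      waveMap G (0 : (Fin n → ℝ) × State n).1 (0 : (Fin n → ℝ) × State n).2) = 0 := by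
    have : waveMap G (0 : (Fin n → ℝ) × State n).1 (0 : (Fin n → ℝ) × State n).2 = 0 :=
      waveMap_zero _
    rw [this]; rfl
  obtain ⟨K, s, hs, hK⟩ := hF.to_localInverse.exists_lipschitzOnWith
  have h1 := hF.eventually_left_inverse
  have h2 := hF.eventually_right_inverse
  have h3 := hF.localInverse_tendsto
  rw [hF0] at hs h2 h3
  refine ⟨fun q => (hF.localInverse _ _ _ q).1, K, ?_, ?_, ?_, s, hs, ?_⟩
  · exact (continuous_fst.tendsto _).comp h3
  · exact h1.mono fun p hp => by rw [hp]
  · filter_upwards [h2] with q hq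
    have h4 := congrArg Prod.fst hq
    have h5 := congrArg Prod.snd hq
    simp only at h4 h5
    rwa [h4] at h5
  · have := LipschitzWith.prod_fst.comp_lipschitzOnWith hK
    rwa [one_mul] at this

end waveMap

namespace ConservationLaw

variable {n : ℕ} {S : ConservationLaw n} {G : Fin n → ℝ × State n → State n} {L : ℝ≥0} {M : ℝ}

/-! ### Left eigenvectors -/

theorem norm_le_sum_inner {φ : Fin n → State n →L[ℝ] ℝ} {e : Fin n → State n}
    (hexp : ∀ x, x = ∑ i, φ i x • e i) (x : State n) :
    ‖x‖ ≤ (∑ i, ‖φ i‖) * ∑ i, |inner ℝ x (e i)| := by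
  rcases eq_or_ne x 0 with rfl | hx
  · rw [norm_zero]; positivity
  have h1 : ‖x‖ * ‖x‖ ≤ ‖x‖ * ((∑ i, ‖φ i‖) * ∑ i, |inner ℝ x (e i)|) := by
    calc ‖x‖ * ‖x‖ = inner ℝ x x := (real_inner_self_eq_norm_mul_norm x).symm
      _ = inner ℝ x (∑ i, φ i x • e i) := by rw [← hexp x]
      _ = ∑ i, φ i x * inner ℝ x (e i) := by
          rw [inner_sum]; exact Finset.sum_congr rfl fun i _ => inner_smul_right _ _ _
      _ ≤ ∑ i, ((∑ k, ‖φ k‖) * ‖x‖) * |inner ℝ x (e i)| := by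
          refine Finset.sum_le_sum fun i _ => (le_abs_self _).trans ?_
          rw [abs_mul]
          refine mul_le_mul_of_nonneg_right (((φ i).le_opNorm x).trans ?_) (abs_nonneg _)
          exact mul_le_mul_of_nonneg_right (Finset.single_le_sum (f := fun k => ‖φ k‖)
            (fun _ _ => norm_nonneg _) (Finset.mem_univ i)) (norm_nonneg _)
      _ = _ := by rw [← Finset.mul_sum]; ring
  exact le_of_mul_le_mul_left h1 (norm_pos_iff.2 hx)

/-- A quantitative form of the independence of the eigenvectors: near the origin their change is
absorbed into the left side, which doubles the constant. -/
theorem Admissible.exists_norm_le (hS : S.Admissible) : ∃ c, 0 ≤ c ∧ ∀ᶠ u in 𝓝 (0 : State n),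
    ∀ x : State n, ‖x‖ ≤ c * ∑ i, |inner ℝ x (S.r i u)| := by
  obtain ⟨φ, -, hexp⟩ := hS.exists_dual
  set c := ∑ i, ‖φ i‖
  have hc : 0 ≤ c := Finset.sum_nonneg fun _ _ => norm_nonneg _
  refine ⟨2 * c, by positivity, ?_⟩
  have h1 : Tendsto (fun u => c * ∑ i, ‖S.r i u - S.r i 0‖) (𝓝 0) (𝓝 0) := by
    have : Tendsto (fun u => c * ∑ i, ‖S.r i u - S.r i 0‖) (𝓝 0)
        (𝓝 (c * ∑ i, ‖S.r i 0 - S.r i 0‖)) :=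
      (tendsto_finsetSum _ fun i _ =>
        (((hS.eigenvector i).self_of_nhds.1.tendsto).sub_const _).norm).const_mul c
    simpa using this
  filter_upwards [h1.eventually_lt_const (show (0 : ℝ) < 1 / 2 by norm_num)] with u hu x
  have h2 := norm_le_sum_inner hexp x
  have h3 : ∑ i, |inner ℝ x (S.r i 0)| ≤
      ∑ i, |inner ℝ x (S.r i u)| + ‖x‖ * ∑ i, ‖S.r i u - S.r i 0‖ := by
    rw [Finset.mul_sum, ← Finset.sum_add_distrib]
    refine Finset.sum_le_sum fun i _ => ?_
    have h4 : inner ℝ x (S.r i 0) = inner ℝ x (S.r i u) - inner ℝ x (S.r i u - S.r i 0) := by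
      rw [inner_sub_right]; ring
    rw [h4]
    exact (abs_sub _ _).trans (add_le_add_right (abs_real_inner_le_norm _ _) _)
  have h5 := mul_le_mul_of_nonneg_left h3 hc
  have h6 := mul_le_mul_of_nonneg_left hu.le (norm_nonneg x)
  linarith

/-- The bound excludes a nonzero vector orthogonal to all columns, so the matrix of the eigenvectors
is invertible and its inverse is a genuine one. -/
theorem inner_l_r {u : State n} {c : ℝ}
    (h : ∀ x : State n, ‖x‖ ≤ c * ∑ i, |inner ℝ x (S.r i u)|) (i j : Fin n) :
    inner ℝ (S.l i u) (S.r j u) = if i = j then (1 : ℝ) else 0 := by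
  set N : Matrix (Fin n) (Fin n) ℝ := Matrix.of fun a j => S.r j u a with hN
  have hinner : ∀ (v : Fin n → ℝ) (j : Fin n),
      inner ℝ (WithLp.toLp 2 v : State n) (S.r j u) = Matrix.vecMul v N j := fun v j => by
    rw [PiLp.inner_apply, Matrix.vecMul, dotProduct]
    refine Finset.sum_congr rfl fun a _ => ?_
    simp [hN, mul_comm]
  have hdet : IsUnit N.det := by
    rw [isUnit_iff_ne_zero]
    intro h0
    obtain ⟨v, hv, hv0⟩ := Matrix.exists_vecMul_eq_zero_iff.2 h0
    have h1 := h (WithLp.toLp 2 v)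
    simp only [hinner, hv0, Pi.zero_apply, abs_zero, Finset.sum_const_zero, mul_zero] at h1
    exact hv ((WithLp.toLp_eq_zero 2).1 (norm_le_zero_iff.1 h1))
  have h2 : Matrix.vecMul (N⁻¹ i) N j = (N⁻¹ * N) i j := rfl
  rw [l, hinner, h2, Matrix.nonsing_inv_mul N hdet, Matrix.one_apply]

theorem Admissible.exists_left (hS : S.Admissible) (hL : ∀ j, LipschitzWith L (G j))
    (hG : ∀ j, IsLaxFamily S j (G j)) : ∃ c, 0 ≤ c ∧ ∃ η > 0, ∀ a ∈ Metric.ball (0 : State n) η,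
      (∀ i j, inner ℝ (S.l i a) (G j (0, a)) = if i = j then (1 : ℝ) else 0) ∧
      (∀ i, ‖S.l i a‖ ≤ c) ∧
      ∀ b ∈ Metric.ball (0 : State n) η, ∀ i, ‖S.l i a - S.l i b‖ ≤ c * ‖a - b‖ := by
  obtain ⟨c, hc, h⟩ := hS.exists_norm_le
  have h0 : ∀ᶠ u in 𝓝 (0 : State n), ∀ j, G j (0, u) = S.r j u :=
    eventually_all.2 fun j => (hG j).zero
  obtain ⟨η, hη, h1⟩ := exists_ball_of_eventually (h.and h0)
  have hl : ∀ a ∈ Metric.ball (0 : State n) η, ∀ i, ‖S.l i a‖ ≤ c := fun a ha i => by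
    refine ((h1 a ha).1 _).trans (le_of_eq ?_)
    have h2 : ∀ j, |inner ℝ (S.l i a) (S.r j a)| = if i = j then (1 : ℝ) else 0 := fun j => by
      rw [inner_l_r (h1 a ha).1]; split_ifs <;> simp
    simp [h2]
  have hL0 : (0 : ℝ) ≤ L := L.2
  have hn : (0 : ℝ) ≤ n := Nat.cast_nonneg n
  refine ⟨c + c * (n * (c * L)), by positivity, η, hη, fun a ha => ⟨fun i j => ?_, fun i => ?_,
    fun b hb i => ?_⟩⟩
  · rw [(h1 a ha).2, inner_l_r (h1 a ha).1]
  · have := hl a ha i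
    have h3 : 0 ≤ c * (n * (c * L)) := by positivity
    linarith
  -- Duality moves the increment from the left eigenvectors to the right ones, which are Lipschitz:
  -- `(lᵢ(a) - lᵢ(b)) · rⱼ(b) = lᵢ(a) · (rⱼ(b) - rⱼ(a))`.
  · have h2 : ∀ j, |inner ℝ (S.l i a - S.l i b) (S.r j b)| ≤ c * L * ‖a - b‖ := fun j => by
      have h3 : inner ℝ (S.l i a - S.l i b) (S.r j b) =
          inner ℝ (S.l i a) (S.r j b - S.r j a) := by
        rw [inner_sub_left, inner_sub_right, inner_l_r (h1 a ha).1, inner_l_r (h1 b hb).1]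
      rw [h3, mul_assoc]
      refine (abs_real_inner_le_norm _ _).trans (mul_le_mul (hl a ha i) ?_ (norm_nonneg _) hc)
      rw [← (h1 a ha).2, ← (h1 b hb).2, norm_sub_rev, ← dist_eq_norm]
      refine ((hL j).dist_le_mul _ _).trans (le_of_eq ?_)
      rw [dist_prodMk_left]
    have h4 : ∑ j, |inner ℝ (S.l i a - S.l i b) (S.r j b)| ≤ n * (c * L * ‖a - b‖) := by
      refine (Finset.sum_le_sum fun j _ => h2 j).trans (le_of_eq ?_)
      simp
    have h5 := mul_le_mul_of_nonneg_left h4 hc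
    have h6 := (h1 b hb).1 (S.l i a - S.l i b)
    have h7 : 0 ≤ c * ‖a - b‖ := by positivity
    nlinarith

/-! ### The estimates for the wave strengths -/

theorem sum_abs_le {σ : Fin n → ℝ} {c : ℝ} (h : ‖σ‖ ≤ c) : ∑ i, |σ i| ≤ n * c := by
  refine (Finset.sum_le_sum fun i _ => (norm_le_pi_norm σ i).trans h).trans (le_of_eq ?_)
  simp

/-- Glimm's interaction estimate. The state reached by the fans `σ` and then `τ` is close to the one
reached by `σ + τ`, up to the amount of interaction, and the Lipschitz inverse `h` turns this into
an estimate for the strengths. -/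
theorem Admissible.eventually_glimm (hS : S.Admissible) (hL : ∀ j, LipschitzWith L (G j))
    (hM0 : 0 ≤ M) (hM : ∀ j q, ‖G j q‖ ≤ M) (hG : ∀ j, IsLaxFamily S j (G j))
    {J : Finset (Fin n)} (hJ : ∀ j, S.GenuinelyNonlinear j → j ∈ J)
    {h : State n × State n → Fin n → ℝ} {K : ℝ≥0} (hh : IsWaveStrength G h K) :
    ∀ᶠ t in 𝓝 (0 : State n × State n × State n),
      ‖h (t.1, t.2.2) - h (t.1, t.2.1) - h (t.2.1, t.2.2)‖ ≤
      K * ((1 + L) ^ n * ((1 + L) ^ n * (2 * L * (1 + M))) *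
        interaction J (h (t.1, t.2.1)) (h (t.2.1, t.2.2))) := by
  have c1 : Tendsto (fun t : State n × State n × State n => (t.1, t.2.1)) (𝓝 0) (𝓝 0) :=
    (by fun_prop : Continuous fun t : State n × State n × State n => (t.1, t.2.1)).tendsto' _ _ rfl
  have c2 : Tendsto (fun t : State n × State n × State n => (t.2.1, t.2.2)) (𝓝 0) (𝓝 0) :=
    (by fun_prop : Continuous fun t : State n × State n × State n =>
      (t.2.1, t.2.2)).tendsto' _ _ rfl
  have c3 : Tendsto (fun t : State n × State n × State n => (t.1, t.2.2)) (𝓝 0) (𝓝 0) :=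
    (by fun_prop : Continuous fun t : State n × State n × State n => (t.1, t.2.2)).tendsto' _ _ rfl
  have c4 : Tendsto (fun t : State n × State n × State n => t.1) (𝓝 0) (𝓝 0) :=
    continuous_fst.tendsto _
  have hσ := hh.tendsto.comp c1
  have hτ := hh.tendsto.comp c2
  have hp : Tendsto (fun t : State n × State n × State n =>
      (h (t.1, t.2.1) + h (t.2.1, t.2.2), t.1)) (𝓝 0) (𝓝 (0 : (Fin n → ℝ) × State n)) := by
    have := (hσ.add hτ).prodMk_nhds c4
    rwa [add_zero] at this
  obtain ⟨s, hs, hK⟩ := hh.lipschitz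
  have hsmall : ∀ᶠ σ in 𝓝 (0 : Fin n → ℝ), ∀ i, |σ i| ≤ 1 / 2 := by
    filter_upwards [Metric.ball_mem_nhds (0 : Fin n → ℝ) (show (0 : ℝ) < 1 / 2 by norm_num)]
      with σ hσ i
    exact (norm_le_pi_norm σ i).trans (mem_ball_zero_iff.1 hσ).le
  have hmerge : ∀ᶠ t in 𝓝 (0 : State n × State n × State n), ∀ j,
      (S.LinearlyDegenerate j ∨ 0 ≤ h (t.2.1, t.2.2) j ∧ 0 ≤ h (t.1, t.2.1) j) →
      flowMap (G j) (h (t.2.1, t.2.2) j) (flowMap (G j) (h (t.1, t.2.1) j)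
        (stage (zeroExtend G) (zeroExtend (h (t.1, t.2.1) + h (t.2.1, t.2.2))) t.1 j)) =
      flowMap (G j) (h (t.2.1, t.2.2) j + h (t.1, t.2.1) j)
        (stage (zeroExtend G) (zeroExtend (h (t.1, t.2.1) + h (t.2.1, t.2.2))) t.1 j) := by
    refine eventually_all.2 fun j => ?_
    have h1 := (((continuous_apply j).tendsto (0 : Fin n → ℝ)).comp hτ).prodMk_nhds
      ((((continuous_apply j).tendsto (0 : Fin n → ℝ)).comp hσ).prodMk_nhds
        ((tendsto_stage hL j).comp hp))
    exact h1.eventually (hG j).merge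
  have hw : Tendsto (fun t : State n × State n × State n =>
      (t.1, waveMap G (h (t.1, t.2.1) + h (t.2.1, t.2.2)) t.1)) (𝓝 0)
      (𝓝 (0 : State n × State n)) :=
    c4.prodMk_nhds ((tendsto_stage hL n).comp hp)
  filter_upwards [hσ.eventually hsmall, hτ.eventually hsmall, hmerge, c1.eventually hh.right_inv,
    c2.eventually hh.right_inv, hp.eventually hh.left_inv, c3 hs, hw hs]
    with t h1 h2 h3 h4 h5 h6 h7 h8
  have h9 := norm_waveMap_waveMap_sub_le hL hM0 hM J (u := t.1) h1 h2
    (fun j hj => h3 j (hj.imp (fun hj => (hS.field j).resolve_left fun h => hj (hJ j h)) id))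
  simp only [Function.comp_apply] at h9
  rw [h4, h5] at h9
  have h10 := hK.dist_le_mul _ h7 _ h8
  rw [h6, dist_eq_norm, Prod.dist_eq, dist_self, max_eq_right dist_nonneg, dist_eq_norm] at h10
  rw [sub_sub]
  exact h10.trans (mul_le_mul_of_nonneg_left h9 K.2)

end ConservationLaw

theorem FanEstimates.congr {n : ℕ} {J : Finset (Fin n)} {E E' : State n → State n → Fin n → ℝ}
    {l : Fin n → State n → State n} {η η' K : ℝ} (h : FanEstimates J E l η K) (hη' : 0 < η')
    (hle : η' ≤ η)
    (hE : ∀ a ∈ Metric.ball 0 η', ∀ b ∈ Metric.ball 0 η', E' a b = E a b) :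
    FanEstimates J E' l η' K := by
  have hb := Metric.ball_subset_ball (x := (0 : State n)) hle
  refine ⟨hη', h.nonneg, fun a ha => ?_, fun a ha b hb' a' ha' b' hb'' i => ?_,
    fun a ha b hb' i => ?_, fun a ha b hb' i => h.left a (hb ha) b (hb hb') i,
    fun a ha m hm b hb' i => ?_⟩
  · rw [hE a ha a ha]; exact h.self a (hb ha)
  · rw [hE a ha b hb', hE a' ha' b' hb'']
    exact h.lipschitz a (hb ha) b (hb hb') a' (hb ha') b' (hb hb'') i
  · rw [hE a ha b hb']; exact h.tangent a (hb ha) b (hb hb') i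
  · rw [hE a ha b hb', hE a ha m hm, hE m hm b hb']
    exact h.glimm a (hb ha) m (hb hm) b (hb hb') i

namespace ConservationLaw

variable {n : ℕ} {S : ConservationLaw n} {G : Fin n → ℝ × State n → State n} {L : ℝ≥0} {M : ℝ}

theorem Admissible.exists_fanEstimates (hS : S.Admissible) (hL : ∀ j, LipschitzWith L (G j))
    (hM0 : 0 ≤ M) (hM : ∀ j q, ‖G j q‖ ≤ M) (hG : ∀ j, IsLaxFamily S j (G j))
    {J : Finset (Fin n)} (hJ : ∀ j, S.GenuinelyNonlinear j → j ∈ J)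
    {h : State n × State n → Fin n → ℝ} {K : ℝ≥0} (hh : IsWaveStrength G h K) :
    ∃ η C, FanEstimates J (fun a b => h (a, b)) S.l η C := by
  have hL0 : (0 : ℝ) ≤ L := L.2
  have hK0 : (0 : ℝ) ≤ K := K.2
  have hn : (0 : ℝ) ≤ n := Nat.cast_nonneg n
  obtain ⟨c, hc, η₁, hη₁, hl⟩ := hS.exists_left hL hG
  obtain ⟨s, hs, hK⟩ := hh.lipschitz
  obtain ⟨η₂, hη₂, h2⟩ := exists_ball_of_eventually (hh.right_inv.and hs)
  obtain ⟨η₃, hη₃, h3⟩ := exists_ball_of_eventually (hS.eventually_glimm hL hM0 hM hG hJ hh)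
  obtain ⟨η₄, hη₄, h4⟩ := exists_ball_of_eventually
    (((by fun_prop : Continuous fun u : State n => ((0 : Fin n → ℝ), u)).tendsto' 0 0
      rfl).eventually hh.left_inv)
  set η := min (min η₁ η₂) (min η₃ η₄) with hη
  have m1 : ∀ a ∈ Metric.ball (0 : State n) η, a ∈ Metric.ball (0 : State n) η₁ := fun a ha =>
    Metric.ball_subset_ball ((min_le_left _ _).trans (min_le_left _ _)) ha
  have m2 : ∀ a ∈ Metric.ball (0 : State n) η, ∀ b ∈ Metric.ball (0 : State n) η,
      (a, b) ∈ Metric.ball (0 : State n × State n) η₂ := fun a ha b hb => by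
    rw [mem_ball_zero_iff] at ha hb ⊢
    exact (max_lt ha hb).trans_le ((min_le_left _ _).trans (min_le_right _ _))
  have m3 : ∀ a ∈ Metric.ball (0 : State n) η, ∀ m ∈ Metric.ball (0 : State n) η,
      ∀ b ∈ Metric.ball (0 : State n) η,
      (a, m, b) ∈ Metric.ball (0 : State n × State n × State n) η₃ := fun a ha m hm b hb => by
    rw [mem_ball_zero_iff] at ha hm hb ⊢
    exact (max_lt ha (max_lt hm hb)).trans_le ((min_le_right _ _).trans (min_le_left _ _))
  have m4 : ∀ a ∈ Metric.ball (0 : State n) η, a ∈ Metric.ball (0 : State n) η₄ := fun a ha =>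
    Metric.ball_subset_ball ((min_le_right _ _).trans (min_le_right _ _)) ha
  have hself : ∀ a ∈ Metric.ball (0 : State n) η, h (a, a) = 0 := fun a ha => by
    have := h4 a (m4 a ha)
    simp only [waveMap_zero] at this
    exact this
  have hlip : ∀ a ∈ Metric.ball (0 : State n) η, ∀ b ∈ Metric.ball (0 : State n) η,
      ∀ a' ∈ Metric.ball (0 : State n) η, ∀ b' ∈ Metric.ball (0 : State n) η,
      ‖h (a, b) - h (a', b')‖ ≤ K * (‖a - a'‖ + ‖b - b'‖) := fun a ha b hb a' ha' b' hb' => by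
    rw [← dist_eq_norm]
    refine (hK.dist_le_mul _ (h2 _ (m2 a ha b hb)).2 _ (h2 _ (m2 a' ha' b' hb')).2).trans
      (mul_le_mul_of_nonneg_left ?_ hK0)
    rw [Prod.dist_eq, dist_eq_norm, dist_eq_norm]
    exact max_le_add_of_nonneg (norm_nonneg _) (norm_nonneg _)
  set C₂ := c * (L * (1 + M) * (n * K) ^ 2) with hC₂
  set C₃ := K * ((1 + L) ^ n * ((1 + L) ^ n * (2 * L * (1 + M))) : ℝ) with hC₃
  have hC₂0 : 0 ≤ C₂ := by positivity
  have hC₃0 : 0 ≤ C₃ := by positivity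
  refine ⟨η, K + C₂ + c + C₃, by positivity, by positivity, hself, ?_, ?_, ?_, ?_⟩
  · intro a ha b hb a' ha' b' hb' i
    refine (norm_le_pi_norm (h (a, b) - h (a', b')) i).trans
      ((hlip a ha b hb a' ha' b' hb').trans (mul_le_mul_of_nonneg_right ?_ (by positivity)))
    linarith
  · intro a ha b hb i
    have h5 : ‖h (a, b)‖ ≤ K * ‖b - a‖ := by
      have := hlip a ha b hb a ha a ha
      rwa [hself a ha, sub_zero, sub_self, norm_zero, zero_add] at this
    have h6 := norm_waveMap_sub_sum_le hL hM0 hM (h (a, b)) a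
    have h7 := (h2 _ (m2 a ha b hb)).1
    simp only at h7
    rw [h7] at h6
    -- The dual eigenvector `lᵢ(a)` extracts `h (a, b) i` from the first-order expansion of the fan
    -- at `a`, so only the quadratic remainder of that expansion is left.
    have h8 : inner ℝ (S.l i a) (b - a) - h (a, b) i =
        inner ℝ (S.l i a) (b - a - ∑ j, h (a, b) j • G j (0, a)) := by
      rw [inner_sub_right _ (b - a), inner_sum]
      simp only [inner_smul_right, (hl a (m1 a ha)).1]
      simp
    rw [← abs_neg, neg_sub, h8]
    calc _ ≤ ‖S.l i a‖ * ‖b - a - ∑ j, h (a, b) j • G j (0, a)‖ := abs_real_inner_le_norm _ _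
      _ ≤ c * (L * (1 + M) * (n * (K * ‖b - a‖)) ^ 2) := by
          refine mul_le_mul ((hl a (m1 a ha)).2.1 i) (h6.trans ?_) (norm_nonneg _) hc
          refine mul_le_mul_of_nonneg_left ?_ (by positivity)
          exact pow_le_pow_left₀ (Finset.sum_nonneg fun _ _ => abs_nonneg _) (sum_abs_le h5) 2
      _ = C₂ * ‖b - a‖ ^ 2 := by rw [hC₂]; ring
      _ ≤ _ := mul_le_mul_of_nonneg_right (by linarith) (by positivity)
  · intro a ha b hb i
    exact ((hl a (m1 a ha)).2.2 b (m1 b hb) i).trans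
      (mul_le_mul_of_nonneg_right (by linarith) (norm_nonneg _))
  · intro a ha m hm b hb i
    have h5 := h3 _ (m3 a ha m hm b hb)
    simp only at h5
    refine (norm_le_pi_norm (h (a, b) - h (a, m) - h (m, b)) i).trans (h5.trans ?_)
    rw [← mul_assoc]
    exact mul_le_mul_of_nonneg_right (by linarith) (interaction_nonneg _ _ _)

/-! ### The Riemann problem -/

theorem IsLax.mono {B B' : Set (State n)} (h : B ⊆ B') {j : Fin n} {u w : State n} {σ : ℝ}
    (hw : S.IsLax B j u σ w) : S.IsLax B' j u σ w :=
  hw.imp (And.imp_right fun h' => h'.mono h) (And.imp_right fun h' => h'.mono h)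

theorem exists_pos_forall_le {ι : Type*} [Finite ι] {R : ι → ℝ} (h : ∀ i, 0 < R i) :
    ∃ r > 0, ∀ i, r ≤ R i := by
  have h1 : ∀ᶠ r in 𝓝[>] (0 : ℝ), ∀ i, r ≤ R i :=
    eventually_all.2 fun i => mem_of_superset (Ioc_mem_nhdsGT (h i)) fun r hr => hr.2
  obtain ⟨r, hr, hr0⟩ := (h1.and eventually_mem_nhdsWithin).exists
  exact ⟨r, hr0, hr⟩

/-- Curves confined to a small ball have small parameters, so inside it the relational Riemann
solver is the map `waveMap` at small strengths; the radius depends on `s₀` alone and serves all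
smaller balls. -/
theorem IsLaxFamily.exists_ball (hG : ∀ j, IsLaxFamily S j (G j)) {s₀ : ℝ} (hs₀ : 0 < s₀) :
    ∃ R > 0, ∀ ρ ≤ R, ∀ a σ b, S.IsWaveDecomposition (Metric.ball 0 ρ) a σ b →
      (∀ i, |σ i| ≤ s₀) ∧ b = waveMap G σ a := by
  choose R hR h using fun j => (hG j).uniq s₀ hs₀
  obtain ⟨r, hr, hrR⟩ := exists_pos_forall_le hR
  refine ⟨r, hr, ?_⟩
  rintro ρ hρ a σ b ⟨ω, rfl, rfl, hω⟩
  have h1 : ∀ i : Fin n, |σ i| ≤ s₀ ∧ ω i.succ = flowMap (G i) (σ i) (ω i.castSucc) := fun i =>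
    h i _ _ _ ((hω i).mono (Metric.ball_subset_ball (hρ.trans (hrR i))))
  have h2 : ∀ i : Fin (n + 1), ω i = stage (zeroExtend G) (zeroExtend σ) (ω 0) i := by
    intro i
    induction i using Fin.induction with
    | zero => rfl
    | succ i ih =>
      rw [(h1 i).2, ih, Fin.val_succ, stage, zeroExtend_val, zeroExtend_val]
      rfl
  exact ⟨fun i => (h1 i).1, h2 (Fin.last n)⟩

theorem IsLaxFamily.isWaveDecomposition (hL : ∀ j, LipschitzWith L (G j))
    (hG : ∀ j, IsLaxFamily S j (G j)) {ρ : ℝ} (hρ : 0 < ρ) :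
    ∀ᶠ p in 𝓝 (0 : (Fin n → ℝ) × State n),
      S.IsWaveDecomposition (Metric.ball 0 ρ) p.2 p.1 (waveMap G p.1 p.2) := by
  have h1 : ∀ᶠ p in 𝓝 (0 : (Fin n → ℝ) × State n), ∀ j : Fin n, S.IsLax (Metric.ball 0 ρ) j
      (stage (zeroExtend G) (zeroExtend p.1) p.2 j) (p.1 j)
      (flowMap (G j) (p.1 j) (stage (zeroExtend G) (zeroExtend p.1) p.2 j)) := by
    refine eventually_all.2 fun j => ?_
    have h2 : Tendsto (fun p : (Fin n → ℝ) × State n => p.1 j) (𝓝 0) (𝓝 0) :=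
      (by fun_prop : Continuous fun p : (Fin n → ℝ) × State n => p.1 j).tendsto' _ _ rfl
    exact (h2.prodMk_nhds (tendsto_stage hL j)).eventually ((hG j).exist ρ hρ)
  filter_upwards [h1] with p hp
  refine ⟨fun i => stage (zeroExtend G) (zeroExtend p.1) p.2 i, rfl, rfl, fun i => ?_⟩
  have := hp i
  rw [← zeroExtend_val G i, ← zeroExtend_val p.1 i] at this
  rw [← zeroExtend_val p.1 i]
  exact this

theorem E_spec {B : Set (State n)} {a b : State n}
    (h : ∃ σ, S.IsWaveDecomposition B a σ b) : S.IsWaveDecomposition B a (S.E B a b) b := by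
  rw [E, dif_pos h]
  exact h.choose_spec

/-- Confinement to the ball makes the strengths of any decomposition so small that the local inverse
recovers them, which gives uniqueness; existence comes from the right inverse. The first clause
needs no restriction to states near the origin, since confinement in the ball is enough. -/
theorem IsWaveStrength.riemann (hL : ∀ j, LipschitzWith L (G j))
    (hG : ∀ j, IsLaxFamily S j (G j)) {h : State n × State n → Fin n → ℝ} {K : ℝ≥0}
    (hh : IsWaveStrength G h K) : ∃ R > 0, ∀ ρ, 0 < ρ → ρ ≤ R →
      (∀ a σ b, S.IsWaveDecomposition (Metric.ball 0 ρ) a σ b → b = waveMap G σ a) ∧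
      ∃ η > 0, ∀ a ∈ Metric.ball (0 : State n) η, ∀ b ∈ Metric.ball (0 : State n) η, ∀ σ,
        S.IsWaveDecomposition (Metric.ball 0 ρ) a σ b ↔ σ = h (a, b) := by
  obtain ⟨r, hr, h1⟩ := exists_ball_of_eventually hh.left_inv
  obtain ⟨R, hR, h2⟩ := IsLaxFamily.exists_ball hG (half_pos hr)
  refine ⟨R, hR, fun ρ hρ hρR => ⟨fun a σ b hw => (h2 ρ hρR a σ b hw).2, ?_⟩⟩
  have hlim : Tendsto (fun q : State n × State n => (h q, q.1)) (𝓝 0)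
      (𝓝 (0 : (Fin n → ℝ) × State n)) := hh.tendsto.prodMk_nhds (continuous_fst.tendsto _)
  obtain ⟨η, hη, h3⟩ := exists_ball_of_eventually
    (hh.right_inv.and (hlim.eventually (IsLaxFamily.isWaveDecomposition hL hG hρ)))
  refine ⟨min η r, by positivity, fun a ha b hb σ => ⟨fun hw => ?_, ?_⟩⟩
  · obtain ⟨h4, h5⟩ := h2 ρ hρR a σ b hw
    have h6 := h1 (σ, a) (by
      rw [mem_ball_zero_iff] at ha ⊢
      refine max_lt ?_ (ha.trans_le (min_le_right _ _))
      exact ((pi_norm_le_iff_of_nonneg (half_pos hr).le).2 h4).trans_lt (half_lt_self hr))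
    rw [h5]
    exact h6.symm
  · rintro rfl
    obtain ⟨h4, h5⟩ := h3 (a, b) (by
      rw [mem_ball_zero_iff] at ha hb ⊢
      exact (max_lt ha hb).trans_le (min_le_left _ _))
    simp only at h4 h5
    rwa [h4] at h5

end ConservationLaw

theorem mainTheorem3 {n : ℕ} (S : ConservationLaw n) (hS : S.Admissible) :
    ∃ R > 0, ∃ C > 0, ∀ ρ : ℝ, 0 < ρ → ρ ≤ R →
      Metric.ball (0 : State n) ρ ⊆ S.Ω ∧
      (∃ η > 0, ∀ u ∈ Metric.ball (0 : State n) η, ∀ w ∈ Metric.ball (0 : State n) η,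
        ∃! σ : Fin n → ℝ, S.IsWaveDecomposition (Metric.ball 0 ρ) u σ w) ∧
      ∀ C₀ : ℝ, C ≤ C₀ → ∃ δ₀ > 0, ∀ δ : ℝ, 0 < δ → δ < δ₀ →
        (∀ w ∈ S.D (Metric.ball 0 ρ) C₀ δ, ∃ u, IsBVRepresentative w u) ∧
        ∀ J : Finset (Fin n), (∀ j, S.GenuinelyNonlinear j → j ∈ J) →
          LowerSemicontinuousOn (S.QHat (Metric.ball 0 ρ) J) (S.D (Metric.ball 0 ρ) C₀ δ) ∧
          LowerSemicontinuousOn (S.UpsilonHat (Metric.ball 0 ρ) J C₀)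
            (S.D (Metric.ball 0 ρ) C₀ δ) := by
  classical
  obtain ⟨G, L, M', hL, hM', hG⟩ := hS.exists_isLaxFamily
  set M := |M'| with hMdef
  have hM0 : 0 ≤ M := abs_nonneg _
  have hM : ∀ j q, ‖G j q‖ ≤ M := fun j q => (hM' j q).trans (le_abs_self _)
  obtain ⟨φ, hφ, hexp⟩ := hS.exists_dual
  have hG0 : ∀ j, G j 0 = S.r j 0 := fun j => (hG j).zero.self_of_nhds
  obtain ⟨h, K₀, hh⟩ := exists_isWaveStrength hL (φ := φ) (by simpa only [hG0] using hφ)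
    (by simpa only [hG0] using hexp)
  set J₀ : Finset (Fin n) := Finset.univ.filter fun j => S.GenuinelyNonlinear j with hJ₀
  obtain ⟨η₀, K, hF⟩ := hS.exists_fanEstimates hL hM0 hM hG (J := J₀) (by simp [hJ₀]) hh
  obtain ⟨R₁, hR₁, hR⟩ := ConservationLaw.IsWaveStrength.riemann hL hG hh
  obtain ⟨R₂, hR₂, hΩ⟩ := Metric.isOpen_iff.1 hS.isOpen 0 hS.zero_mem
  have hn : (0 : ℝ) ≤ n := Nat.cast_nonneg n
  have hK := hF.nonneg
  -- The constant `K` belongs to the local inverse `h` and was fixed before `ρ`, so the threshold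
  -- for `C₀` is uniform in `ρ`; the summand `1` only makes it positive.
  refine ⟨min R₁ R₂, by positivity, 2 * n * K + 1, by positivity, fun ρ hρ hρR => ?_⟩
  obtain ⟨hmap, η₁, hη₁, hiff⟩ := hR ρ hρ (hρR.trans (min_le_left _ _))
  refine ⟨(Metric.ball_subset_ball (hρR.trans (min_le_right _ _))).trans hΩ,
    ⟨η₁, hη₁, fun u hu w hw => ⟨h (u, w), (hiff u hu w hw _).2 rfl,
      fun σ hσ => (hiff u hu w hw σ).1 hσ⟩⟩, fun C₀ hC₀ => ?_⟩
  have hη : 0 < min η₀ η₁ := lt_min hF.pos hη₁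
  -- By uniqueness in the Riemann problem, the chosen strengths `E` coincide with `h` near the
  -- origin and inherit its estimates.
  have hF' : FanEstimates J₀ (S.E (Metric.ball 0 ρ)) S.l (min η₀ η₁) K :=
    hF.congr hη (min_le_left _ _) fun a ha b hb => by
      have ha' := Metric.ball_subset_ball (min_le_right _ _) ha
      have hb' := Metric.ball_subset_ball (min_le_right _ _) hb
      exact (hiff a ha' b hb' _).1 (ConservationLaw.E_spec ⟨_, (hiff a ha' b hb' _).2 rfl⟩)
  -- This is needed for all states with a decomposition inside the ball, since at this stage the
  -- values of functions in `𝒟_δ^*` are not yet known to be close to `0`.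
  have hE : ∀ a b, (∃ σ, S.IsWaveDecomposition (Metric.ball 0 ρ) a σ b) →
      ‖b - a‖ ≤ M * ∑ i, |S.E (Metric.ball 0 ρ) a b i| := fun a b hab => by
    have h1 := hmap a _ b (ConservationLaw.E_spec hab)
    conv_lhs => rw [h1]
    exact norm_waveMap_sub_le hM0 hM _ _
  have hC₀0 : 0 ≤ C₀ := le_trans (by positivity) hC₀
  -- Values and variation of the functions in `𝒟_δ` are at most `M * δ`. The first condition keeps
  -- the values where the fan estimates hold; the second makes the total strength so small that
  -- merging fans decreases the potential.
  have hlim : ∀ᶠ δ in 𝓝 (0 : ℝ), M * δ < min η₀ η₁ ∧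
      2 * n * (2 * n) * K * (n * K * (M * δ)) < 1 / 2 :=
    (ContinuousAt.eventually_lt (by fun_prop) continuousAt_const (by simpa using hη)).and
      (ContinuousAt.eventually_lt (by fun_prop) continuousAt_const (by simp))
  obtain ⟨δ₀, hδ₀, hδ⟩ := Metric.eventually_nhds_iff_ball.1 hlim
  refine ⟨δ₀, hδ₀, fun δ hδ0 hδlt => ?_⟩
  obtain ⟨h1, h2⟩ := hδ δ (by rwa [mem_ball_zero_iff, Real.norm_eq_abs, abs_of_pos hδ0])
  have hD : ∀ w ∈ S.D (Metric.ball 0 ρ) C₀ δ, ∃ u, w =ᵐ[volume] u ∧ IsTame (M * δ) u :=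
    fun w hw => ConservationLaw.exists_isTame_of_mem_D hM0 hC₀0 hδ0.le hE hw
  refine ⟨fun w hw => ?_, fun J hJ => ?_⟩
  · obtain ⟨u, hwu, hu⟩ := hD w hw
    exact ⟨u, hu.isBVRepresentative hwu⟩
  · exact ConservationLaw.lowerSemicontinuousOn_hat hF' h1
      (fun j hj => hJ j (Finset.mem_filter.1 hj).2) h2.le (by linarith) hD
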